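/- **Notation.** Identify $SU(2)$ with the unit quaternions and $su(2)$ with the purely imaginary quaternions. For a group $G$ let $\mathcal M(G)=\operatorname{Hom}(G,SU(2))/\mathrm{conj}$, with the quotient of the topology of pointwise convergence. A representation is *irreducible* if its stabilizer under conjugation is $\{\pm1\}$, and *abelian* if its stabilizer is a maximal torus $U(1)$ (central representations are neither). Let $F$ be the closed oriented surface of genus $n$ obtained from the sphere $S_0$ with $2n$ disks (around points $a_i,b_i$, $i=1,\dots,n$) removed by gluing a cylinder to the $i$-th pair of boundary circles for each $i$, so that $$\pi_1(F)=\langle A_i,D_i\mid \textstyle\prod_{i=1}^n[A_i,D_i]=1\rangle,\qquad \pi_1(S_0)=\langle A_i,B_i\mid\textstyle\prod_{i=1}^nA_iB_i^{-1}=1\rangle ,$$ and the inclusion is $A_i\mapsto A_i$, $B_i\mapsto D_iA_iD_i^{-1}$. Write $\mathcal M(F)=\mathcal M(\pi_1(F))$, $\mathcal M(S_0)=\mathcal M(\pi_1(S_0))$, let $r:\mathcal M(F)\to\mathcal M(S_0)$ be restriction, $\mathcal M(F)^{\mathbb Z/2}$ the set of irreducible classes, and $R^{U(1)}\subset\mathcal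 M(S_0)$ the set of classes of abelian representations that send every meridian (conjugate of some $A_i^{\pm1}$ or $B_i^{\pm1}$) to a quaternion of real part $0$. The tangent space of $\mathcal M(F)^{\mathbb Z/2}$ at $[\rho]$ is $H^1(\pi_1(F);su(2)_{\mathrm{ad}\rho})$: the tangent vector of a path $\rho_s$ is the class of the cocycle $g\mapsto \frac{d}{ds}\rho_s(g)\,\rho_s(g)^{-1}$; a map to $\mathcal M(F)^{\mathbb Z/2}$ is a submersion at $t$ if near $t$ it has a smooth lift to $\operatorname{Hom}(\pi_1(F),SU(2))$ and its differential at $t$ is onto this space. **Perturbations.** Let $C\subset F$ be an oriented simple closed curve, joined to the base point by an arc so as to give $c\in\pi_1(F)$, and let $N_C$ be a tube around $C\times\{\frac12\}$ in $F\times I$, framed by the surface. Then $\pi_1(F\times I\setminus N_C)=\langle \pi_1(F),m\mid [m,c]=1\rangle$ with $\pi_1(F)=\pi_1(F\times\{0\})$, longitude $c$ and meridian $m$. For $t\in\mathbb R$ every $\rho:\pi_1(F)\to SU(2)$ has a unique extension $\tilde\rho$ to this group with $\tilde\rho(m)=F_t(\tilde\rho(c))$, where $F_t(e^{\alpha Q})=e^{t\sin(\alpha)Q}$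 for purely imaginary unit quaternions $Q$. Restricting $\tilde\rho$ to $\pi_1(F\times\{1\})$ defines $\Phi_{C,t}:\mathcal M(F)\to\mathcal M(F)$. Explicitly, a based generator $E\in\{A_l,D_l\}$ of $\pi_1(F\times\{1\})$ equals $\bigl(\prod_k g_km^{s_k}g_k^{-1}\bigr)E$, the product being over the successive crossings of the based loop $E$ with $C$, where $s_k$ is the sign of the crossing and $g_kcg_k^{-1}$ is the longitude of $C$ based along $E$ up to that crossing. For $\mathbf C=(C_1,\dots,C_K)$ and $t\in\mathbb R^K$ put $\Phi_{\mathbf C}(\cdot,t)=\Phi_{C_K,t_K}\circ\dots\circ\Phi_{C_1,t_1}$. **The curves.** Sectors are indexed cyclically. For $i\ne j$ let $Z=\prod_{l=i+1}^{j-1}[A_l,D_l]$ and $V=[A_i,D_i]\,Z\,[A_j,D_j]$ (cyclic products). The special perturbation curves are $C_{I}(i),C_{II}(i),C_{III}(i)$ for $1\le i\le n$ and $C_{IV}(ij),\dots,C_{XI}(ij)$ for $i\ne j$; they are given by the words $c$ and the crossings $E:(s,g)$ as follows. - $I$: $c=D_i$; $A_i:(-1,A_i)$. - $II$: $c=A_i$;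 $D_i:(1,D_i)$. - $III$: $c=D_iA_i$; $D_i:(1,1)$, $A_i:(-1,A_i)$. - $IV$: $c=D_j^{-1}A_i$; $D_i:(1,1)$, $A_j:(1,1)$; arcs $s=1$, $p=1$, $q=D_j$. - $V$: $c=D_jD_i$; $A_i:(-1,1)$, $A_j:(-1,D_i)$; arcs $s=-1$, $p=D_i$, $q=1$. - $VI$: $c=A_jA_iD_i$; $A_i:(-1,A_i)$, $D_i:(1,1)$, $D_j:(1,A_j^{-1})$; arcs $s=1$, $p=1$, $q=A_j^{-1}$. - $VII$: $c=D_j^{-1}A_iD_i$; $D_i:(1,1)$, $A_i:(-1,A_i)$, $A_j:(1,1)$; arcs $s=1$, $p=1$, $q=D_j$. - $VIII$: $c=ZD_j^{-1}V^{-1}A_i$; $D_i:(1,1)$, $A_j:(1,Z^{-1})$. - $IX$: $c=ZD_j^{-1}V^{-1}A_iD_i$; $D_i:(1,1)$, $A_j:(1,Z^{-1})$, $A_i:(-1,A_i)$. - $X$: $c=VD_jZ^{-1}D_i$; $A_i:(-1,1)$, $A_j:(-1,Z^{-1}D_i)$. - $XI$: $c=ZA_jV^{-1}A_iD_i$; $D_i:(1,1)$,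 $A_i:(-1,A_i)$, $D_j:(1,(ZA_j)^{-1})$. Here "arcs $s,p,q$" means that for $l\ne i,j$ each $E\in\{A_l,D_l\}$ has two crossings, on the arc joining it to the base point: $(s,g)$ and then $(-s,Eg)$, where $g=p$ if $l$ lies strictly between $i$ and $j$ in the cyclic order and $g=q$ otherwise. There are no other crossings. **Proposition.** Let $\mathbf C$ be any ordering of the $K=3n+8n(n-1)=8n^2-5n$ special perturbation curves. 1. If $\rho:\pi_1(F)\to SU(2)$ is irreducible, its restriction to $\pi_1(S_0)$ is abelian, and $\operatorname{Re}\rho(A_i)=0$ for $i=1,\dots,n$, then $t\mapsto\Phi_{\mathbf C}([\rho],t)$ maps $\mathbb R^K$ to $\mathcal M(F)^{\mathbb Z/2}$ and has surjective differential at $0$ (it is a submersion at $0$). 2. The set $\mathcal E$ of conjugacy classes of such $\rho$ equals $r^{-1}(R^{U(1)})\cap\mathcal M(F)^{\mathbb Z/2}$; it is compact, and it is a finite (possibly empty) union of subsets homeomorphic to the $(n-1)$-dimensional torus. 3. There is an open neighborhood $U_1\subset\mathbb R^K$ of $0$ such that, for every $x\in\mathcal E$, the map $\Phi_{\mathbf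 C}(x,\cdot):U_1\to\mathcal M(F)^{\mathbb Z/2}$ is a submersion. -/

import Mathlib

open scoped Quaternion Topology ContDiff commutatorElement

noncomputable section

namespace TracelessTangle

/-! ### The group `SU(2)` of unit quaternions and representation spaces -/

/-- `SU(2)`, identified with the group of unit quaternions. -/
abbrev SU2 : Type := unitary ℍ[ℝ]

/-- Real part of a unit quaternion (one half of the trace of the matrix). -/
def SU2.re (q : SU2) : ℝ := (q : ℍ[ℝ]).re

/-- The Lie algebra `su(2)`: the purely imaginary quaternions. -/
def su2 : Submodule ℝ ℍ[ℝ] where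
  carrier := {v | v.re = 0}
  add_mem' := by
    intro a b (ha : a.re = 0) (hb : b.re = 0)
    change (a + b).re = 0
    simp [ha, hb]
  zero_mem' := by simp
  smul_mem' := by
    intro c a (ha : a.re = 0)
    change (c • a).re = 0
    simp [ha]

/-- `Hom(G, SU(2))`. -/
def RepSpace (G : Type) [Group G] : Type := G →* SU2

variable {G : Type} [Group G]

instance : FunLike (RepSpace G) G SU2 := inferInstanceAs (FunLike (G →* SU2) G SU2)

instance : MonoidHomClass (RepSpace G) G SU2 :=
  inferInstanceAs (MonoidHomClass (G →* SU2) G SU2)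

/-- `Hom(G, SU(2))` has the topology of pointwise convergence; for generators `x₁, …, x_q` of `G`
this is the subspace topology from `SU(2)^q`. -/
instance : TopologicalSpace (RepSpace G) :=
  TopologicalSpace.induced (fun (ρ : RepSpace G) (g : G) => ρ g) inferInstance

/-- Conjugacy of representations. -/
instance conjSetoid (G : Type) [Group G] : Setoid (RepSpace G) where
  r ρ σ := ∃ h : SU2, ∀ g, σ g = h * ρ g * h⁻¹
  iseqv :=
    { refl := fun ρ => ⟨1, fun g => by simp⟩
      symm := by
        rintro ρ σ ⟨h, H⟩
        exact ⟨h⁻¹, fun g => by rw [H g]; group⟩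
      trans := by
        rintro ρ σ τ ⟨h, H⟩ ⟨k, K⟩
        exact ⟨k * h, fun g => by rw [K g, H g]; group⟩ }

/-- The character variety `Hom(G, SU(2)) / conjugation`, with the quotient topology. -/
def CharVar (G : Type) [Group G] : Type := Quotient (conjSetoid G)

instance : TopologicalSpace (CharVar G) :=
  inferInstanceAs (TopologicalSpace (Quotient (conjSetoid G)))

/-- The conjugacy class of a representation. -/
def CharVar.mk (ρ : RepSpace G) : CharVar G := Quotient.mk (conjSetoid G) ρ

/-- The stabilizer of a representation under conjugation. -/
def stab (ρ : RepSpace G) : Subgroup SU2 where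
  carrier := {h | ∀ g, h * ρ g * h⁻¹ = ρ g}
  one_mem' := fun g => by simp
  mul_mem' := by
    intro h k hh hk g
    calc h * k * ρ g * (h * k)⁻¹ = h * (k * ρ g * k⁻¹) * h⁻¹ := by group
      _ = ρ g := by rw [hk g, hh g]
  inv_mem' := by
    intro h hh g
    calc h⁻¹ * ρ g * h⁻¹⁻¹ = h⁻¹ * (h * ρ g * h⁻¹) * h⁻¹⁻¹ := by rw [hh g]
      _ = ρ g := by group

/-- A representation is irreducible if its stabilizer is `{±1}`. -/
def IsIrredRep (ρ : RepSpace G) : Prop :=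
  ∀ h : SU2, h ∈ stab ρ ↔ ((h : ℍ[ℝ]) = 1 ∨ (h : ℍ[ℝ]) = -1)

/-- A representation is abelian if its stabilizer is a maximal torus
`{cos α + sin α P}` for some purely imaginary unit quaternion `P`
(in particular central representations are not called abelian). -/
def IsAbelianRep (ρ : RepSpace G) : Prop :=
  ∃ P : ℍ[ℝ], P.re = 0 ∧ ‖P‖ = 1 ∧
    ∀ h : SU2, h ∈ stab ρ ↔ ∃ α : ℝ, (h : ℍ[ℝ]) = (Real.cos α : ℍ[ℝ]) + Real.sin α • P

/-- The irreducible stratum `CharVar(G)^{ℤ/2}`. -/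
def irredStratum (G : Type) [Group G] : Set (CharVar G) := CharVar.mk '' {ρ | IsIrredRep ρ}

/-- The conjugate representation `h ρ h⁻¹`. -/
def RepSpace.conj (h : SU2) (ρ : RepSpace G) : RepSpace G :=
  MonoidHom.mk' (fun g => h * ρ g * h⁻¹) (fun a b => by rw [map_mul]; group)

theorem RepSpace.conj_apply (h : SU2) (ρ : RepSpace G) (g : G) :
    RepSpace.conj h ρ g = h * ρ g * h⁻¹ := rfl

/-- Pull-back of representations along a homomorphism. -/
def RepSpace.comap {G' : Type} [Group G'] (f : G' →* G) (ρ : RepSpace G) : RepSpace G' :=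
  MonoidHom.comp (show G →* SU2 from ρ) f

/-- The map of character varieties induced by a homomorphism. -/
def CharVar.comap {G' : Type} [Group G'] (f : G' →* G) : CharVar G → CharVar G' :=
  Quotient.map (RepSpace.comap f) (by
    rintro ρ σ ⟨h, H⟩
    exact ⟨h, fun g => H (f g)⟩)

/-! ### Tangent spaces -/

/-- The adjoint representation `ad ρ` of `G` on `su(2)`. -/
def adRep (ρ : RepSpace G) : Representation ℝ G su2 where
  toFun g :=
    { toFun := fun v => ⟨(ρ g : ℍ[ℝ]) * v * star (ρ g : ℍ[ℝ]), by
        have hv : (v : ℍ[ℝ]).re = 0 := v.2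
        change ((ρ g : ℍ[ℝ]) * v * star (ρ g : ℍ[ℝ])).re = 0
        simp [Quaternion.re_mul, hv]
        ring⟩
      map_add' := fun v w => by
        ext1
        simp [mul_add, add_mul]
      map_smul' := fun c v => by
        ext1
        simp }
  map_one' := by
    ext1 v
    ext1
    simp
  map_mul' g h := by
    ext1 v
    ext1
    simp [mul_assoc]

/-- The Zariski tangent space of the character variety at `ρ`: the first cohomology
`H¹(G; su(2)_{ad ρ})`, which is the tangent space at the points of the irreducible stratum of a
closed surface. -/
abbrev TangentH1 (ρ : RepSpace G) := groupCohomology.H1 (Rep.of (adRep ρ))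

/-- `IsTangentMap F t L`: the linear map `L` is the differential at `t` of the family
`s ↦ F s` of representations, as a map to the character variety: the tangent vector in the
direction `v` is represented by the cocycle `g ↦ (∂ᵥ F(g)) F(g)⁻¹`. -/
def IsTangentMap {K : ℕ} (F : (Fin K → ℝ) → RepSpace G) (t : Fin K → ℝ)
    (L : (Fin K → ℝ) →ₗ[ℝ] TangentH1 (F t)) : Prop :=
  ∀ v, ∃ z : groupCohomology.cocycles₁ (Rep.of (adRep (F t))),
    (∀ g, ((z g : su2) : ℍ[ℝ]) =
      fderiv ℝ (fun s => (F s g : ℍ[ℝ])) t v * ((F t g)⁻¹ : SU2)) ∧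
    L v = groupCohomology.H1π _ z

/-- A map `f : ℝᴷ → CharVar(G)` is submersive at `t`: near `t` it has a smooth lift to
`Hom(G, SU(2))`, and its differential at `t` is onto the tangent space `H¹(G; su(2)_{ad})`. -/
def SubmersiveAt {K : ℕ} (f : (Fin K → ℝ) → CharVar G) (t : Fin K → ℝ) : Prop :=
  ∃ F : (Fin K → ℝ) → RepSpace G,
    (∀ᶠ s in 𝓝 t, CharVar.mk (F s) = f s) ∧
    (∀ g, ContDiffAt ℝ ∞ (fun s => (F s g : ℍ[ℝ])) t) ∧
    ∃ L : (Fin K → ℝ) →ₗ[ℝ] TangentH1 (F t), IsTangentMap F t L ∧ Function.Surjective L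

/-! ### The closed surface `F` of genus `n` and the `2n`-punctured sphere `S₀` -/

/-- The standard generators `A_i, D_i` of `π₁(F)`. -/
inductive Gen (n : ℕ) : Type
  | A (i : Fin n)
  | D (i : Fin n)

/-- The loop `A_i` as a word. -/
def wA {n : ℕ} (i : Fin n) : FreeGroup (Gen n) := FreeGroup.of (Gen.A i)

/-- The loop `D_i` as a word. -/
def wD {n : ℕ} (i : Fin n) : FreeGroup (Gen n) := FreeGroup.of (Gen.D i)

/-- The surface relator `∏ [A_i, D_i]`, in the order `i = 1, …, n`. -/
def surfaceWord (n : ℕ) : FreeGroup (Gen n) :=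
  ((List.finRange n).map fun i => ⁅wA i, wD i⁆).prod

/-- `π₁(F) = ⟨A_i, D_i ∣ ∏ [A_i, D_i] = 1⟩`. -/
abbrev SurfaceGroup (n : ℕ) : Type := PresentedGroup {surfaceWord n}

/-- The class of a generator in `π₁(F)`. -/
def SurfaceGroup.of {n : ℕ} (E : Gen n) : SurfaceGroup n := PresentedGroup.of E

/-- The standard generators `A_i, B_i` of `π₁(S₀)`: the boundary loops around `a_i` and `b_i`. -/
inductive SphereGen (n : ℕ) : Type
  | A (i : Fin n)
  | B (i : Fin n)

/-- The relator `∏ A_i B_i⁻¹`. -/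
def sphereWord (n : ℕ) : FreeGroup (SphereGen n) :=
  ((List.finRange n).map fun i =>
    FreeGroup.of (SphereGen.A i) * (FreeGroup.of (SphereGen.B i))⁻¹).prod

/-- `π₁(S₀) = ⟨A_i, B_i ∣ ∏ A_i B_i⁻¹ = 1⟩`. -/
abbrev SphereGroup (n : ℕ) : Type := PresentedGroup {sphereWord n}

/-- The images of the generators under the inclusion `S₀ ⊂ F`:
`A_i ↦ A_i` and `B_i ↦ D_i A_i D_i⁻¹`. -/
def inclGen {n : ℕ} : SphereGen n → SurfaceGroup n
  | .A i => SurfaceGroup.of (.A i)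
  | .B i => SurfaceGroup.of (.D i) * SurfaceGroup.of (.A i) * (SurfaceGroup.of (.D i))⁻¹

theorem surface_relation (n : ℕ) : ((List.finRange n).map fun i =>
    ⁅(SurfaceGroup.of (.A i) : SurfaceGroup n), SurfaceGroup.of (.D i)⁆).prod = 1 := by
  have h : PresentedGroup.mk {surfaceWord n} (surfaceWord n) = 1 :=
    PresentedGroup.one_of_mem (by simp)
  rw [surfaceWord, map_list_prod, List.map_map] at h
  exact h

/-- The homomorphism `π₁(S₀) → π₁(F)` induced by the inclusion. -/
def incl (n : ℕ) : SphereGroup n →* SurfaceGroup n :=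
  PresentedGroup.toGroup (f := inclGen) (by
    intro r hr
    rw [Set.mem_singleton_iff] at hr
    rw [hr, sphereWord, map_list_prod, List.map_map, ← surface_relation n]
    refine congrArg _ (List.map_congr_left fun i _ => ?_)
    simp [inclGen, commutatorElement_def, mul_assoc])

/-- The meridians of the punctures in `π₁(S₀)`: the conjugates of the `A_i`, the `B_i` and their
inverses. -/
def IsMeridian {n : ℕ} (m : SphereGroup n) : Prop :=
  ∃ (E : SphereGen n) (g : SphereGroup n),
    m = g * PresentedGroup.of E * g⁻¹ ∨ m = g * (PresentedGroup.of E)⁻¹ * g⁻¹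

/-- The abelian stratum `R(S², {a_i, b_i})^{U(1)}` of the traceless character variety. -/
def tracelessAbelian (n : ℕ) : Set (CharVar (SphereGroup n)) :=
  CharVar.mk '' {ρ | IsAbelianRep ρ ∧ ∀ m, IsMeridian m → (ρ m).re = 0}

/-- The set of irreducible classes on `F` with abelian traceless restriction to `S₀`. -/
def exceptionalSet (n : ℕ) : Set (CharVar (SurfaceGroup n)) :=
  CharVar.comap (incl n) ⁻¹' tracelessAbelian n ∩ irredStratum (SurfaceGroup n)

/-! ### The special perturbation curves -/

/-- The eleven families of special perturbation curves in `F`. -/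
inductive SpecialCurve (n : ℕ) : Type
  | I (i : Fin n)
  | II (i : Fin n)
  | III (i : Fin n)
  | IV (i j : Fin n) (h : i ≠ j)
  | V (i j : Fin n) (h : i ≠ j)
  | VI (i j : Fin n) (h : i ≠ j)
  | VII (i j : Fin n) (h : i ≠ j)
  | VIII (i j : Fin n) (h : i ≠ j)
  | IX (i j : Fin n) (h : i ≠ j)
  | X (i j : Fin n) (h : i ≠ j)
  | XI (i j : Fin n) (h : i ≠ j)

/-- The sectors `i + 1, …, j - 1` strictly between `i` and `j` in the cyclic (counterclockwise)
order. -/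
def between {n : ℕ} (i j : Fin n) : List (Fin n) :=
  ((List.finRange n).rotate (i + 1)).takeWhile (fun l => decide (l ≠ j))

/-- The cyclic product `∏_{ℓ = i + 1}^{j - 1} A_ℓ B_ℓ⁻¹`, where `A_ℓ B_ℓ⁻¹ = [A_ℓ, D_ℓ]`. -/
def wZ {n : ℕ} (i j : Fin n) : FreeGroup (Gen n) :=
  ((between i j).map fun l => ⁅wA l, wD l⁆).prod

/-- The cyclic product `∏_{ℓ = i}^{j} A_ℓ B_ℓ⁻¹`. -/
def wV {n : ℕ} (i j : Fin n) : FreeGroup (Gen n) :=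
  ⁅wA i, wD i⁆ * wZ i j * ⁅wA j, wD j⁆

/-- A word in `A_i, D_i` representing the curve `C`, joined to the base point by a fixed arc. -/
def SpecialCurve.loop {n : ℕ} : SpecialCurve n → FreeGroup (Gen n)
  | .I i => wD i
  | .II i => wA i
  | .III i => wD i * wA i
  | .IV i j _ => (wD j)⁻¹ * wA i
  | .V i j _ => wD j * wD i
  | .VI i j _ => wA j * wA i * wD i
  | .VII i j _ => (wD j)⁻¹ * wA i * wD i
  | .VIII i j _ => wZ i j * (wD j)⁻¹ * (wV i j)⁻¹ * wA i
  | .IX i j _ => wZ i j * (wD j)⁻¹ * (wV i j)⁻¹ * wA i * wD i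
  | .X i j _ => wV i j * wD j * (wZ i j)⁻¹ * wD i
  | .XI i j _ => wZ i j * wA j * (wV i j)⁻¹ * wA i * wD i

/-- Crossings of a curve with `γ_E * E * γ_E⁻¹`, where `E` is a loop of the `l`-th sector,
when the curve crosses the arc `γ_E` once, with sign `s`, and misses `E`. The curve is reached
from the base point through `p` if the `l`-th sector lies between the `i`-th and `j`-th ones and
through `q` otherwise. The second crossing is the one on the way back to the base point. -/
def arcCrossings {n : ℕ} (i j l : Fin n) (s : ℤ) (p q E : FreeGroup (Gen n)) :
    List (ℤ × FreeGroup (Gen n)) :=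
  if l ∈ between i j then [(s, p), (-s, E * p)] else [(s, q), (-s, E * q)]

/-- The crossings of a special perturbation curve `C` with the based loop `γ_E * E * γ_E⁻¹`,
in the order in which this loop meets them. A crossing is recorded by its sign (the sign of the
intersection `E · C`) and by a word `g` such that the longitude of `C` at this crossing (travel
along the based loop to the crossing, then around `C`, and back) is `g * C.loop * g⁻¹`. Thus the
longitudes `λ_C(E)` of the curves with respect to the loops `E` which they meet are:

* `I(i)`: `A_i D_i A_i⁻¹` for `A_i`;
* `II(i)`: `D_i A_i D_i⁻¹` for `D_i`;
* `III(i)`: `D_i A_i` for `D_i`, `A_i D_i` for `A_i`;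
* `IV(ij)`: `D_j⁻¹ A_i` for `D_i` and `A_j`;
* `V(ij)`: `D_j D_i` for `A_i`, `D_i D_j` for `A_j`;
* `VI(ij)`: `A_i A_j A_i D_i A_i⁻¹` for `A_i`, `A_j A_i D_i` for `D_i`, `A_i D_i A_j` for `D_j`;
* `VII(ij)`: `D_j⁻¹ A_i D_i` for `D_i` and `A_j`, `A_i D_j⁻¹ A_i D_i A_i⁻¹` for `A_i`;
* `VIII(ij)`: `Z D_j⁻¹ V⁻¹ A_i` for `D_i`, `D_j⁻¹ V⁻¹ A_i Z` for `A_j`;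
* `IX(ij)`: `Z D_j⁻¹ V⁻¹ A_i D_i` for `D_i`, `D_j⁻¹ V⁻¹ A_i D_i Z` for `A_j`,
  `A_i Z D_j⁻¹ V⁻¹ A_i D_i A_i⁻¹` for `A_i`;
* `X(ij)`: `V D_j Z⁻¹ D_i` for `A_i`, `Z⁻¹ D_i V D_j` for `A_j`;
* `XI(ij)`: `Z A_j V⁻¹ A_i D_i` for `D_i`, `A_i Z A_j V⁻¹ A_i D_i A_i⁻¹` for `A_i`,
  `V⁻¹ A_i D_i Z A_j` for `D_j`;
where `Z = wZ i j` and `V = wV i j`. The curves `IV`-`VII` also cross the arcs `γ_E` of all sectors other than `i, j`. -/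
def SpecialCurve.crossings {n : ℕ} : SpecialCurve n → Gen n → List (ℤ × FreeGroup (Gen n))
  | .I i, .A l => if l = i then [(-1, wA i)] else []
  | .I _, .D _ => []
  | .II _, .A _ => []
  | .II i, .D l => if l = i then [(1, wD i)] else []
  | .III i, .A l => if l = i then [(-1, wA i)] else []
  | .III i, .D l => if l = i then [(1, 1)] else []
  | .IV i j _, .A l => if l = i then [] else if l = j then [(1, 1)]
      else arcCrossings i j l 1 1 (wD j) (wA l)
  | .IV i j _, .D l => if l = i then [(1, 1)] else if l = j then []
      else arcCrossings i j l 1 1 (wD j) (wD l)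
  | .V i j _, .A l => if l = i then [(-1, 1)] else if l = j then [(-1, wD i)]
      else arcCrossings i j l (-1) (wD i) 1 (wA l)
  | .V i j _, .D l => if l = i then [] else if l = j then []
      else arcCrossings i j l (-1) (wD i) 1 (wD l)
  | .VI i j _, .A l => if l = i then [(-1, wA i)] else if l = j then []
      else arcCrossings i j l 1 1 (wA j)⁻¹ (wA l)
  | .VI i j _, .D l => if l = i then [(1, 1)] else if l = j then [(1, (wA j)⁻¹)]
      else arcCrossings i j l 1 1 (wA j)⁻¹ (wD l)
  | .VII i j _, .A l => if l = i then [(-1, wA i)] else if l = j then [(1, 1)]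
      else arcCrossings i j l 1 1 (wD j) (wA l)
  | .VII i j _, .D l => if l = i then [(1, 1)] else if l = j then []
      else arcCrossings i j l 1 1 (wD j) (wD l)
  | .VIII i j _, .A l => if l = j then [(1, (wZ i j)⁻¹)] else []
  | .VIII i _ _, .D l => if l = i then [(1, 1)] else []
  | .IX i j _, .A l => if l = i then [(-1, wA i)] else if l = j then [(1, (wZ i j)⁻¹)] else []
  | .IX i _ _, .D l => if l = i then [(1, 1)] else []
  | .X i j _, .A l => if l = i then [(-1, 1)] else if l = j then [(-1, (wZ i j)⁻¹ * wD i)] else []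
  | .X _ _ _, .D _ => []
  | .XI i _ _, .A l => if l = i then [(-1, wA i)] else []
  | .XI i j _, .D l => if l = i then [(1, 1)] else if l = j then [(1, (wZ i j * wA j)⁻¹)] else []

/-! ### The cylinder `F × I` with a perturbation along `C` -/

/-- The based loop `E` after it has been pushed through the curve `C`: every crossing, of sign `s`
and with connecting word `g`, contributes the factor `g m^s g⁻¹`, where `m` is the meridian of the
curve. Here `x` gives the values of the generators in a group `H`. -/
def crossProd {n : ℕ} {H : Type} [Group H] (c : SpecialCurve n) (x : Gen n → H) (m : H)
    (E : Gen n) : H :=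
  ((c.crossings E).map fun p =>
    FreeGroup.lift x p.2 * m ^ p.1 * (FreeGroup.lift x p.2)⁻¹).prod * x E

theorem rotate_eq {n : ℕ} (i j : Fin n) (h : i ≠ j) : ∃ O : List (Fin n),
    (List.finRange n).rotate i = i :: (between i j ++ j :: O) ∧ i ∉ between i j ∧
      j ∉ between i j ∧ ∀ l ∈ O, l ≠ i ∧ l ≠ j ∧ l ∉ between i j := by
  obtain ⟨T, hT⟩ : ∃ T, (List.finRange n).rotate i = i :: T := by
    rw [List.rotate_eq_drop_append_take (by simp [i.2.le])]
    rw [List.drop_eq_getElem_cons (by simp)]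
    exact ⟨_, by simp; rfl⟩
  have hnd : ((List.finRange n).rotate i).Nodup := by
    rw [List.nodup_rotate]; exact List.nodup_finRange n
  have hj : j ∈ (List.finRange n).rotate i := by
    rw [List.mem_rotate]; exact List.mem_finRange j
  have hT1 : (List.finRange n).rotate (i + 1) = T ++ [i] := by
    rw [← List.rotate_rotate, hT]; simp
  rw [hT] at hj hnd
  have hjT : j ∈ T := by
    rcases List.mem_cons.1 hj with h' | h'
    · exact absurd h'.symm h
    · exact h'
  obtain ⟨s, O, rfl⟩ := List.append_of_mem hjT
  simp only [List.nodup_cons, List.nodup_append, List.mem_append, List.mem_cons] at hnd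
  have hb : between i j = s := by
    rw [between, hT1, List.append_assoc, List.takeWhile_append_of_pos]
    · simp
    · intro a ha
      have := hnd.2.2.2 a ha j (Or.inl rfl)
      simpa using this
  refine ⟨O, by rw [hb, hT], ?_, ?_, ?_⟩
  · rw [hb]; tauto
  · rw [hb]; intro hs; exact hnd.2.2.2 j hs j (Or.inl rfl) rfl
  · intro l hl
    rw [hb]
    refine ⟨?_, ?_, ?_⟩
    · rintro rfl; tauto
    · rintro rfl; exact hnd.2.2.1.1 hl
    · intro hs; exact hnd.2.2.2 l hs l (Or.inr hl) rfl

theorem prod_conj {ι H : Type} [Group H] (L : List ι) (f f' : ι → H) (p : H)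
    (hf : ∀ l ∈ L, f' l = p * f l * p⁻¹) : (L.map f').prod = p * (L.map f).prod * p⁻¹ := by
  induction L with
  | nil => simp
  | cons a L ih =>
    rw [List.map_cons, List.prod_cons, hf a (by simp), ih fun l hl => hf l (by simp [hl])]
    simp

theorem glue_arc {H : Type} [Group H] {X Z Y O X' Y' p q : H} (h : X * (Z * (Y * O)) = 1)
    (hX : X' = q * X * p⁻¹) (hY : Y' = p * Y * q⁻¹) :
    X' * (p * Z * p⁻¹ * (Y' * (q * O * q⁻¹))) = 1 := by
  subst hX hY
  calc _ = q * (X * (Z * (Y * O))) * q⁻¹ := by group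
    _ = 1 := by rw [h]; group

theorem glue_inner {H : Type} [Group H] {X Z Y O X' Y' a b d : H} (h : X * (Z * (Y * O)) = 1)
    (hX : X' = a * X * b⁻¹) (hY : Y' = Z⁻¹ * b * Z * Y * d⁻¹)
    (hd : a * (X * Z * Y) = (X * Z * Y) * d) :
    X' * (Z * (Y' * O)) = 1 := by
  subst hX hY
  calc _ = (a * (X * Z * Y)) * d⁻¹ * O := by group
    _ = X * (Z * (Y * O)) := by rw [hd]; group
    _ = 1 := h

theorem glue {n : ℕ} {H : Type} [Group H] (x x' : Gen n → H) (i j : Fin n) (hij : i ≠ j)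
    (hx : ((List.finRange n).map fun l => ⁅x (.A l), x (.D l)⁆).prod = 1) (p q : H)
    (hin : ∀ l ∈ between i j, l ≠ i → l ≠ j →
      ⁅x' (.A l), x' (.D l)⁆ = p * ⁅x (.A l), x (.D l)⁆ * p⁻¹)
    (hout : ∀ l, l ∉ between i j → l ≠ i → l ≠ j →
      ⁅x' (.A l), x' (.D l)⁆ = q * ⁅x (.A l), x (.D l)⁆ * q⁻¹)
    (hglue : ∀ O, ⁅x (.A i), x (.D i)⁆ * (FreeGroup.lift x (wZ i j) *
        (⁅x (.A j), x (.D j)⁆ * O)) = 1 →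
      ⁅x' (.A i), x' (.D i)⁆ * (p * FreeGroup.lift x (wZ i j) * p⁻¹ *
        (⁅x' (.A j), x' (.D j)⁆ * (q * O * q⁻¹))) = 1) :
    ((List.finRange n).map fun l => ⁅x' (.A l), x' (.D l)⁆).prod = 1 := by
  obtain ⟨O, hr, hi, hj, hO⟩ := rotate_eq i j hij
  have hZ : FreeGroup.lift x (wZ i j) =
      ((between i j).map fun l => ⁅x (.A l), x (.D l)⁆).prod := by
    rw [wZ, map_list_prod, List.map_map]
    refine congrArg _ (List.map_congr_left fun l _ => ?_)
    simp [wA, wD, map_commutatorElement]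
  have key : ∀ f : Fin n → H, ((List.finRange n).map f).prod = 1 ↔
      (((List.finRange n).rotate i).map f).prod = 1 := by
    intro f
    rw [List.map_rotate]
    constructor
    · intro h; exact List.prod_rotate_eq_one_of_prod_eq_one h _
    · intro h
      have h2 := List.prod_rotate_eq_one_of_prod_eq_one h (n - i)
      rw [List.rotate_rotate] at h2
      have : ((i : ℕ) + (n - i)) = ((List.finRange n).map f).length := by
        simp [i.2.le]
      rw [this, List.rotate_length] at h2
      exact h2
  rw [key, hr] at hx ⊢
  simp only [List.map_cons, List.prod_cons, List.map_append, List.prod_append] at hx ⊢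
  rw [← hZ] at hx
  rw [prod_conj (between i j) (fun l => ⁅x (.A l), x (.D l)⁆) _ p
      (fun l hl => hin l hl (fun e => hi (e ▸ hl)) (fun e => hj (e ▸ hl))),
    prod_conj O (fun l => ⁅x (.A l), x (.D l)⁆) _ q
      (fun l hl => hout l (hO l hl).2.2 (hO l hl).1 (hO l hl).2.1), ← hZ]
  exact hglue _ hx

set_option linter.unusedSimpArgs false in
set_option maxHeartbeats 2000000 in
/-- Pushing the generators through a special perturbation curve preserves the surface relation, if
the meridian commutes with the longitude. -/
theorem crossProd_relation {n : ℕ} {H : Type} [Group H] (c : SpecialCurve n) (x : Gen n → H)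
    (m : H) (hm : m * FreeGroup.lift x c.loop = FreeGroup.lift x c.loop * m)
    (hx : ((List.finRange n).map fun l => ⁅x (.A l), x (.D l)⁆).prod = 1) :
    ((List.finRange n).map fun l =>
      ⁅crossProd c x m (.A l), crossProd c x m (.D l)⁆).prod = 1 := by
  have hA : ∀ l, FreeGroup.lift x (wA l) = x (.A l) := fun l => by simp [wA]
  have hD : ∀ l, FreeGroup.lift x (wD l) = x (.D l) := fun l => by simp [wD]
  have hconj : ∀ u g g' : H, ⁅u * g * u⁻¹, u * g' * u⁻¹⁆ = u * ⁅g, g'⁆ * u⁻¹ := fun u g g' => by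
    simp only [commutatorElement_def]; group
  have hV : ∀ i j, FreeGroup.lift x (wV i j) =
      ⁅x (.A i), x (.D i)⁆ * FreeGroup.lift x (wZ i j) * ⁅x (.A j), x (.D j)⁆ := fun i j => by
    simp [wV, hA, hD, map_commutatorElement]
  have rules : ∀ w : H, m * w = w * m → (∀ z, m * (w * z) = w * (m * z)) ∧
      (m * w⁻¹ = w⁻¹ * m) ∧ (∀ z, m * (w⁻¹ * z) = w⁻¹ * (m * z)) ∧
      (m⁻¹ * w = w * m⁻¹) ∧ (∀ z, m⁻¹ * (w * z) = w * (m⁻¹ * z)) ∧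
      (m⁻¹ * w⁻¹ = w⁻¹ * m⁻¹) ∧ (∀ z, m⁻¹ * (w⁻¹ * z) = w⁻¹ * (m⁻¹ * z)) := by
    intro w h
    have h0 : Commute m w := h
    have h1 := h0.inv_right
    have h2 := h0.inv_left
    have h3 := h0.inv_inv
    refine ⟨fun z => ?_, h1, fun z => ?_, h2, fun z => ?_, h3, fun z => ?_⟩
    · rw [← mul_assoc, h, mul_assoc]
    · rw [← mul_assoc, h1.eq, mul_assoc]
    · rw [← mul_assoc, h2.eq, mul_assoc]
    · rw [← mul_assoc, h3.eq, mul_assoc]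
  cases c with
  | I i =>
    rw [← hx]
    refine congrArg _ (List.map_congr_left fun l _ => ?_)
    by_cases h : l = i
    · subst h
      simp only [SpecialCurve.loop, hD] at hm
      obtain ⟨r1, r2, r3, r4, r5, r6, r7⟩ := rules _ hm
      simp [crossProd, SpecialCurve.crossings, hA, commutatorElement_def, mul_assoc, hm, r1, r2, r3, r4, r5, r6, r7]
    · simp [crossProd, SpecialCurve.crossings, h]
  | II i =>
    rw [← hx]
    refine congrArg _ (List.map_congr_left fun l _ => ?_)
    by_cases h : l = i
    · subst h
      simp only [SpecialCurve.loop, hA] at hm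
      obtain ⟨r1, r2, r3, r4, r5, r6, r7⟩ := rules _ hm
      simp [crossProd, SpecialCurve.crossings, hD, commutatorElement_def, mul_assoc, hm, r1, r2, r3, r4, r5, r6, r7]
    · simp [crossProd, SpecialCurve.crossings, h]
  | III i =>
    rw [← hx]
    refine congrArg _ (List.map_congr_left fun l _ => ?_)
    by_cases h : l = i
    · subst h
      simp only [SpecialCurve.loop, map_mul, hA, hD] at hm
      simp only [crossProd, SpecialCurve.crossings, if_true, List.map_cons, List.map_nil,
          List.prod_cons, List.prod_nil, map_one, map_mul, map_inv, hA, hD, zpow_one, zpow_neg]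
      obtain ⟨w, hw⟩ : ∃ w, x (.A l) = (x (.D l))⁻¹ * w := ⟨x (.D l) * x (.A l), by group⟩
      rw [hw] at hm ⊢
      simp only [mul_inv_cancel_left] at hm
      obtain ⟨r1, r2, r3, r4, r5, r6, r7⟩ := rules _ hm
      simp only [commutatorElement_def]
      simp [mul_assoc, hm, r1, r2, r3, r4, r5, r6, r7]
    · simp [crossProd, SpecialCurve.crossings, h]
  | IV i j h =>
    simp only [SpecialCurve.loop, map_mul, map_inv, hA, hD] at hm
    refine glue x _ i j h hx m (x (.D j) * m * (x (.D j))⁻¹) ?_ ?_ ?_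
    · intro l hl hi hj
      rw [← hconj]
      simp [crossProd, SpecialCurve.crossings, arcCrossings, hl, hi, hj, hA, hD, mul_assoc]
    · intro l hl hi hj
      rw [← hconj]
      simp [crossProd, SpecialCurve.crossings, arcCrossings, hl, hi, hj, hA, hD, mul_assoc]
    · intro O hO
      refine glue_arc hO ?_ ?_ <;>
      · simp only [crossProd, SpecialCurve.crossings, h, h.symm, if_true, if_false, List.map_cons, List.map_nil,
          List.prod_cons, List.prod_nil, map_one, map_mul, map_inv, hA, hD, zpow_one, zpow_neg]
        obtain ⟨w, hw⟩ : ∃ w, x (.A i) = x (.D j) * w := ⟨(x (.D j))⁻¹ * x (.A i), by group⟩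
        rw [hw] at hm
        try rw [hw]
        simp only [inv_mul_cancel_left] at hm
        obtain ⟨r1, r2, r3, r4, r5, r6, r7⟩ := rules _ hm
        simp only [commutatorElement_def]
        simp [mul_assoc, hm, r1, r2, r3, r4, r5, r6, r7]
  | V i j h =>
    simp only [SpecialCurve.loop, map_mul, map_inv, hA, hD] at hm
    refine glue x _ i j h hx (x (.D i) * m⁻¹ * (x (.D i))⁻¹) m⁻¹ ?_ ?_ ?_
    · intro l hl hi hj
      rw [← hconj]
      simp [crossProd, SpecialCurve.crossings, arcCrossings, hl, hi, hj, hA, hD, mul_assoc]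
    · intro l hl hi hj
      rw [← hconj]
      simp [crossProd, SpecialCurve.crossings, arcCrossings, hl, hi, hj, hA, hD, mul_assoc]
    · intro O hO
      refine glue_arc hO ?_ ?_ <;>
      · simp only [crossProd, SpecialCurve.crossings, h, h.symm, if_true, if_false, List.map_cons, List.map_nil,
          List.prod_cons, List.prod_nil, map_one, map_mul, map_inv, hA, hD, zpow_one, zpow_neg]
        obtain ⟨w, hw⟩ : ∃ w, x (.D j) = w * (x (.D i))⁻¹ := ⟨x (.D j) * x (.D i), by group⟩
        rw [hw] at hm
        try rw [hw]
        simp only [inv_mul_cancel_right] at hm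
        obtain ⟨r1, r2, r3, r4, r5, r6, r7⟩ := rules _ hm
        simp only [commutatorElement_def]
        simp [mul_assoc, hm, r1, r2, r3, r4, r5, r6, r7]
  | VI i j h =>
    simp only [SpecialCurve.loop, map_mul, map_inv, hA, hD] at hm
    refine glue x _ i j h hx m ((x (.A j))⁻¹ * m * x (.A j)) ?_ ?_ ?_
    · intro l hl hi hj
      rw [← hconj]
      simp [crossProd, SpecialCurve.crossings, arcCrossings, hl, hi, hj, hA, hD, mul_assoc]
    · intro l hl hi hj
      rw [← hconj]
      simp [crossProd, SpecialCurve.crossings, arcCrossings, hl, hi, hj, hA, hD, mul_assoc]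
    · intro O hO
      refine glue_arc hO ?_ ?_ <;>
      · simp only [crossProd, SpecialCurve.crossings, h, h.symm, if_true, if_false, List.map_cons, List.map_nil,
          List.prod_cons, List.prod_nil, map_one, map_mul, map_inv, hA, hD, zpow_one, zpow_neg]
        obtain ⟨w, hw⟩ : ∃ w, x (.D i) = (x (.A i))⁻¹ * (x (.A j))⁻¹ * w :=
          ⟨x (.A j) * x (.A i) * x (.D i), by group⟩
        rw [hw] at hm
        try rw [hw]
        have hm' : m * w = w * m := by simpa [mul_assoc] using hm
        obtain ⟨r1, r2, r3, r4, r5, r6, r7⟩ := rules _ hm'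
        simp only [commutatorElement_def]
        simp [mul_assoc, hm', r1, r2, r3, r4, r5, r6, r7]
  | VII i j h =>
    simp only [SpecialCurve.loop, map_mul, map_inv, hA, hD] at hm
    refine glue x _ i j h hx m (x (.D j) * m * (x (.D j))⁻¹) ?_ ?_ ?_
    · intro l hl hi hj
      rw [← hconj]
      simp [crossProd, SpecialCurve.crossings, arcCrossings, hl, hi, hj, hA, hD, mul_assoc]
    · intro l hl hi hj
      rw [← hconj]
      simp [crossProd, SpecialCurve.crossings, arcCrossings, hl, hi, hj, hA, hD, mul_assoc]
    · intro O hO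
      refine glue_arc hO ?_ ?_ <;>
      · simp only [crossProd, SpecialCurve.crossings, h, h.symm, if_true, if_false, List.map_cons, List.map_nil,
          List.prod_cons, List.prod_nil, map_one, map_mul, map_inv, hA, hD, zpow_one, zpow_neg]
        obtain ⟨w, hw⟩ : ∃ w, x (.D i) = (x (.A i))⁻¹ * x (.D j) * w :=
          ⟨(x (.D j))⁻¹ * x (.A i) * x (.D i), by group⟩
        rw [hw] at hm
        try rw [hw]
        have hm' : m * w = w * m := by simpa [mul_assoc] using hm
        obtain ⟨r1, r2, r3, r4, r5, r6, r7⟩ := rules _ hm'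
        simp only [commutatorElement_def]
        simp [mul_assoc, hm', r1, r2, r3, r4, r5, r6, r7]
  | VIII i j h =>
    simp only [SpecialCurve.loop, map_mul, map_inv, hA, hD, hV] at hm
    refine glue x _ i j h hx 1 1 ?_ ?_ ?_
    · intro l hl hi hj
      simp [crossProd, SpecialCurve.crossings, hi, hj]
    · intro l hl hi hj
      simp [crossProd, SpecialCurve.crossings, hi, hj]
    · intro O hO
      simp only [one_mul, inv_one, mul_one, crossProd, SpecialCurve.crossings, h, h.symm,
        if_true, if_false, List.map_cons, List.map_nil, List.prod_cons, List.prod_nil, map_one,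
        map_mul, map_inv, hA, hD, zpow_one, zpow_neg]
      generalize FreeGroup.lift x (wZ i j) = Z at hm hO ⊢
      refine glue_inner (a := x (.A i) * m * (x (.A i))⁻¹) (b := m) (d := x (.D j) * Z⁻¹ * m * Z * (x (.D j))⁻¹) hO ?_ ?_ ?_
      · simp only [commutatorElement_def]; group
      · simp only [commutatorElement_def]; group
      · generalize ⁅x (.A i), x (.D i)⁆ * Z * ⁅x (.A j), x (.D j)⁆ = V at hm ⊢
        obtain ⟨w, hw⟩ : ∃ w, x (.A i) = V * x (.D j) * Z⁻¹ * w := ⟨Z * (x (.D j))⁻¹ * V⁻¹ * x (.A i), by group⟩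
        rw [hw] at hm ⊢
        have hm' : m * w = w * m := by simpa [mul_assoc] using hm
        obtain ⟨r1, r2, r3, r4, r5, r6, r7⟩ := rules _ hm'
        simp [mul_assoc, hm', r1, r2, r3, r4, r5, r6, r7]
  | IX i j h =>
    simp only [SpecialCurve.loop, map_mul, map_inv, hA, hD, hV] at hm
    refine glue x _ i j h hx 1 1 ?_ ?_ ?_
    · intro l hl hi hj
      simp [crossProd, SpecialCurve.crossings, hi, hj]
    · intro l hl hi hj
      simp [crossProd, SpecialCurve.crossings, hi, hj]
    · intro O hO
      simp only [one_mul, inv_one, mul_one, crossProd, SpecialCurve.crossings, h, h.symm,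
        if_true, if_false, List.map_cons, List.map_nil, List.prod_cons, List.prod_nil, map_one,
        map_mul, map_inv, hA, hD, zpow_one, zpow_neg]
      generalize FreeGroup.lift x (wZ i j) = Z at hm hO ⊢
      refine glue_inner (a := x (.A i) * x (.D i) * m * (x (.D i))⁻¹ * (x (.A i))⁻¹) (b := m) (d := x (.D j) * Z⁻¹ * m * Z * (x (.D j))⁻¹) hO ?_ ?_ ?_
      · simp only [commutatorElement_def]; group
      · simp only [commutatorElement_def]; group
      · generalize ⁅x (.A i), x (.D i)⁆ * Z * ⁅x (.A j), x (.D j)⁆ = V at hm ⊢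
        obtain ⟨w, hw⟩ : ∃ w, x (.D i) = (x (.A i))⁻¹ * V * x (.D j) * Z⁻¹ * w := ⟨Z * (x (.D j))⁻¹ * V⁻¹ * x (.A i) * x (.D i), by group⟩
        rw [hw] at hm ⊢
        have hm' : m * w = w * m := by simpa [mul_assoc] using hm
        obtain ⟨r1, r2, r3, r4, r5, r6, r7⟩ := rules _ hm'
        simp [mul_assoc, hm', r1, r2, r3, r4, r5, r6, r7]
  | X i j h =>
    simp only [SpecialCurve.loop, map_mul, map_inv, hA, hD, hV] at hm
    refine glue x _ i j h hx 1 1 ?_ ?_ ?_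
    · intro l hl hi hj
      simp [crossProd, SpecialCurve.crossings, hi, hj]
    · intro l hl hi hj
      simp [crossProd, SpecialCurve.crossings, hi, hj]
    · intro O hO
      simp only [one_mul, inv_one, mul_one, crossProd, SpecialCurve.crossings, h, h.symm,
        if_true, if_false, List.map_cons, List.map_nil, List.prod_cons, List.prod_nil, map_one,
        map_mul, map_inv, hA, hD, zpow_one, zpow_neg]
      generalize FreeGroup.lift x (wZ i j) = Z at hm hO ⊢
      refine glue_inner (a := m⁻¹) (b := x (.D i) * m⁻¹ * (x (.D i))⁻¹) (d := x (.D j) * Z⁻¹ * x (.D i) * m⁻¹ * (x (.D i))⁻¹ * Z * (x (.D j))⁻¹) hO ?_ ?_ ?_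
      · simp only [commutatorElement_def]; group
      · simp only [commutatorElement_def]; group
      · generalize ⁅x (.A i), x (.D i)⁆ * Z * ⁅x (.A j), x (.D j)⁆ = V at hm ⊢
        obtain ⟨w, hw⟩ : ∃ w, x (.D i) = Z * (x (.D j))⁻¹ * V⁻¹ * w := ⟨V * x (.D j) * Z⁻¹ * x (.D i), by group⟩
        rw [hw] at hm ⊢
        have hm' : m * w = w * m := by simpa [mul_assoc] using hm
        obtain ⟨r1, r2, r3, r4, r5, r6, r7⟩ := rules _ hm'
        simp [mul_assoc, hm', r1, r2, r3, r4, r5, r6, r7]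
  | XI i j h =>
    simp only [SpecialCurve.loop, map_mul, map_inv, hA, hD, hV] at hm
    refine glue x _ i j h hx 1 1 ?_ ?_ ?_
    · intro l hl hi hj
      simp [crossProd, SpecialCurve.crossings, hi, hj]
    · intro l hl hi hj
      simp [crossProd, SpecialCurve.crossings, hi, hj]
    · intro O hO
      simp only [one_mul, inv_one, mul_one, crossProd, SpecialCurve.crossings, h, h.symm,
        if_true, if_false, List.map_cons, List.map_nil, List.prod_cons, List.prod_nil, map_one,
        map_mul, map_inv, hA, hD, zpow_one, zpow_neg]
      generalize FreeGroup.lift x (wZ i j) = Z at hm hO ⊢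
      refine glue_inner (a := x (.A i) * x (.D i) * m * (x (.D i))⁻¹ * (x (.A i))⁻¹) (b := m) (d := (Z * x (.A j))⁻¹ * m * (Z * x (.A j))) hO ?_ ?_ ?_
      · simp only [commutatorElement_def]; group
      · simp only [commutatorElement_def]; group
      · generalize ⁅x (.A i), x (.D i)⁆ * Z * ⁅x (.A j), x (.D j)⁆ = V at hm ⊢
        obtain ⟨w, hw⟩ : ∃ w, x (.D i) = (x (.A i))⁻¹ * V * (x (.A j))⁻¹ * Z⁻¹ * w := ⟨Z * x (.A j) * V⁻¹ * x (.A i) * x (.D i), by group⟩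
        rw [hw] at hm ⊢
        have hm' : m * w = w * m := by simpa [mul_assoc] using hm
        obtain ⟨r1, r2, r3, r4, r5, r6, r7⟩ := rules _ hm'
        simp [mul_assoc, hm', r1, r2, r3, r4, r5, r6, r7]

/-- The generators of the fundamental group of the complement of the curve `C × {1/2}` in the
cylinder `F × I`: those of `π₁(F × {0})`, and a meridian. -/
abbrev CylGen (n : ℕ) : Type := Option (Gen n)

/-- The relators of the complement of `C × {1/2}` in `F × I`: the surface relator, and the
commutation of the meridian and the longitude on the boundary torus of the tube. -/
def cylRels {n : ℕ} (c : SpecialCurve n) : Set (FreeGroup (CylGen n)) :=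
  {FreeGroup.map some (surfaceWord n), 
    ⁅(FreeGroup.of none : FreeGroup (CylGen n)), FreeGroup.map some c.loop⁆}

/-- `π₁(F × I ∖ N_C)`, based on `F × {0}`. As `F × I ∖ N_C` is, up to homotopy, `F × {0}` with the
boundary torus of `N_C` attached along the curve `C`, this is `π₁(F) *_{⟨C⟩} π₁(torus)`. -/
abbrev CylGroup {n : ℕ} (c : SpecialCurve n) : Type := PresentedGroup (cylRels c)

/-- The meridian `μ` of `N_C`. -/
def meridian {n : ℕ} (c : SpecialCurve n) : CylGroup c := PresentedGroup.of none

/-- The value of a word of `π₁(F × {0})` in `π₁(F × I ∖ N_C)`. -/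
def cylOf {n : ℕ} (c : SpecialCurve n) (E : Gen n) : CylGroup c := PresentedGroup.of (some E)

/-- The longitude `λ` of `N_C` (a push-off of `C` along the surface). -/
def longitude {n : ℕ} (c : SpecialCurve n) : CylGroup c := FreeGroup.lift (cylOf c) c.loop

theorem mk_map_some {n : ℕ} (c : SpecialCurve n) (w : FreeGroup (Gen n)) :
    PresentedGroup.mk (cylRels c) (FreeGroup.map some w) = FreeGroup.lift (cylOf c) w := by
  have : (PresentedGroup.mk (cylRels c)).comp (FreeGroup.map some) = FreeGroup.lift (cylOf c) := by
    ext E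
    simp [cylOf, PresentedGroup.of]
  exact DFunLike.congr_fun this w

theorem lift_surfaceWord {n : ℕ} {H : Type} [Group H] (x : Gen n → H) :
    FreeGroup.lift x (surfaceWord n) =
      ((List.finRange n).map fun l => ⁅x (.A l), x (.D l)⁆).prod := by
  rw [surfaceWord, map_list_prod, List.map_map]
  refine congrArg _ (List.map_congr_left fun l _ => ?_)
  simp [wA, wD, map_commutatorElement]

theorem cyl_surface {n : ℕ} (c : SpecialCurve n) :
    FreeGroup.lift (cylOf c) (surfaceWord n) = 1 := by
  rw [← mk_map_some]
  exact PresentedGroup.one_of_mem (by simp [cylRels])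

theorem cyl_commute {n : ℕ} (c : SpecialCurve n) :
    meridian c * longitude c = longitude c * meridian c := by
  have h : PresentedGroup.mk (cylRels c) ⁅FreeGroup.of none, FreeGroup.map some c.loop⁆ = 1 :=
    PresentedGroup.one_of_mem (Or.inr rfl)
  rw [map_commutatorElement, mk_map_some] at h
  exact commutatorElement_eq_one_iff_mul_comm.1 h

/-- The inclusion `π₁(F × {0}) → π₁(F × I ∖ N_C)`. -/
def bottom {n : ℕ} (c : SpecialCurve n) : SurfaceGroup n →* CylGroup c :=
  PresentedGroup.toGroup (f := cylOf c) (by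
    intro r hr
    rw [Set.mem_singleton_iff] at hr
    rw [hr, cyl_surface])

/-- The map `π₁(F × {1}) → π₁(F × I ∖ N_C)`, for the base points joined by the vertical arc: a
generator `E` in `F × {1}` is pushed down to `F × {0}` through the curve. -/
def top {n : ℕ} (c : SpecialCurve n) : SurfaceGroup n →* CylGroup c :=
  PresentedGroup.toGroup (f := crossProd c (cylOf c) (meridian c)) (by
    intro r hr
    rw [Set.mem_singleton_iff] at hr
    rw [hr, lift_surfaceWord]
    refine crossProd_relation c _ _ (cyl_commute c) ?_
    rw [← lift_surfaceWord, cyl_surface])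

/-- The function `F(e^{αQ}) = e^{f(α)Q}` of the perturbation function `f(α) = t sin α`: as the
imaginary part of `e^{αQ}` is `(sin α) Q`, this is `q ↦ exp (t Im q)`. -/
def pertMap (t : ℝ) (q : SU2) : SU2 :=
  ⟨NormedSpace.exp (t • (q : ℍ[ℝ]).im), by
    have h : Quaternion.normSq (NormedSpace.exp (t • (q : ℍ[ℝ]).im)) = 1 := by
      rw [Quaternion.normSq_exp]
      simp
    rw [Unitary.mem_iff, Quaternion.star_mul_self, Quaternion.self_mul_star, h]
    simp⟩

theorem pertMap_exp (t α : ℝ) (Q : ℍ[ℝ]) (hQ : Q.re = 0) (hn : ‖Q‖ = 1) (q : SU2)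
    (hq : (q : ℍ[ℝ]) = NormedSpace.exp (α • Q)) :
    (pertMap t q : ℍ[ℝ]) = NormedSpace.exp ((t * Real.sin α) • Q) := by
  have him : Q.im = Q := by ext <;> simp [hQ]
  have h : (q : ℍ[ℝ]).im = Real.sin α • Q := by
    rw [hq, Quaternion.im_exp]
    simp only [Quaternion.im_smul, him, Quaternion.re_smul, hQ, norm_smul, hn, smul_zero,
      NormedSpace.exp_zero, one_mul, mul_one, smul_smul, Real.norm_eq_abs]
    congr 1
    rcases eq_or_ne α 0 with rfl | h0
    · simp
    · rcases abs_choice α with h1 | h1 <;> rw [h1]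
      · field_simp
      · rw [Real.sin_neg]; field_simp
  change NormedSpace.exp (t • (q : ℍ[ℝ]).im) = _
  rw [h, smul_smul]

theorem pertMap_conj (t : ℝ) (h q : SU2) :
    pertMap t (h * q * h⁻¹) = h * pertMap t q * h⁻¹ := by
  have h0 : (h : ℍ[ℝ]) ≠ 0 := by
    intro h0
    have := Unitary.coe_star_mul_self h
    rw [h0, mul_zero] at this
    exact zero_ne_one this
  have hinv : ((h⁻¹ : SU2) : ℍ[ℝ]) = (h : ℍ[ℝ])⁻¹ := by
    apply eq_inv_of_mul_eq_one_left
    exact congrArg Subtype.val (inv_mul_cancel h)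
  have hcyc : ∀ a b : ℍ[ℝ], (a * b).re = (b * a).re := by
    intro a b
    simp only [Quaternion.re_mul]
    ring
  have him : ((h : ℍ[ℝ]) * q * (h : ℍ[ℝ])⁻¹).im = h * (q : ℍ[ℝ]).im * (h : ℍ[ℝ])⁻¹ := by
    have e1 : ∀ p : ℍ[ℝ], p.im = p - (p.re : ℍ[ℝ]) := fun p =>
      eq_sub_of_add_eq (by rw [add_comm]; exact Quaternion.re_add_im p)
    have e2 : ((h : ℍ[ℝ]) * q * (h : ℍ[ℝ])⁻¹).re = (q : ℍ[ℝ]).re := by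
      rw [hcyc, ← mul_assoc, inv_mul_cancel₀ h0, one_mul]
    rw [e1, e1 (q : ℍ[ℝ]), e2, mul_sub, sub_mul]
    congr 1
    rw [← Quaternion.coe_commutes, mul_assoc, mul_inv_cancel₀ h0, mul_one]
  ext1
  change NormedSpace.exp (t • ((h : ℍ[ℝ]) * q * ((h⁻¹ : SU2) : ℍ[ℝ])).im) =
    h * NormedSpace.exp (t • (q : ℍ[ℝ]).im) * ((h⁻¹ : SU2) : ℍ[ℝ])
  let _ : NormedAlgebra ℚ ℍ[ℝ] := NormedAlgebra.restrictScalars ℚ ℝ ℍ[ℝ]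
  rw [hinv, him, ← NormedSpace.exp_conj _ _ h0]
  simp

theorem pertMap_commute (t : ℝ) (q : SU2) : pertMap t q * q = q * pertMap t q := by
  have h := pertMap_conj t q q
  rw [mul_inv_cancel_right] at h
  nth_rewrite 1 [h]
  simp

/-- The perturbation condition `ρ(μ) = F(ρ(λ))`, for the perturbation data `(N_C, t sin α)`. -/
def IsPerturbed {n : ℕ} (c : SpecialCurve n) (t : ℝ) (ρ : RepSpace (CylGroup c)) : Prop :=
  ρ (meridian c) = pertMap t (ρ (longitude c))

/-- The values on generators of the perturbed extension of `ρ`. -/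
def extendGen {n : ℕ} (c : SpecialCurve n) (t : ℝ) (ρ : RepSpace (SurfaceGroup n)) :
    CylGen n → SU2
  | none => pertMap t (FreeGroup.lift (fun E => ρ (SurfaceGroup.of E)) c.loop)
  | some E => ρ (SurfaceGroup.of E)

theorem lift_extendGen {n : ℕ} (c : SpecialCurve n) (t : ℝ) (ρ : RepSpace (SurfaceGroup n))
    (w : FreeGroup (Gen n)) : FreeGroup.lift (extendGen c t ρ) (FreeGroup.map some w) =
      FreeGroup.lift (fun E => ρ (SurfaceGroup.of E)) w := by
  have : (FreeGroup.lift (extendGen c t ρ)).comp (FreeGroup.map some) =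
      FreeGroup.lift (fun E => ρ (SurfaceGroup.of E)) := by
    ext1 E
    simp [extendGen]
  exact DFunLike.congr_fun this w

/-- The perturbed representation of `π₁(F × I ∖ N_C)` which extends `ρ`. -/
def extend {n : ℕ} (c : SpecialCurve n) (t : ℝ) (ρ : RepSpace (SurfaceGroup n)) :
    RepSpace (CylGroup c) :=
  PresentedGroup.toGroup (f := extendGen c t ρ) (by
    intro r hr
    rcases hr with rfl | rfl
    · rw [lift_extendGen, lift_surfaceWord]
      have h := congrArg ρ (surface_relation n)
      rw [map_list_prod, List.map_map, map_one] at h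
      rw [← h]
      refine congrArg _ (List.map_congr_left fun l _ => ?_)
      simp [commutatorElement_def]
    · rw [map_commutatorElement, lift_extendGen, FreeGroup.lift_apply_of,
        commutatorElement_eq_one_iff_mul_comm]
      exact pertMap_commute _ _)

theorem extend_of {n : ℕ} (c : SpecialCurve n) (t : ℝ) (ρ : RepSpace (SurfaceGroup n))
    (E : CylGen n) : extend c t ρ (PresentedGroup.of E) = extendGen c t ρ E :=
  PresentedGroup.toGroup.of _

theorem rep_longitude {n : ℕ} (c : SpecialCurve n) (σ : RepSpace (CylGroup c)) :
    σ (longitude c) = FreeGroup.lift (fun E => σ (cylOf c E)) c.loop := by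
  have : (show CylGroup c →* SU2 from σ).comp (FreeGroup.lift (cylOf c)) =
      FreeGroup.lift (fun E => σ (cylOf c E)) := by
    ext1 E
    simp
    rfl
  exact DFunLike.congr_fun this c.loop

theorem extend_isPerturbed {n : ℕ} (c : SpecialCurve n) (t : ℝ) (ρ : RepSpace (SurfaceGroup n)) :
    IsPerturbed c t (extend c t ρ) ∧ (extend c t ρ).comap (bottom c) = ρ := by
  constructor
  · rw [IsPerturbed, rep_longitude]
    simp only [cylOf, meridian, extend_of, extendGen]
  · refine PresentedGroup.ext fun E => ?_
    change extend c t ρ (bottom c (PresentedGroup.of E)) = _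
    rw [bottom, PresentedGroup.toGroup.of, cylOf, extend_of]
    rfl

/-- A perturbed representation is determined by its restriction to the bottom. -/
theorem eq_extend {n : ℕ} (c : SpecialCurve n) (t : ℝ) (ρ : RepSpace (SurfaceGroup n))
    (σ : RepSpace (CylGroup c)) (h : IsPerturbed c t σ) (hσ : σ.comap (bottom c) = ρ) :
    σ = extend c t ρ := by
  have hE : ∀ E, σ (cylOf c E) = ρ (SurfaceGroup.of E) := by
    intro E
    rw [← hσ]
    change σ (cylOf c E) = σ (bottom c (PresentedGroup.of E))
    rw [bottom, PresentedGroup.toGroup.of]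
  refine PresentedGroup.ext fun E => ?_
  change σ (PresentedGroup.of E) = extend c t ρ (PresentedGroup.of E)
  rw [extend_of]
  cases E with
  | none =>
    rw [IsPerturbed, rep_longitude] at h
    simp only [hE] at h
    exact h
  | some E => exact hE E

/-- The restriction to `F × {1}` of the perturbed representation which restricts to `ρ` on
`F × {0}`. -/
def perturbRep {n : ℕ} (c : SpecialCurve n) (t : ℝ) (ρ : RepSpace (SurfaceGroup n)) :
    RepSpace (SurfaceGroup n) :=
  (extend c t ρ).comap (top c)

/-- The map `Φ_{π_C} : M(F) = M(F × {0}) ← M_{π_C}(F × I) → M(F × {1}) = M(F)`, for the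
perturbation data `π_C = (N_C, t sin α)`. -/
def perturb {n : ℕ} (c : SpecialCurve n) (t : ℝ) :
    CharVar (SurfaceGroup n) → CharVar (SurfaceGroup n) :=
  Quotient.map (perturbRep c t) (by
    rintro ρ σ ⟨h, H⟩
    have key : extend c t σ = RepSpace.conj h (extend c t ρ) := by
      refine (eq_extend c t σ _ ?_ ?_).symm
      · have := (extend_isPerturbed c t ρ).1
        rw [IsPerturbed] at this ⊢
        rw [RepSpace.conj_apply, RepSpace.conj_apply, this, pertMap_conj]
      · refine DFunLike.ext _ _ fun g => ?_
        rw [H g]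
        nth_rewrite 2 [← (extend_isPerturbed c t ρ).2]
        rfl
    exact ⟨h, fun g => by
      change extend c t σ (top c g) = _
      rw [key]
      rfl⟩)

/-- `Φ_C(x, t) = Φ_{t_K, C_K} ∘ ⋯ ∘ Φ_{t_1, C_1} (x)` for a list `C = (C_1, …, C_K)` of special
perturbation curves. -/
def Phi {n K : ℕ} (C : Fin K → SpecialCurve n) (x : CharVar (SurfaceGroup n)) (t : Fin K → ℝ) :
    CharVar (SurfaceGroup n) :=
  (List.finRange K).foldl (fun y k => perturb (C k) (t k) y) x

end TracelessTangle

end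

open TracelessTangle

open scoped Quaternion Topology ContDiff commutatorElement

noncomputable section

namespace TracelessTangle

/-! ### Pushing generators through a curve -/

/-! Normal forms. Conjugate an exceptional `ρ` so that the maximal torus stabilizing its restriction
to `S₀` is the circle of complex units. Each `A_l` and each `D_l A_l D_l⁻¹` is then a complex unit
of real part `0`, that is `±i`, so `D_l` normalizes the circle: it is `z_l` or `z_l j` with a
complex unit `z_l`. The commutator `[A_l, D_l]` is `1` in the first case and `-1` in the second, so
the surface relation says that the number of `j`'s is even, and irreducibility says that it is not
zero. Conjugation by a complex unit `w` multiplies the `z_l` of type `z_l j` by `w²` and fixes the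
others; normalizing one of the former to `1` leaves an `(n-1)`-torus for each choice of signs
(`exists_normalRep`, `mem_torusSet`, `normalRep_injective`). As `SU(2)` is compact, the character
variety is Hausdorff, so these tori are embedded.

Irreducibility. A push through a curve is undone by the inverse meridian (`crossProd_inv`) and does
not change the value of the curve (`crossProd_loop`). Hence the representations at the bottom and at
the top of the cylinder have the same stabilizer (`stab_perturbRep`).

Submersion. At `t = 0` the derivative along the `k`-th curve is a cocycle, recorded by its values
`curveTangent` in `su(2)^{2n}` on the generators. Cocycles lie in the kernel of the derivative
`relDeriv` of the surface relator. No dimension of `H¹` is computed. Instead a three-dimensional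
space, the image of `relSection m`, is added in a sector with `D_m = z_m j`: `relDeriv` is injective
on it (`relDeriv_relSection_injective`), and together with the curve tangents it spans `su(2)^{2n}`
(`span_curveTangent`). A cocycle is then a combination of curve tangents plus an added term killed
by `relDeriv`, and this term vanishes. So every cocycle, not only every class, is a derivative.
Surjectivity and injectivity of linear maps are open conditions, so the argument persists near `t =
0` (`eventually_submersiveAt`), uniformly because the tori are compact and the signs finite in
number. -/

theorem lift_wZ_congr {n : ℕ} {H : Type} [Group H] (x x' : Gen n → H) {i j : Fin n} (hij : i ≠ j)
    (h : ∀ l, l ≠ i → l ≠ j → x' (.A l) = x (.A l) ∧ x' (.D l) = x (.D l)) :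
    FreeGroup.lift x' (wZ i j) = FreeGroup.lift x (wZ i j) := by
  obtain ⟨O, -, hi, hj, -⟩ := rotate_eq i j hij
  rw [wZ, map_list_prod, map_list_prod, List.map_map, List.map_map]
  refine congrArg _ (List.map_congr_left fun l hl => ?_)
  obtain ⟨h1, h2⟩ := h l (fun e => hi (e ▸ hl)) (fun e => hj (e ▸ hl))
  simp [wA, wD, map_commutatorElement, h1, h2]

/-- The curves of the last four families meet only the generators of the sectors `i` and `j`. -/
theorem crossProd_lift_wZ {n : ℕ} {H : Type} [Group H] (x : Gen n → H) (m : H) {i j : Fin n}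
    (hij : i ≠ j) (c : SpecialCurve n) (hc : c = .VIII i j hij ∨ c = .IX i j hij ∨
      c = .X i j hij ∨ c = .XI i j hij) :
    FreeGroup.lift (crossProd c x m) (wZ i j) = FreeGroup.lift x (wZ i j) := by
  refine lift_wZ_congr _ _ hij fun l hi hj => ?_
  rcases hc with rfl | rfl | rfl | rfl <;> simp [crossProd, SpecialCurve.crossings, hi, hj]

set_option linter.unusedSimpArgs false in
set_option maxHeartbeats 1000000 in
-- The connecting words of a curve involve only generators which the curve does not cross, or the
-- crossed loop itself. Hence the same formula with `m⁻¹` removes each inserted factor; `m` need not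
-- commute with the curve.
theorem crossProd_inv {n : ℕ} {H : Type} [Group H] (c : SpecialCurve n) (x : Gen n → H) (m : H) :
    crossProd c (crossProd c x m) m⁻¹ = x := by
  have hA : ∀ (x : Gen n → H) l, FreeGroup.lift x (wA l) = x (.A l) := fun x l => by simp [wA]
  have hD : ∀ (x : Gen n → H) l, FreeGroup.lift x (wD l) = x (.D l) := fun x l => by simp [wD]
  have hZ := fun (i j : Fin n) (h : i ≠ j) => crossProd_lift_wZ x m h c
  have key : ∀ l, crossProd c (crossProd c x m) m⁻¹ (.A l) = x (.A l) ∧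
      crossProd c (crossProd c x m) m⁻¹ (.D l) = x (.D l) := by
    intro l
    cases c with
    | I i | II i | III i =>
      clear hZ
      rcases eq_or_ne l i with rfl | hi <;>
        constructor <;> simp [crossProd, SpecialCurve.crossings, hA, hD, mul_assoc, *]
    | IV i j h | V i j h | VI i j h | VII i j h =>
      clear hZ
      rcases eq_or_ne l i with rfl | hi
      · constructor <;>
          simp [crossProd, SpecialCurve.crossings, hA, hD, mul_assoc, h, h.symm]
      rcases eq_or_ne l j with rfl | hj
      · constructor <;>
          simp [crossProd, SpecialCurve.crossings, hA, hD, mul_assoc, h, h.symm]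
      by_cases hl : l ∈ between i j <;> constructor <;>
        simp [crossProd, SpecialCurve.crossings, arcCrossings, hA, hD, mul_assoc, h, h.symm, hl,
          hi, hj]
    | VIII i j h | IX i j h | X i j h | XI i j h =>
      have hz := hZ i j h (by simp)
      rcases eq_or_ne l i with rfl | hi
      · constructor <;>
          simp [crossProd, SpecialCurve.crossings, hA, hD, mul_assoc, h, h.symm, hz]
      rcases eq_or_ne l j with rfl | hj
      · constructor <;>
          simp [crossProd, SpecialCurve.crossings, hA, hD, mul_assoc, h, h.symm, hz]
      constructor <;> simp [crossProd, SpecialCurve.crossings, hi, hj]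
  funext E
  cases E with
  | A l => exact (key l).1
  | D l => exact (key l).2

set_option linter.unusedSimpArgs false in
set_option maxHeartbeats 1000000 in
-- Either the generators in the word are not crossed, or the inserted meridians cancel, or the whole
-- word is conjugated by `m` or `m⁻¹`, with which it commutes.
theorem crossProd_loop {n : ℕ} {H : Type} [Group H] (c : SpecialCurve n) (x : Gen n → H)
    (m : H) (hm : m * FreeGroup.lift x c.loop = FreeGroup.lift x c.loop * m) :
    FreeGroup.lift (crossProd c x m) c.loop = FreeGroup.lift x c.loop := by
  have hA : ∀ (x : Gen n → H) l, FreeGroup.lift x (wA l) = x (.A l) := fun x l => by simp [wA]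
  have hD : ∀ (x : Gen n → H) l, FreeGroup.lift x (wD l) = x (.D l) := fun x l => by simp [wD]
  have hV : ∀ (x : Gen n → H) i j, FreeGroup.lift x (wV i j) =
      ⁅x (.A i), x (.D i)⁆ * FreeGroup.lift x (wZ i j) * ⁅x (.A j), x (.D j)⁆ := fun x i j => by
    simp [wV, hA, hD, map_commutatorElement]
  have hZ := fun (i j : Fin n) (h : i ≠ j) => crossProd_lift_wZ x m h c
  have hcm : ∀ w : H, m * w = w * m → m * w * m⁻¹ = w := fun w h => by rw [h]; group
  have hcm' : ∀ w : H, m * w = w * m → m⁻¹ * w * m = w := fun w h => by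
    rw [mul_assoc, ← h]; group
  cases c with
  | I i => simp [SpecialCurve.loop, crossProd, SpecialCurve.crossings, hD]
  | II i => simp [SpecialCurve.loop, crossProd, SpecialCurve.crossings, hA]
  | III i =>
    simp only [SpecialCurve.loop, map_mul, hA, hD] at hm ⊢
    simpa [crossProd, SpecialCurve.crossings, hA, mul_assoc] using hcm _ hm
  | IV i j h => simp [SpecialCurve.loop, crossProd, SpecialCurve.crossings, hA, hD, h.symm]
  | V i j h => simp [SpecialCurve.loop, crossProd, SpecialCurve.crossings, hD, h.symm]
  | VI i j h =>
    simp only [SpecialCurve.loop, map_mul, hA, hD] at hm ⊢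
    simp [crossProd, SpecialCurve.crossings, hA, mul_assoc, h.symm]
  | VII i j h =>
    simp only [SpecialCurve.loop, map_mul, hA, hD] at hm ⊢
    simp [crossProd, SpecialCurve.crossings, hA, hD, mul_assoc, h.symm]
  | VIII i j h =>
    have hz := hZ i j h (by simp)
    simp only [SpecialCurve.loop, map_mul, map_inv, hA, hD, hV] at hm ⊢
    rw [hz]
    simp only [crossProd, SpecialCurve.crossings, h, h.symm, if_true, if_false, List.map_cons,
      List.map_nil, List.prod_cons, List.prod_nil, map_one, map_mul, map_inv, hA, hD, zpow_one,
      zpow_neg, one_mul, mul_one, inv_one, inv_inv]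
    generalize FreeGroup.lift x (wZ i j) = Z at *
    refine Eq.trans ?_ (hcm _ hm)
    simp only [commutatorElement_def]
    group
  | IX i j h =>
    have hz := hZ i j h (by simp)
    simp only [SpecialCurve.loop, map_mul, map_inv, hA, hD, hV] at hm ⊢
    rw [hz]
    simp only [crossProd, SpecialCurve.crossings, h, h.symm, if_true, if_false, List.map_cons,
      List.map_nil, List.prod_cons, List.prod_nil, map_one, map_mul, map_inv, hA, hD, zpow_one,
      zpow_neg, one_mul, mul_one, inv_one, inv_inv]
    generalize FreeGroup.lift x (wZ i j) = Z at *
    refine Eq.trans ?_ (hcm _ hm)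
    simp only [commutatorElement_def]
    group
  | X i j h =>
    have hz := hZ i j h (by simp)
    simp only [SpecialCurve.loop, map_mul, map_inv, hA, hD, hV] at hm ⊢
    rw [hz]
    simp only [crossProd, SpecialCurve.crossings, h, h.symm, if_true, if_false, List.map_cons,
      List.map_nil, List.prod_cons, List.prod_nil, map_one, map_mul, map_inv, hA, hD, zpow_one,
      zpow_neg, one_mul, mul_one, inv_one, inv_inv]
    generalize FreeGroup.lift x (wZ i j) = Z at *
    refine Eq.trans ?_ (hcm' _ hm)
    simp only [commutatorElement_def]
    group
  | XI i j h =>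
    have hz := hZ i j h (by simp)
    simp only [SpecialCurve.loop, map_mul, map_inv, hA, hD, hV] at hm ⊢
    rw [hz]
    simp only [crossProd, SpecialCurve.crossings, h, h.symm, if_true, if_false, List.map_cons,
      List.map_nil, List.prod_cons, List.prod_nil, map_one, map_mul, map_inv, hA, hD, zpow_one,
      zpow_neg, one_mul, mul_one, inv_one, inv_inv]
    generalize FreeGroup.lift x (wZ i j) = Z at *
    refine Eq.trans ?_ (hcm _ hm)
    simp only [commutatorElement_def]
    group

end TracelessTangle

namespace TracelessTangle

/-! ### Perturbed representations -/

theorem map_freeGroup_lift {α H H' : Type} [Group H] [Group H'] (f : H →* H') (x : α → H)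
    (w : FreeGroup α) : f (FreeGroup.lift x w) = FreeGroup.lift (fun E => f (x E)) w := by
  have : f.comp (FreeGroup.lift x) = FreeGroup.lift (fun E => f (x E)) := by
    ext1 E
    simp
  exact DFunLike.congr_fun this w

theorem map_crossProd {n : ℕ} {H H' : Type} [Group H] [Group H'] (f : H →* H')
    (c : SpecialCurve n) (x : Gen n → H) (m : H) (E : Gen n) :
    f (crossProd c x m E) = crossProd c (fun E => f (x E)) (f m) E := by
  rw [crossProd, crossProd, map_mul, map_list_prod, List.map_map]
  congr 1
  refine congrArg _ (List.map_congr_left fun p _ => ?_)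
  simp only [Function.comp_apply, map_mul, map_inv, map_zpow, map_freeGroup_lift]

/-- This eliminates the cylinder group: the later computations work with values on generators. -/
theorem perturbRep_of {n : ℕ} (c : SpecialCurve n) (t : ℝ) (ρ : RepSpace (SurfaceGroup n))
    (E : Gen n) : perturbRep c t ρ (SurfaceGroup.of E) =
      crossProd c (fun E => ρ (SurfaceGroup.of E))
        (pertMap t (FreeGroup.lift (fun E => ρ (SurfaceGroup.of E)) c.loop)) E := by
  have h : top c (SurfaceGroup.of E) = crossProd c (cylOf c) (meridian c) E :=
    PresentedGroup.toGroup.of _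
  change extend c t ρ (top c (SurfaceGroup.of E)) = _
  rw [h]
  refine (map_crossProd (show CylGroup c →* SU2 from extend c t ρ) c _ _ E).trans ?_
  congr 1
  · funext E
    exact extend_of c t ρ (some E)
  · exact extend_of c t ρ none

theorem pertMap_zero (q : SU2) : pertMap 0 q = 1 := by
  ext1
  change NormedSpace.exp ((0 : ℝ) • (q : ℍ[ℝ]).im) = 1
  rw [zero_smul, NormedSpace.exp_zero]

theorem crossProd_one {n : ℕ} {H : Type} [Group H] (c : SpecialCurve n) (x : Gen n → H) :
    crossProd c x 1 = x := by
  funext E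
  rw [crossProd, List.prod_eq_one, one_mul]
  simp

theorem RepSpace.ext_of {n : ℕ} {ρ σ : RepSpace (SurfaceGroup n)}
    (h : ∀ E, ρ (SurfaceGroup.of E) = σ (SurfaceGroup.of E)) : ρ = σ :=
  PresentedGroup.ext h

theorem perturbRep_zero {n : ℕ} (c : SpecialCurve n) (ρ : RepSpace (SurfaceGroup n)) :
    perturbRep c 0 ρ = ρ :=
  RepSpace.ext_of fun E => by rw [perturbRep_of, pertMap_zero, crossProd_one]

/-- A property of elements of a presented group, which is closed under products and inverses, holds
if it holds for the generators. -/
theorem presentedGroup_induction {α : Type} {R : Set (FreeGroup α)} {p : PresentedGroup R → Prop}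
    (hof : ∀ a, p (PresentedGroup.of a)) (hone : p 1) (hmul : ∀ a b, p a → p b → p (a * b))
    (hinv : ∀ a, p a → p a⁻¹) (g : PresentedGroup R) : p g := by
  let S : Subgroup (PresentedGroup R) :=
    { carrier := {g | p g}
      mul_mem' := fun {a b} ha hb => hmul a b ha hb
      one_mem' := hone
      inv_mem' := fun {a} ha => hinv a ha }
  have h : Subgroup.closure (Set.range (PresentedGroup.of : α → PresentedGroup R)) ≤ S := by
    rw [Subgroup.closure_le]
    rintro _ ⟨a, rfl⟩
    exact hof a
  rw [PresentedGroup.closure_range_of] at h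
  exact h (Subgroup.mem_top g)

theorem mem_stab_iff {α : Type} {R : Set (FreeGroup α)} (ρ : RepSpace (PresentedGroup R))
    (h : SU2) : h ∈ stab ρ ↔ ∀ E, h * ρ (PresentedGroup.of E) = ρ (PresentedGroup.of E) * h := by
  constructor
  · intro hh E
    rw [← mul_inv_eq_iff_eq_mul]
    exact hh _
  · intro hh
    have : ∀ g, Commute h (ρ g) := by
      refine presentedGroup_induction hh ?_ ?_ ?_
      · rw [map_one]; exact Commute.one_right _
      · intro a b ha hb; rw [map_mul]; exact ha.mul_right hb
      · intro a ha; rw [map_inv]; exact ha.inv_right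
    intro g
    rw [mul_inv_eq_iff_eq_mul]
    exact this g

theorem commute_lift {α H : Type} [Group H] (x : α → H) (h : H) (hx : ∀ E, Commute h (x E))
    (w : FreeGroup α) : Commute h (FreeGroup.lift x w) := by
  induction w using FreeGroup.induction_on with
  | C1 => rw [map_one]; exact Commute.one_right _
  | of E => rw [FreeGroup.lift_apply_of]; exact hx E
  | inv_of E ih => rw [map_inv]; exact ih.inv_right
  | mul a b ha hb => rw [map_mul]; exact ha.mul_right hb

theorem commute_crossProd {n : ℕ} {H : Type} [Group H] (c : SpecialCurve n) (x : Gen n → H)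
    (m h : H) (hx : ∀ E, Commute h (x E)) (hm : Commute h m) (E : Gen n) :
    Commute h (crossProd c x m E) := by
  have key : ∀ L : List (ℤ × FreeGroup (Gen n)), Commute h (L.map fun p =>
      FreeGroup.lift x p.2 * m ^ p.1 * (FreeGroup.lift x p.2)⁻¹).prod := by
    intro L
    induction L with
    | nil => exact Commute.one_right _
    | cons p L ih =>
      rw [List.map_cons, List.prod_cons]
      have hp := commute_lift x h hx p.2
      exact ((hp.mul_right (hm.zpow_right _)).mul_right hp.inv_right).mul_right ih
  exact (key _).mul_right (hx E)

theorem commute_pertMap (t : ℝ) {h q : SU2} (hq : Commute h q) : Commute h (pertMap t q) := by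
  have h1 := pertMap_conj t h q
  rw [hq.eq, mul_inv_cancel_right] at h1
  exact (eq_mul_inv_iff_mul_eq.1 h1).symm

/-- What commutes with the values at the bottom commutes with the meridian, hence with the values at
the top. For the converse the roles of bottom and top are exchanged, using the inverse push. -/
theorem stab_perturbRep {n : ℕ} (c : SpecialCurve n) (t : ℝ) (ρ : RepSpace (SurfaceGroup n)) :
    stab (perturbRep c t ρ) = stab ρ := by
  ext h
  rw [mem_stab_iff, mem_stab_iff]
  change (∀ E, Commute h (perturbRep c t ρ (SurfaceGroup.of E))) ↔
    (∀ E, Commute h (ρ (SurfaceGroup.of E)))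
  simp only [perturbRep_of]
  set x : Gen n → SU2 := fun E => ρ (SurfaceGroup.of E) with hx
  constructor
  · intro hh
    -- The value of the curve is the same at the top and at the bottom, so `h` commutes with it and
    -- therefore with the meridian.
    have hc := commute_lift _ h hh c.loop
    change Commute h (FreeGroup.lift (crossProd c x _) c.loop) at hc
    rw [crossProd_loop c x _ (pertMap_commute _ _)] at hc
    have h2 := fun E => commute_crossProd c _ _ h hh (commute_pertMap t hc).inv_right E
    intro E
    have h3 := h2 E
    change Commute h (crossProd c (crossProd c x _) _ E) at h3
    rwa [crossProd_inv] at h3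
  · intro hh
    exact commute_crossProd c x _ h hh (commute_pertMap t (commute_lift x h hh _))

theorem isIrredRep_of_stab_eq {G G' : Type} [Group G] [Group G'] {ρ : RepSpace G}
    {σ : RepSpace G'} (h : stab σ = stab ρ) (hρ : IsIrredRep ρ) : IsIrredRep σ := by
  intro k
  rw [h]
  exact hρ k

/-- The lift of `Phi` to representations. -/
def repPhi {n K : ℕ} (C : Fin K → SpecialCurve n) (ρ : RepSpace (SurfaceGroup n))
    (t : Fin K → ℝ) : RepSpace (SurfaceGroup n) :=
  (List.finRange K).foldl (fun σ k => perturbRep (C k) (t k) σ) ρ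

theorem mk_repPhi {n K : ℕ} (C : Fin K → SpecialCurve n) (ρ : RepSpace (SurfaceGroup n))
    (t : Fin K → ℝ) : CharVar.mk (repPhi C ρ t) = Phi C (CharVar.mk ρ) t := by
  rw [repPhi, Phi]
  generalize List.finRange K = L
  induction L generalizing ρ with
  | nil => rfl
  | cons k L ih => rw [List.foldl_cons, List.foldl_cons, ih]; rfl

theorem stab_repPhi {n K : ℕ} (C : Fin K → SpecialCurve n) (ρ : RepSpace (SurfaceGroup n))
    (t : Fin K → ℝ) : stab (repPhi C ρ t) = stab ρ := by
  rw [repPhi]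
  generalize List.finRange K = L
  induction L generalizing ρ with
  | nil => rfl
  | cons k L ih => rw [List.foldl_cons, ih, stab_perturbRep]

/-- Perturbations with parameter `0` are trivial, so along a coordinate axis only one curve acts.
This is why the order of the curves is irrelevant to the differential at the origin. -/
theorem repPhi_single {n K : ℕ} (C : Fin K → SpecialCurve n) (ρ : RepSpace (SurfaceGroup n))
    (k : Fin K) (s : ℝ) : repPhi C ρ (Pi.single k s) = perturbRep (C k) s ρ := by
  have h0 : ∀ (L : List (Fin K)) (σ : RepSpace (SurfaceGroup n)), k ∉ L →
      L.foldl (fun σ l => perturbRep (C l) ((Pi.single k s : Fin K → ℝ) l) σ) σ = σ := by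
    intro L
    induction L with
    | nil => intros; rfl
    | cons l L ih =>
      intro σ hk
      rw [List.mem_cons, not_or] at hk
      rw [List.foldl_cons, ih _ hk.2, Pi.single_eq_of_ne (Ne.symm hk.1), perturbRep_zero]
  obtain ⟨L₁, L₂, hL⟩ := List.append_of_mem (List.mem_finRange k)
  have hnd := List.nodup_finRange K
  rw [hL] at hnd
  have h1 : k ∉ L₁ := fun h => (List.nodup_append.1 hnd).2.2 k h k (by simp) rfl
  have h2 : k ∉ L₂ := (List.nodup_cons.1 (List.nodup_append.1 hnd).2.1).1
  rw [repPhi, hL, List.foldl_append, h0 _ _ h1, List.foldl_cons, h0 _ _ h2, Pi.single_eq_same]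

theorem repPhi_zero {n K : ℕ} (C : Fin K → SpecialCurve n) (ρ : RepSpace (SurfaceGroup n)) :
    repPhi C ρ 0 = ρ := by
  rw [repPhi]
  generalize List.finRange K = L
  induction L with
  | nil => rfl
  | cons k L ih => rw [List.foldl_cons, Pi.zero_apply, perturbRep_zero, ih]

theorem phi_mem_irredStratum {n K : ℕ} (C : Fin K → SpecialCurve n)
    {ρ : RepSpace (SurfaceGroup n)} (hρ : IsIrredRep ρ) (t : Fin K → ℝ) :
    Phi C (CharVar.mk ρ) t ∈ irredStratum (SurfaceGroup n) :=
  ⟨_, isIrredRep_of_stab_eq (stab_repPhi C ρ t) hρ, mk_repPhi C ρ t⟩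

end TracelessTangle

namespace TracelessTangle

/-! ### The adjoint action and imaginary parts -/

theorem SU2.coe_inv (q : SU2) : ((q⁻¹ : SU2) : ℍ[ℝ]) = star (q : ℍ[ℝ]) := rfl

theorem SU2.coe_mul_star (q : SU2) : (q : ℍ[ℝ]) * star (q : ℍ[ℝ]) = 1 :=
  Unitary.coe_mul_star_self q

theorem SU2.coe_star_mul (q : SU2) : star (q : ℍ[ℝ]) * (q : ℍ[ℝ]) = 1 :=
  Unitary.coe_star_mul_self q

/-- The adjoint action of `SU(2)` on `su(2)`. -/
def Ad (q : SU2) : su2 →ₗ[ℝ] su2 where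
  toFun v := ⟨(q : ℍ[ℝ]) * v * star (q : ℍ[ℝ]), by
    have hv : (v : ℍ[ℝ]).re = 0 := v.2
    change ((q : ℍ[ℝ]) * v * star (q : ℍ[ℝ])).re = 0
    simp [Quaternion.re_mul, hv]
    ring⟩
  map_add' v w := by
    ext1
    simp [mul_add, add_mul]
  map_smul' c v := by
    ext1
    simp

theorem coe_Ad (q : SU2) (v : su2) :
    (Ad q v : ℍ[ℝ]) = (q : ℍ[ℝ]) * v * star (q : ℍ[ℝ]) := rfl

theorem Ad_one (v : su2) : Ad 1 v = v := by
  ext1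
  simp [coe_Ad]

theorem Ad_mul (p q : SU2) (v : su2) : Ad (p * q) v = Ad p (Ad q v) := by
  ext1
  simp [coe_Ad, mul_assoc]

theorem Ad_inv_Ad (q : SU2) (v : su2) : Ad q⁻¹ (Ad q v) = v := by
  rw [← Ad_mul, inv_mul_cancel, Ad_one]

theorem continuous_Ad {X : Type*} [TopologicalSpace X] {f : X → SU2} {g : X → su2}
    (hf : Continuous f) (hg : Continuous g) : Continuous fun x => Ad (f x) (g x) := by
  refine Continuous.subtype_mk (f := fun x => (f x : ℍ[ℝ]) * (g x : ℍ[ℝ]) * star (f x : ℍ[ℝ])) ?_ _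
  fun_prop

/-- The imaginary part, as a linear map to `su(2)`. -/
def imL : ℍ[ℝ] →L[ℝ] su2 :=
  LinearMap.toContinuousLinearMap
    { toFun := fun q => ⟨q.im, by change q.im.re = 0; simp⟩
      map_add' := fun p q => by ext1; simp
      map_smul' := fun c q => by ext1; simp }

theorem coe_imL (q : ℍ[ℝ]) : (imL q : ℍ[ℝ]) = q.im := rfl

theorem imL_of_re_eq_zero {q : ℍ[ℝ]} (h : q.re = 0) : (imL q : ℍ[ℝ]) = q := by
  rw [coe_imL]
  ext <;> simp [h]

theorem imL_coe (v : su2) : imL v = v :=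
  Subtype.ext (imL_of_re_eq_zero v.2)

/-- Quaternionic conjugation, as a linear map. -/
def conjL : ℍ[ℝ] →L[ℝ] ℍ[ℝ] :=
  LinearMap.toContinuousLinearMap
    { toFun := star
      map_add' := star_add
      map_smul' := fun c q => by simp }

/-! ### Smooth families in `SU(2)` and their logarithmic derivatives -/

variable {P P' : Type} [NormedAddCommGroup P] [NormedSpace ℝ P] [NormedAddCommGroup P']
  [NormedSpace ℝ P']

/-- A smooth map to `SU(2)`. -/
def SmoothSU2 (f : P → SU2) : Prop := ContDiff ℝ ∞ fun p => (f p : ℍ[ℝ])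

namespace SmoothSU2

theorem const (q : SU2) : SmoothSU2 fun _ : P => q := contDiff_const

theorem mul {f g : P → SU2} (hf : SmoothSU2 f) (hg : SmoothSU2 g) :
    SmoothSU2 fun p => f p * g p :=
  ContDiff.mul hf hg

theorem inv {f : P → SU2} (hf : SmoothSU2 f) : SmoothSU2 fun p => (f p)⁻¹ :=
  conjL.contDiff.comp hf

theorem pow {f : P → SU2} (hf : SmoothSU2 f) (k : ℕ) : SmoothSU2 fun p => f p ^ k := by
  induction k with
  | zero => simpa using const 1
  | succ k ih => simpa only [pow_succ] using ih.mul hf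

theorem zpow {f : P → SU2} (hf : SmoothSU2 f) (k : ℤ) : SmoothSU2 fun p => f p ^ k := by
  cases k with
  | ofNat k => simpa using hf.pow k
  | negSucc k => simpa only [zpow_negSucc] using (hf.pow (k + 1)).inv

theorem list_prod {ι : Type} {f : ι → P → SU2} (hf : ∀ i, SmoothSU2 (f i)) (L : List ι) :
    SmoothSU2 fun p => (L.map fun i => f i p).prod := by
  induction L with
  | nil => simpa using const 1
  | cons i L ih => simpa only [List.map_cons, List.prod_cons] using (hf i).mul ih

theorem lift {α : Type} {x : P → α → SU2} (hx : ∀ E, SmoothSU2 fun p => x p E)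
    (w : FreeGroup α) : SmoothSU2 fun p => FreeGroup.lift (x p) w := by
  induction w using FreeGroup.induction_on with
  | C1 => simpa only [map_one] using const 1
  | of E => simpa only [FreeGroup.lift_apply_of] using hx E
  | inv_of E ih => simpa only [map_inv] using ih.inv
  | mul a b ha hb => simpa only [map_mul] using ha.mul hb

theorem pertMap {t : P → ℝ} (ht : ContDiff ℝ ∞ t) {f : P → SU2} (hf : SmoothSU2 f) :
    SmoothSU2 fun p => TracelessTangle.pertMap (t p) (f p) := by
  let _ : NormedAlgebra ℚ ℍ[ℝ] := NormedAlgebra.restrictScalars ℚ ℝ ℍ[ℝ]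
  have h1 : ContDiff ℝ ∞ (NormedSpace.exp : ℍ[ℝ] → ℍ[ℝ]) := by
    rw [contDiff_iff_contDiffAt]
    exact fun x => (NormedSpace.exp_analytic (𝕂 := ℝ) x).contDiffAt
  have h2 : ContDiff ℝ ∞ fun p => ((imL (f p) : su2) : ℍ[ℝ]) :=
    su2.subtypeL.contDiff.comp (imL.contDiff.comp hf)
  exact h1.comp (ht.smul h2)

theorem crossProd {n : ℕ} (c : SpecialCurve n) {x : P → Gen n → SU2} {m : P → SU2}
    (hx : ∀ E, SmoothSU2 fun p => x p E) (hm : SmoothSU2 m) (E : Gen n) :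
    SmoothSU2 fun p => TracelessTangle.crossProd c (x p) (m p) E :=
  (list_prod (fun q : ℤ × FreeGroup (Gen n) =>
    ((lift hx q.2).mul (hm.zpow q.1)).mul (lift hx q.2).inv) _).mul (hx E)

theorem comp {f : P → SU2} (hf : SmoothSU2 f) {φ : P' → P} (hφ : ContDiff ℝ ∞ φ) :
    SmoothSU2 fun p => f (φ p) :=
  ContDiff.comp (g := fun p => (f p : ℍ[ℝ])) hf hφ

theorem rep {α : Type} {R : Set (FreeGroup α)} {F : P → RepSpace (PresentedGroup R)}
    (hF : ∀ E, SmoothSU2 fun p => F p (PresentedGroup.of E)) (g : PresentedGroup R) :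
    SmoothSU2 fun p => F p g := by
  refine presentedGroup_induction (p := fun g => SmoothSU2 fun p => F p g) hF ?_ ?_ ?_ g
  · simpa only [map_one] using const 1
  · intro a b ha hb
    simpa only [map_mul] using ha.mul hb
  · intro a ha
    simpa only [map_inv] using ha.inv

theorem perturbRep {n : ℕ} (c : SpecialCurve n) {t : P → ℝ} (ht : ContDiff ℝ ∞ t)
    {F : P → RepSpace (SurfaceGroup n)}
    (hF : ∀ E, SmoothSU2 fun p => F p (SurfaceGroup.of E)) (E : Gen n) :
    SmoothSU2 fun p => TracelessTangle.perturbRep c (t p) (F p) (SurfaceGroup.of E) := by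
  simp only [perturbRep_of]
  exact crossProd c hF (pertMap ht (lift hF _)) E

theorem repPhi {n K : ℕ} (C : Fin K → SpecialCurve n) {t : P → Fin K → ℝ}
    (ht : ContDiff ℝ ∞ t) {F : P → RepSpace (SurfaceGroup n)}
    (hF : ∀ E, SmoothSU2 fun p => F p (SurfaceGroup.of E)) (E : Gen n) :
    SmoothSU2 fun p => TracelessTangle.repPhi C (F p) (t p) (SurfaceGroup.of E) := by
  simp only [TracelessTangle.repPhi]
  generalize List.finRange K = L
  induction L generalizing F with
  | nil => exact hF E
  | cons k L ih =>
    simp only [List.foldl_cons]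
    exact ih fun E => perturbRep (C k) ((contDiff_apply ℝ ℝ k).comp ht) hF E

theorem differentiableAt {f : P → SU2} (hf : SmoothSU2 f) (p : P) :
    DifferentiableAt ℝ (fun p => (f p : ℍ[ℝ])) p :=
  ContDiff.differentiable hf (by simp) p

theorem continuous {f : P → SU2} (hf : SmoothSU2 f) : Continuous f :=
  continuous_induced_rng.2 (ContDiff.continuous hf)

end SmoothSU2

/-- The logarithmic derivative `(df) f⁻¹` of a map to `SU(2)`. -/
def logDeriv (f : P → SU2) (p : P) : P →L[ℝ] su2 :=
  imL ∘L ((ContinuousLinearMap.mul ℝ ℍ[ℝ]).flip (star (f p : ℍ[ℝ]))) ∘L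
    fderiv ℝ (fun p => (f p : ℍ[ℝ])) p

theorem logDeriv_apply (f : P → SU2) (p v : P) : logDeriv f p v =
    imL (fderiv ℝ (fun p => (f p : ℍ[ℝ])) p v * star (f p : ℍ[ℝ])) := rfl

/-- The projection `imL` in `logDeriv` serves only to land in `su(2)`: differentiating `f f* = 1`
shows that `(df) f*` already has real part `0`. -/
theorem coe_logDeriv {f : P → SU2} {p : P} (hf : SmoothSU2 f) (v : P) :
    (logDeriv f p v : ℍ[ℝ]) =
      fderiv ℝ (fun p => (f p : ℍ[ℝ])) p v * star (f p : ℍ[ℝ]) := by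
  rw [logDeriv_apply]
  apply imL_of_re_eq_zero
  have h0 := (hf.differentiableAt p).hasFDerivAt
  have h1 : HasFDerivAt (fun p => star (f p : ℍ[ℝ])) _ p :=
    conjL.hasFDerivAt.comp p h0
  have h2 := h0.mul' h1
  have h3 : ((fun p => (f p : ℍ[ℝ])) * fun p => star (f p : ℍ[ℝ])) = fun _ => 1 := by
    funext p
    exact SU2.coe_mul_star _
  rw [h3] at h2
  have h4 := DFunLike.congr_fun (h2.unique (hasFDerivAt_const (1 : ℍ[ℝ]) p)) v
  change (f p : ℍ[ℝ]) * star (fderiv ℝ (fun p => (f p : ℍ[ℝ])) p v) +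
    fderiv ℝ (fun p => (f p : ℍ[ℝ])) p v * star (f p : ℍ[ℝ]) = 0 at h4
  have h5 := congrArg (fun q : ℍ[ℝ] => q.re) h4
  simp [Quaternion.re_mul] at h5
  simp [Quaternion.re_mul]
  linarith

theorem logDeriv_const (q : SU2) (p : P) : logDeriv (fun _ : P => q) p = 0 := by
  ext1 v
  simp [logDeriv_apply]

theorem logDeriv_mul {f g : P → SU2} (hf : SmoothSU2 f) (hg : SmoothSU2 g) (p v : P) :
    logDeriv (fun p => f p * g p) p v = logDeriv f p v + Ad (f p) (logDeriv g p v) := by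
  ext1
  rw [coe_logDeriv (hf.mul hg), Submodule.coe_add, coe_Ad, coe_logDeriv hf, coe_logDeriv hg]
  have h := (hf.differentiableAt p).hasFDerivAt.mul' (hg.differentiableAt p).hasFDerivAt
  have h' : fderiv ℝ (fun p => ((f p * g p : SU2) : ℍ[ℝ])) p = _ := h.fderiv
  rw [h']
  have e1 : star ((f p * g p : SU2) : ℍ[ℝ]) = star (g p : ℍ[ℝ]) * star (f p : ℍ[ℝ]) :=
    star_mul _ _
  rw [e1]
  simp only [add_apply, smul_apply, smul_eq_mul,
    MulOpposite.smul_eq_mul_unop, MulOpposite.unop_op]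
  rw [add_mul, add_comm]
  congr 1
  · rw [mul_assoc, ← mul_assoc (g p : ℍ[ℝ]), SU2.coe_mul_star, one_mul]
  · simp only [mul_assoc]

theorem logDeriv_inv {f : P → SU2} (hf : SmoothSU2 f) (p v : P) :
    logDeriv (fun p => (f p)⁻¹) p v = -Ad (f p)⁻¹ (logDeriv f p v) := by
  have h := logDeriv_mul hf.inv hf p v
  simp only [inv_mul_cancel, logDeriv_const] at h
  exact eq_neg_of_add_eq_zero_left h.symm

theorem logDeriv_comp {f : P → SU2} (hf : SmoothSU2 f) {φ : P' → P} {φ' : P' →L[ℝ] P} {p : P'}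
    (hφ : HasFDerivAt φ φ' p) (v : P') :
    logDeriv (fun p => f (φ p)) p v = logDeriv f (φ p) (φ' v) := by
  have h : HasFDerivAt (fun p => (f (φ p) : ℍ[ℝ])) _ p :=
    (hf.differentiableAt (φ p)).hasFDerivAt.comp p hφ
  rw [logDeriv_apply, h.fderiv]
  rfl

theorem continuous_logDeriv {f : P → SU2} (hf : SmoothSU2 f) (v : P) :
    Continuous fun p => logDeriv f p v := by
  simp only [logDeriv_apply]
  refine imL.continuous.comp (Continuous.mul ?_ ?_)
  · exact (ContDiff.continuous_fderiv_apply hf (by simp)).comp (continuous_id.prodMk continuous_const)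
  · exact continuous_star.comp (ContDiff.continuous hf)

/-- Where `f = 1` the adjoint twist in the product rule is trivial, and powers differentiate as in
an abelian group. The meridian is in this situation at `t = 0`. -/
theorem logDeriv_zpow {f : P → SU2} (hf : SmoothSU2 f) {p : P} (h1 : f p = 1) (k : ℤ) (v : P) :
    logDeriv (fun p => f p ^ k) p v = (k : ℝ) • logDeriv f p v := by
  have key : ∀ k : ℕ, logDeriv (fun p => f p ^ k) p v = (k : ℝ) • logDeriv f p v := by
    intro k
    induction k with
    | zero => simp [logDeriv_const]
    | succ k ih =>
      simp only [pow_succ]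
      rw [logDeriv_mul (hf.pow k) hf, ih, h1, one_pow, Ad_one]
      push_cast
      rw [add_smul, one_smul]
  cases k with
  | ofNat k => simpa using key k
  | negSucc k =>
    simp only [zpow_negSucc]
    rw [logDeriv_inv (hf.pow (k + 1)), key, h1, one_pow, inv_one, Ad_one, Int.cast_negSucc]
    module

theorem logDeriv_list_prod {ι : Type} {f : ι → P → SU2} (hf : ∀ i, SmoothSU2 (f i)) {p : P}
    (h1 : ∀ i, f i p = 1) (L : List ι) (v : P) :
    logDeriv (fun p => (L.map fun i => f i p).prod) p v =
      (L.map fun i => logDeriv (f i) p v).sum := by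
  induction L with
  | nil => simp [logDeriv_const]
  | cons i L ih =>
    simp only [List.map_cons, List.prod_cons, List.sum_cons]
    rw [logDeriv_mul (hf i) (.list_prod hf L), ih, h1, Ad_one]

theorem logDeriv_conj_const {f : P → SU2} (hf : SmoothSU2 f) (q : SU2) (p v : P) : logDeriv (fun p => q * f p * q⁻¹) p v = Ad q (logDeriv f p v) := by
  rw [logDeriv_mul ((SmoothSU2.const q).mul hf) (.const q⁻¹),
    logDeriv_mul (.const q) hf, logDeriv_const, logDeriv_const]
  simp

theorem logDeriv_pertMap (q : SU2) :
    logDeriv (fun s : ℝ => pertMap s q) 0 1 = imL q := by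
  have h : HasDerivAt (fun s : ℝ => NormedSpace.exp (s • (q : ℍ[ℝ]).im)) (q : ℍ[ℝ]).im 0 := by
    have := hasDerivAt_exp_smul_const (𝕂 := ℝ) (q : ℍ[ℝ]).im 0
    simpa using this
  have h' : fderiv ℝ (fun s : ℝ => (pertMap s q : ℍ[ℝ])) 0 1 = (q : ℍ[ℝ]).im := by
    rw [← h.deriv]
    rfl
  rw [logDeriv_apply, h', pertMap_zero]
  simp only [OneMemClass.coe_one, star_one, mul_one]
  exact imL_coe (imL q)

/-- The tangent vector at `t = 0` of the perturbation along the curve `c`. -/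
def curveTangent {n : ℕ} (x : Gen n → SU2) (c : SpecialCurve n) (E : Gen n) : su2 :=
  ((c.crossings E).map fun p =>
    (p.1 : ℝ) • Ad (FreeGroup.lift x p.2) (imL (FreeGroup.lift x c.loop : SU2))).sum

/-- All factors `g m^s g⁻¹` equal `1` at parameter `0`, so their derivatives add without twists,
each being `s Ad(g)` of the velocity of `m`; by `logDeriv_pertMap` this velocity is the imaginary
part of the longitude. -/
theorem logDeriv_perturbRep {n : ℕ} (c : SpecialCurve n) (ρ : RepSpace (SurfaceGroup n))
    (E : Gen n) : logDeriv (fun s : ℝ => perturbRep c s ρ (SurfaceGroup.of E)) 0 1 =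
      curveTangent (fun E => ρ (SurfaceGroup.of E)) c E := by
  simp only [perturbRep_of, crossProd, curveTangent]
  generalize FreeGroup.lift (fun E => ρ (SurfaceGroup.of E)) c.loop = q
  have hm : SmoothSU2 fun s : ℝ => pertMap s q := .pertMap contDiff_id (.const q)
  have hf : ∀ p : ℤ × FreeGroup (Gen n), SmoothSU2 fun s : ℝ =>
      FreeGroup.lift (fun E => ρ (SurfaceGroup.of E)) p.2 * pertMap s q ^ p.1 *
        (FreeGroup.lift (fun E => ρ (SurfaceGroup.of E)) p.2)⁻¹ := fun p =>
    ((SmoothSU2.const _).mul (hm.zpow _)).mul (.const _)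
  rw [logDeriv_mul (.list_prod hf _) (.const _), logDeriv_const, logDeriv_list_prod hf]
  · simp only [zero_apply, map_zero, add_zero]
    refine congrArg _ (List.map_congr_left fun p _ => ?_)
    rw [logDeriv_conj_const (hm.zpow _),
      logDeriv_zpow hm (pertMap_zero q), logDeriv_pertMap, map_smul]
  · intro p
    simp [pertMap_zero]

/-! ### Cocycles -/

variable {G : Type} [Group G]

/-- The cocycle of logarithmic derivatives of a family of representations. -/
def derivCocycle (F : P → RepSpace G) (hF : ∀ g, SmoothSU2 fun p => F p g) (p : P) :
    P →ₗ[ℝ] groupCohomology.cocycles₁ (Rep.of (adRep (F p))) where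
  toFun v := ⟨fun g => logDeriv (fun p => F p g) p v, by
    rw [groupCohomology.mem_cocycles₁_iff]
    intro g h
    simp only [map_mul]
    rw [logDeriv_mul (hF g) (hF h), add_comm]
    rfl⟩
  map_add' v w := by
    exact Subtype.ext (funext fun g => map_add _ v w)
  map_smul' a v := by
    exact Subtype.ext (funext fun g => map_smul _ a v)

/-- Surjectivity onto `H¹` follows from the stronger property that every cocycle, coboundaries
included, is a derivative of the lift. Coboundaries then need no separate description. -/
theorem submersiveAt_of_cocycles {K : ℕ} {f : (Fin K → ℝ) → CharVar G} {t : Fin K → ℝ}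
    (F : (Fin K → ℝ) → RepSpace G) (hF : ∀ g, SmoothSU2 fun p => F p g)
    (hf : ∀ s, CharVar.mk (F s) = f s)
    (h : ∀ z : groupCohomology.cocycles₁ (Rep.of (adRep (F t))), ∃ v, derivCocycle F hF t v = z) :
    SubmersiveAt f t := by
  refine ⟨F, Filter.Eventually.of_forall hf, fun g => (hF g).contDiffAt,
    (groupCohomology.H1π (Rep.of (adRep (F t)))).hom ∘ₗ derivCocycle F hF t, ?_, ?_⟩
  · intro v
    exact ⟨derivCocycle F hF t v, fun g => coe_logDeriv (hF g) v, rfl⟩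
  · intro y
    induction y using groupCohomology.H1_induction_on with
    | h z =>
      obtain ⟨v, hv⟩ := h z
      exact ⟨v, by rw [← hv]; rfl⟩

end TracelessTangle

namespace TracelessTangle

/-! ### Open conditions on families of linear maps -/

/-- The units of the Banach algebra of endomorphisms are open; in finite dimension pointwise
continuity of `A` gives continuity in norm. -/
theorem eventually_isUnit_clm {X V : Type} [TopologicalSpace X] [NormedAddCommGroup V]
    [NormedSpace ℝ V] [FiniteDimensional ℝ V] (A : X → V →ₗ[ℝ] V)
    (hA : ∀ v, Continuous fun x => A x v) {x₀ : X} (h : A x₀ = LinearMap.id) :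
    ∀ᶠ x in 𝓝 x₀, Function.Bijective (A x) := by
  have : CompleteSpace V := FiniteDimensional.complete ℝ V
  let B : X → V →L[ℝ] V := fun x => LinearMap.toContinuousLinearMap (A x)
  have hB : Continuous B := continuous_clm_apply.2 hA
  have h0 : IsUnit (B x₀) := by
    have : B x₀ = 1 := by
      ext v
      change A x₀ v = v
      rw [h]
      rfl
    rw [this]
    exact isUnit_one
  filter_upwards [hB.continuousAt.preimage_mem_nhds (Units.isOpen.mem_nhds h0)] with x hx
  obtain ⟨u, hu⟩ := hx
  have hu' : ∀ v, A x v = (u : V →L[ℝ] V) v := fun v => by rw [hu]; rfl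
  have h1 : ∀ v, (↑u⁻¹ : V →L[ℝ] V) ((u : V →L[ℝ] V) v) = v := fun v =>
    DFunLike.congr_fun u.inv_mul v
  have h2 : ∀ v, (u : V →L[ℝ] V) ((↑u⁻¹ : V →L[ℝ] V) v) = v := fun v =>
    DFunLike.congr_fun u.mul_inv v
  refine ⟨fun v w hvw => ?_, fun v => ⟨(↑u⁻¹ : V →L[ℝ] V) v, by rw [hu', h2]⟩⟩
  rw [hu', hu'] at hvw
  rw [← h1 v, hvw, h1]

/-- Composed with a right inverse of `A x₀`, the family is the identity at `x₀`, hence invertible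
nearby. The next lemma uses a left inverse in the same way. -/
theorem eventually_surjective {X V W : Type} [TopologicalSpace X] [AddCommGroup V] [Module ℝ V]
    [NormedAddCommGroup W] [NormedSpace ℝ W] [FiniteDimensional ℝ W] (A : X → V →ₗ[ℝ] W)
    (hA : ∀ v, Continuous fun x => A x v) {x₀ : X} (h : Function.Surjective (A x₀)) :
    ∀ᶠ x in 𝓝 x₀, Function.Surjective (A x) := by
  obtain ⟨B, hB⟩ := (A x₀).exists_rightInverse_of_surjective (LinearMap.range_eq_top.2 h)
  filter_upwards [eventually_isUnit_clm (fun x => A x ∘ₗ B) (fun v => hA (B v)) hB] with x hx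
  intro w
  obtain ⟨v, hv⟩ := hx.2 w
  exact ⟨B v, hv⟩

theorem eventually_injective {X V W : Type} [TopologicalSpace X] [NormedAddCommGroup V]
    [NormedSpace ℝ V] [FiniteDimensional ℝ V] [NormedAddCommGroup W] [NormedSpace ℝ W]
    [FiniteDimensional ℝ W] (A : X → V →ₗ[ℝ] W)
    (hA : ∀ v, Continuous fun x => A x v) {x₀ : X} (h : Function.Injective (A x₀)) :
    ∀ᶠ x in 𝓝 x₀, Function.Injective (A x) := by
  obtain ⟨B, hB⟩ := (A x₀).exists_leftInverse_of_injective (LinearMap.ker_eq_bot.2 h)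
  have hc : Continuous B := B.continuous_of_finiteDimensional
  filter_upwards [eventually_isUnit_clm (fun x => B ∘ₗ A x) (fun v => hc.comp (hA v)) hB] with x hx
  exact Function.Injective.of_comp hx.1

/-! ### The derivative of the surface relator -/

instance (n : ℕ) : DecidableEq (Gen n) := fun E E' =>
  match E, E' with
  | .A i, .A j => decidable_of_iff (i = j) (by simp)
  | .D i, .D j => decidable_of_iff (i = j) (by simp)
  | .A _, .D _ => isFalse (by simp)
  | .D _, .A _ => isFalse (by simp)

instance (n : ℕ) : Fintype (Gen n) where
  elems := Finset.univ.image Gen.A ∪ Finset.univ.image Gen.D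
  complete E := by cases E <;> simp

variable {n : ℕ}

/-- The derivative of the commutator `[A_l, D_l]` in the direction of `y`. -/
def commDeriv (x : Gen n → SU2) (l : Fin n) : (Gen n → su2) →ₗ[ℝ] su2 :=
  let prj (E : Gen n) : (Gen n → su2) →ₗ[ℝ] su2 := LinearMap.proj E
  prj (.A l) + Ad (x (.A l)) ∘ₗ prj (.D l) -
    Ad (x (.A l) * x (.D l) * (x (.A l))⁻¹) ∘ₗ prj (.A l) - Ad ⁅x (.A l), x (.D l)⁆ ∘ₗ prj (.D l)

theorem commDeriv_apply (x : Gen n → SU2) (l : Fin n) (y : Gen n → su2) :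
    commDeriv x l y = y (.A l) + Ad (x (.A l)) (y (.D l)) -
      Ad (x (.A l) * x (.D l) * (x (.A l))⁻¹) (y (.A l)) -
      Ad ⁅x (.A l), x (.D l)⁆ (y (.D l)) := rfl

/-- The derivative of a product of commutators `[A_l, D_l]` in the direction of `y`. -/
def relDeriv (x : Gen n → SU2) : List (Fin n) → (Gen n → su2) →ₗ[ℝ] su2
  | [] => 0
  | l :: L => commDeriv x l + Ad ⁅x (.A l), x (.D l)⁆ ∘ₗ relDeriv x L

theorem relDeriv_cons (x : Gen n → SU2) (l : Fin n) (L : List (Fin n)) (y : Gen n → su2) :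
    relDeriv x (l :: L) y = commDeriv x l y + Ad ⁅x (.A l), x (.D l)⁆ (relDeriv x L y) := rfl

theorem continuous_relDeriv {X : Type} [TopologicalSpace X] {x : X → Gen n → SU2}
    (hx : ∀ E, Continuous fun p => x p E) (L : List (Fin n)) (y : Gen n → su2) :
    Continuous fun p => relDeriv (x p) L y := by
  induction L with
  | nil => exact continuous_const
  | cons l L ih =>
    have hA := hx (.A l)
    have hD := hx (.D l)
    have hc : Continuous fun p => ⁅x p (.A l), x p (.D l)⁆ := by
      simp only [commutatorElement_def]
      fun_prop
    simp only [relDeriv_cons, commDeriv_apply]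
    refine Continuous.add ?_ (continuous_Ad hc ih)
    refine Continuous.sub (Continuous.sub ?_ ?_) (continuous_Ad hc continuous_const)
    · exact continuous_const.add (continuous_Ad hA continuous_const)
    · exact continuous_Ad (by fun_prop) continuous_const

section cocycle

variable {G : Type} [Group G] {ρ : RepSpace G}
  (z : groupCohomology.cocycles₁ (Rep.of (adRep ρ)))

/-- The value of a cocycle, as an element of `su(2)`. -/
def cocycleVal (g : G) : su2 := z g

theorem cocycleVal_mul (g h : G) :
    cocycleVal z (g * h) = cocycleVal z g + Ad (ρ g) (cocycleVal z h) := by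
  rw [add_comm]
  exact (groupCohomology.mem_cocycles₁_iff z.1).1 z.2 g h

theorem cocycleVal_one : cocycleVal z 1 = 0 := groupCohomology.cocycles₁_map_one z

theorem cocycleVal_inv (g : G) : cocycleVal z g⁻¹ = -Ad (ρ g)⁻¹ (cocycleVal z g) := by
  have h := cocycleVal_mul z g⁻¹ g
  rw [inv_mul_cancel, cocycleVal_one, map_inv] at h
  exact eq_neg_of_add_eq_zero_left h.symm

end cocycle

/-- The cocycle rule expands the value on a product of commutators exactly as the product rule
expands its derivative; on the surface relator this value is the value at `1`. -/
theorem relDeriv_cocycle {ρ : RepSpace (SurfaceGroup n)}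
    (z : groupCohomology.cocycles₁ (Rep.of (adRep ρ))) :
    relDeriv (fun E => ρ (SurfaceGroup.of E)) (List.finRange n)
      (fun E => cocycleVal z (SurfaceGroup.of E)) = 0 := by
  have key : ∀ L : List (Fin n), relDeriv (fun E => ρ (SurfaceGroup.of E)) L
      (fun E => cocycleVal z (SurfaceGroup.of E)) = cocycleVal z
        (L.map fun i => ⁅(SurfaceGroup.of (.A i) : SurfaceGroup n), SurfaceGroup.of (.D i)⁆).prod := by
    intro L
    induction L with
    | nil => exact (cocycleVal_one z).symm
    | cons l L ih =>
      rw [relDeriv_cons, ih, List.map_cons, List.prod_cons, cocycleVal_mul, commDeriv_apply]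
      simp only [commutatorElement_def, cocycleVal_mul, cocycleVal_inv, map_mul, map_inv, map_neg,
        Ad_mul]
      abel
  rw [key, surface_relation, cocycleVal_one]

theorem cocycle_ext_of {α : Type} {R : Set (FreeGroup α)} {ρ : RepSpace (PresentedGroup R)}
    {z z' : groupCohomology.cocycles₁ (Rep.of (adRep ρ))}
    (h : ∀ E, cocycleVal z (PresentedGroup.of E) = cocycleVal z' (PresentedGroup.of E)) :
    z = z' := by
  have key : ∀ g, cocycleVal z g = cocycleVal z' g := by
    refine presentedGroup_induction h ?_ ?_ ?_
    · rw [cocycleVal_one, cocycleVal_one]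
    · intro a b ha hb
      rw [cocycleVal_mul, cocycleVal_mul, ha, hb]
    · intro a ha
      rw [cocycleVal_inv, cocycleVal_inv, ha]
  exact Subtype.ext (funext key)

/-! ### Submersivity is an open condition -/

/-- The auxiliary map `S` replaces a dimension count: `hspan` and `hS` are both open conditions,
while the dimension of the span of the derivatives alone could not be compared with that of the
cocycles without computing the latter. The parameter `θ` is carried along so that the neighbourhood
is open in `(θ, t)` jointly. -/
theorem eventually_submersiveAt {Θ : Type} [NormedAddCommGroup Θ] [NormedSpace ℝ Θ] {K : ℕ}
    (C : Fin K → SpecialCurve n) (F : Θ → RepSpace (SurfaceGroup n))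
    (hF : ∀ E, SmoothSU2 fun θ => F θ (SurfaceGroup.of E)) (θ₀ : Θ)
    (S : su2 →ₗ[ℝ] (Gen n → su2))
    (hspan : Submodule.span ℝ (Set.range fun k =>
      curveTangent (fun E => F θ₀ (SurfaceGroup.of E)) (C k)) ⊔ LinearMap.range S = ⊤)
    (hS : Function.Injective
      (relDeriv (fun E => F θ₀ (SurfaceGroup.of E)) (List.finRange n) ∘ₗ S)) :
    ∀ᶠ p : Θ × (Fin K → ℝ) in 𝓝 (θ₀, 0), SubmersiveAt (Phi C (CharVar.mk (F p.1))) p.2 := by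
  let H : Θ × (Fin K → ℝ) → RepSpace (SurfaceGroup n) := fun p => repPhi C (F p.1) p.2
  have hH : ∀ E, SmoothSU2 fun p => H p (SurfaceGroup.of E) := fun E =>
    SmoothSU2.repPhi C (t := fun p : Θ × (Fin K → ℝ) => p.2) (F := fun p => F p.1) contDiff_snd
      (fun E => (hF E).comp contDiff_fst) E
  -- Only the derivative in the perturbation parameters enters, whence `inr`; the parameter `θ` just
  -- moves the base point.
  let Ψ : Θ × (Fin K → ℝ) → ((Fin K → ℝ) × su2) →ₗ[ℝ] (Gen n → su2) := fun p =>
    (LinearMap.pi fun E => (logDeriv (fun p => H p (SurfaceGroup.of E)) p).toLinearMap ∘ₗ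
      LinearMap.inr ℝ Θ (Fin K → ℝ)).coprod S
  have hΨ : ∀ p v w E, Ψ p (v, w) E =
      logDeriv (fun p => H p (SurfaceGroup.of E)) p (0, v) + S w E := fun p v w E => rfl
  have hslice : ∀ (p : Θ × (Fin K → ℝ)) (v) (E), logDeriv (fun s => H (p.1, s) (SurfaceGroup.of E))
      p.2 v = logDeriv (fun p => H p (SurfaceGroup.of E)) p (0, v) := fun p v E =>
    logDeriv_comp (hH E) (hasFDerivAt_prodMk_right p.1 p.2) v
  have hΨc : ∀ v, Continuous fun p => Ψ p v := by
    rintro ⟨v, w⟩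
    refine continuous_pi fun E => ?_
    simp only [hΨ]
    exact (continuous_logDeriv (hH E) _).add continuous_const
  have hH0 : H (θ₀, 0) = F θ₀ := repPhi_zero C _
  have hΨs : Function.Surjective (Ψ (θ₀, 0)) := by
    rw [← LinearMap.range_eq_top, ← top_le_iff, ← hspan, sup_le_iff, Submodule.span_le]
    constructor
    · rintro _ ⟨k, rfl⟩
      refine ⟨(Pi.single k 1, 0), funext fun E => ?_⟩
      beta_reduce
      rw [hΨ, map_zero, Pi.zero_apply, add_zero, ← logDeriv_perturbRep,
        ← hslice (θ₀, 0) (Pi.single k 1) E]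
      have h1 : HasFDerivAt (fun s : ℝ => (Pi.single k s : Fin K → ℝ))
          (ContinuousLinearMap.single ℝ (fun _ : Fin K => ℝ) k) 0 :=
        (ContinuousLinearMap.single ℝ (fun _ : Fin K => ℝ) k).hasFDerivAt
      have h2 : SmoothSU2 fun s => H (θ₀, s) (SurfaceGroup.of E) :=
        (hH E).comp (contDiff_prodMk_right θ₀)
      have h3 := logDeriv_comp h2 h1 1
      simp only [H, repPhi_single, Pi.single_zero] at h3
      exact h3.symm
    · rintro _ ⟨w, rfl⟩
      refine ⟨(0, w), funext fun E => ?_⟩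
      rw [hΨ]
      change logDeriv (fun p => H p (SurfaceGroup.of E)) (θ₀, 0) 0 + S w E = S w E
      rw [map_zero, zero_add]
  rw [← hH0] at hS
  filter_upwards [eventually_surjective Ψ hΨc hΨs,
    eventually_injective (fun p => relDeriv (fun E => H p (SurfaceGroup.of E)) (List.finRange n) ∘ₗ S)
      (fun w => continuous_relDeriv (fun E => (hH E).continuous) _ (S w)) hS] with p hp1 hp2
  have hsm : ∀ g, SmoothSU2 fun s => H (p.1, s) g := SmoothSU2.rep fun E =>
    (hH E).comp (contDiff_prodMk_right p.1)
  refine submersiveAt_of_cocycles (fun s => H (p.1, s)) hsm (fun s => mk_repPhi C _ s) fun z => ?_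
  obtain ⟨⟨v, w⟩, hvw⟩ := hp1 fun E => cocycleVal z (SurfaceGroup.of E)
  have hval : ∀ E, cocycleVal z (SurfaceGroup.of E) =
      cocycleVal (derivCocycle _ hsm p.2 v) (SurfaceGroup.of E) + S w E := by
    intro E
    rw [← congrFun hvw E, hΨ, ← hslice]
    rfl
  -- Both `z` and the derivative are cocycles at the same representation, so `relDeriv` kills their
  -- difference `S w`.
  have hw : w = 0 := by
    apply hp2
    rw [map_zero]
    have h1 := relDeriv_cocycle z
    have h2 := relDeriv_cocycle (derivCocycle _ hsm p.2 v)
    have h3 : (fun E => cocycleVal z (SurfaceGroup.of E)) =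
      (fun E => cocycleVal (derivCocycle _ hsm p.2 v) (SurfaceGroup.of E)) + S w := funext hval
    rw [h3, map_add, h2, zero_add] at h1
    exact h1
  refine ⟨v, cocycle_ext_of fun E => ?_⟩
  have h := hval E
  rw [hw, map_zero, Pi.zero_apply, add_zero] at h
  exact h.symm

end TracelessTangle

namespace TracelessTangle

/-! ### Binary dihedral normal forms -/

theorem mem_unitary_of_normSq {q : ℍ[ℝ]} (h : Quaternion.normSq q = 1) :
    q ∈ unitary ℍ[ℝ] := by
  rw [Unitary.mem_iff, Quaternion.star_mul_self, Quaternion.self_mul_star, h]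
  simp

theorem SU2.normSq_eq_one (q : SU2) : Quaternion.normSq (q : ℍ[ℝ]) = 1 := by
  have h := SU2.coe_mul_star q
  rw [Quaternion.self_mul_star] at h
  exact Quaternion.coe_injective h

theorem circle_sq (z : Circle) : (z : ℂ).re ^ 2 + (z : ℂ).im ^ 2 = 1 := by
  have h := Circle.normSq_coe z
  rw [Complex.normSq_apply] at h
  linarith

/-- The quaternion `a + b i + c j + d k`. -/
def quat (a b c d : ℝ) : ℍ[ℝ] := ⟨a, b, c, d⟩

@[simp] theorem re_quat (a b c d : ℝ) : (quat a b c d).re = a := rfl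
@[simp] theorem imI_quat (a b c d : ℝ) : (quat a b c d).imI = b := rfl
@[simp] theorem imJ_quat (a b c d : ℝ) : (quat a b c d).imJ = c := rfl
@[simp] theorem imK_quat (a b c d : ℝ) : (quat a b c d).imK = d := rfl

theorem normSq_quat (a b c d : ℝ) :
    Quaternion.normSq (quat a b c d) = a ^ 2 + b ^ 2 + c ^ 2 + d ^ 2 := by
  rw [Quaternion.normSq_def']
  simp

/-- The quaternions `±i`. -/
def qA (b : Bool) : SU2 :=
  ⟨quat 0 (if b then -1 else 1) 0 0, mem_unitary_of_normSq (by cases b <;> simp [normSq_quat])⟩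

/-- The quaternions `z` and `z j`, for a complex unit `z`. -/
def qD (e : Bool) (z : Circle) : SU2 :=
  ⟨if e then quat 0 0 (z : ℂ).re (z : ℂ).im else quat (z : ℂ).re (z : ℂ).im 0 0,
    mem_unitary_of_normSq (by
      have := circle_sq z
      cases e <;> simpa [normSq_quat] using this)⟩

/-- The signs `±1`. -/
def sgn (e : Bool) : SU2 := if e then -1 else 1

theorem coe_qA_false : (qA false : ℍ[ℝ]) = quat 0 1 0 0 := rfl

theorem coe_qA_true : (qA true : ℍ[ℝ]) = quat 0 (-1) 0 0 := rfl

theorem coe_qD_false (z : Circle) : (qD false z : ℍ[ℝ]) = quat ((z : ℂ).re) ((z : ℂ).im) 0 0 := rfl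

theorem coe_qD_true (z : Circle) : (qD true z : ℍ[ℝ]) = quat 0 0 ((z : ℂ).re) ((z : ℂ).im) := rfl

theorem SU2.coe_mul (p q : SU2) : ((p * q : SU2) : ℍ[ℝ]) = p * q := rfl

theorem SU2.coe_neg (p : SU2) : ((-p : SU2) : ℍ[ℝ]) = -p := rfl

theorem SU2.coe_one : ((1 : SU2) : ℍ[ℝ]) = 1 := rfl

theorem qA_mul_qD (b e : Bool) (z : Circle) : qA b * qD e z = sgn e * qD e z * qA b := by
  ext1
  cases b <;> cases e <;> ext <;>
    simp [sgn, SU2.coe_neg, coe_qA_false, coe_qA_true, coe_qD_false, coe_qD_true,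
      Quaternion.re_mul, Quaternion.imI_mul, Quaternion.imJ_mul, Quaternion.imK_mul]

theorem commutator_qA_qD (b e : Bool) (z : Circle) : ⁅qA b, qD e z⁆ = sgn e := by
  rw [commutatorElement_def, qA_mul_qD]
  group

theorem Ad_sgn (e : Bool) (v : su2) : Ad (sgn e) v = v := by
  ext1
  cases e <;> simp [coe_Ad, sgn, SU2.coe_neg]

theorem sgn_inv (e : Bool) : (sgn e)⁻¹ = sgn e := by
  cases e <;> simp [sgn]

theorem sgn_mul (e e' : Bool) : sgn e * sgn e' = sgn (xor e e') := by
  cases e <;> cases e' <;> simp [sgn]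

theorem mul_sgn (e : Bool) (q : SU2) : q * sgn e = sgn e * q := by
  cases e <;> simp [sgn]

variable {n : ℕ}

/-- The values of the generators in the normal form: `A_l = ±i`, and `D_l` is `z_l` or `z_l j`. -/
def normalVal (σ ε : Fin n → Bool) (z : Fin n → Circle) : Gen n → SU2
  | .A l => qA (σ l)
  | .D l => qD (ε l) (z l)

/-- The number of the `D_l` of the form `z_l j` is even. -/
def IsEven (ε : Fin n → Bool) : Prop := ((List.finRange n).map fun l => sgn (ε l)).prod = 1

theorem normalVal_relation (σ ε : Fin n → Bool) (z : Fin n → Circle) :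
    ((List.finRange n).map fun l => ⁅normalVal σ ε z (.A l), normalVal σ ε z (.D l)⁆).prod =
      ((List.finRange n).map fun l => sgn (ε l)).prod := by
  refine congrArg _ (List.map_congr_left fun l _ => commutator_qA_qD _ _ _)

/-- The representations in normal form. -/
def normalRep (σ ε : Fin n → Bool) (hε : IsEven ε) (z : Fin n → Circle) :
    RepSpace (SurfaceGroup n) :=
  PresentedGroup.toGroup (f := normalVal σ ε z) (by
    intro r hr
    rw [Set.mem_singleton_iff] at hr
    rw [hr, lift_surfaceWord, normalVal_relation]
    exact hε)

theorem normalRep_of (σ ε : Fin n → Bool) (hε : IsEven ε) (z : Fin n → Circle) (E : Gen n) :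
    normalRep σ ε hε z (SurfaceGroup.of E) = normalVal σ ε z E :=
  PresentedGroup.toGroup.of _

/-! ### Tangent vectors of the special curves at a normal form -/

/-- Every commutator `[A_l, D_l]` is `±1` at a normal form. So `Z` and `V` are central signs: they
scale a curve tangent by a nonzero factor and disappear from the adjoint action. -/
theorem lift_wZ_normalVal (σ ε : Fin n → Bool) (z : Fin n → Circle) (i j : Fin n) :
    ∃ e, FreeGroup.lift (normalVal σ ε z) (wZ i j) = sgn e := by
  rw [wZ, map_list_prod, List.map_map]
  induction between i j with
  | nil => exact ⟨false, rfl⟩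
  | cons l L ih =>
    obtain ⟨e, he⟩ := ih
    refine ⟨xor (ε l) e, ?_⟩
    rw [List.map_cons, List.prod_cons, he, ← sgn_mul]
    congr 1
    simp [wA, wD, map_commutatorElement, normalVal, commutator_qA_qD]

theorem lift_wV_normalVal (σ ε : Fin n → Bool) (z : Fin n → Circle) (i j : Fin n) :
    ∃ e, FreeGroup.lift (normalVal σ ε z) (wV i j) = sgn e := by
  obtain ⟨e, he⟩ := lift_wZ_normalVal σ ε z i j
  refine ⟨xor (xor (ε i) e) (ε j), ?_⟩
  rw [wV, map_mul, map_mul, he, ← sgn_mul, ← sgn_mul]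
  simp [wA, wD, map_commutatorElement, normalVal, commutator_qA_qD]

theorem imL_sgn_mul (e : Bool) (q : SU2) :
    ∃ s : ℝ, s ≠ 0 ∧ imL (sgn e * q : SU2) = s • imL q := by
  cases e
  · exact ⟨1, one_ne_zero, by simp [sgn]⟩
  · exact ⟨-1, by simp, by simp [sgn, SU2.coe_neg]; module⟩

section tangents

variable (σ ε : Fin n → Bool) (z : Fin n → Circle) (i j : Fin n) (h : i ≠ j)

/-- The families `VIII`–`XI` cross no arcs of other sectors, so their tangents live in the sectors
`i` and `j`. Only lines spanned by these vectors matter, so the sign due to `Z` and `V` is hidden in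
`s`. -/
theorem curveTangent_VIII :
    ∃ s : ℝ, s ≠ 0 ∧
      curveTangent (normalVal σ ε z) (.VIII i j h) (.A i) = 0 ∧
      curveTangent (normalVal σ ε z) (.VIII i j h) (.D i) =
        s • imL ((qD (ε j) (z j))⁻¹ * qA (σ i) : SU2) ∧
      curveTangent (normalVal σ ε z) (.VIII i j h) (.A j) =
        s • imL ((qD (ε j) (z j))⁻¹ * qA (σ i) : SU2) ∧
      curveTangent (normalVal σ ε z) (.VIII i j h) (.D j) = 0 ∧
      ∀ k, k ≠ i → k ≠ j → curveTangent (normalVal σ ε z) (.VIII i j h) (.A k) = 0 ∧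
        curveTangent (normalVal σ ε z) (.VIII i j h) (.D k) = 0 := by
  obtain ⟨e, he⟩ := lift_wZ_normalVal σ ε z i j
  obtain ⟨e', he'⟩ := lift_wV_normalVal σ ε z i j
  obtain ⟨s, hs, hl⟩ := imL_sgn_mul (xor e e') ((qD (ε j) (z j))⁻¹ * qA (σ i))
  have hloop : FreeGroup.lift (normalVal σ ε z) (SpecialCurve.VIII i j h).loop =
      sgn (xor e e') * ((qD (ε j) (z j))⁻¹ * qA (σ i)) := by
    simp only [SpecialCurve.loop, map_mul, map_inv, he, he', wA, wD, FreeGroup.lift_apply_of,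
      normalVal, sgn_inv, ← sgn_mul]
    rw [mul_assoc (sgn e), mul_sgn]
    simp only [mul_assoc]
  refine ⟨s, hs, ?_⟩
  simp only [curveTangent, hloop, hl]
  refine ⟨?_, ?_, ?_, ?_, fun k hki hkj => ⟨?_, ?_⟩⟩ <;>
    simp [SpecialCurve.crossings, sgn_inv, Ad_sgn, Ad_one, *, h.symm]

theorem curveTangent_IX :
    ∃ s : ℝ, s ≠ 0 ∧
      curveTangent (normalVal σ ε z) (.IX i j h) (.A i) =
        -(s • Ad (qA (σ i)) (imL ((qD (ε j) (z j))⁻¹ * qA (σ i) * qD (ε i) (z i) : SU2))) ∧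
      curveTangent (normalVal σ ε z) (.IX i j h) (.D i) =
        s • imL ((qD (ε j) (z j))⁻¹ * qA (σ i) * qD (ε i) (z i) : SU2) ∧
      curveTangent (normalVal σ ε z) (.IX i j h) (.A j) =
        s • imL ((qD (ε j) (z j))⁻¹ * qA (σ i) * qD (ε i) (z i) : SU2) ∧
      curveTangent (normalVal σ ε z) (.IX i j h) (.D j) = 0 ∧
      ∀ k, k ≠ i → k ≠ j → curveTangent (normalVal σ ε z) (.IX i j h) (.A k) = 0 ∧
        curveTangent (normalVal σ ε z) (.IX i j h) (.D k) = 0 := by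
  obtain ⟨e, he⟩ := lift_wZ_normalVal σ ε z i j
  obtain ⟨e', he'⟩ := lift_wV_normalVal σ ε z i j
  obtain ⟨s, hs, hl⟩ := imL_sgn_mul (xor e e') ((qD (ε j) (z j))⁻¹ * qA (σ i) * qD (ε i) (z i))
  have hloop : FreeGroup.lift (normalVal σ ε z) (SpecialCurve.IX i j h).loop =
      sgn (xor e e') * ((qD (ε j) (z j))⁻¹ * qA (σ i) * qD (ε i) (z i)) := by
    simp only [SpecialCurve.loop, map_mul, map_inv, he, he', wA, wD, FreeGroup.lift_apply_of,
      normalVal, sgn_inv, ← sgn_mul]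
    rw [mul_assoc (sgn e), mul_sgn]
    simp only [mul_assoc]
  refine ⟨s, hs, ?_⟩
  simp only [curveTangent, hloop, hl]
  refine ⟨?_, ?_, ?_, ?_, fun k hki hkj => ⟨?_, ?_⟩⟩ <;>
    simp [SpecialCurve.crossings, sgn_inv, Ad_sgn, Ad_one, wA, normalVal, *, h.symm] <;> module

theorem curveTangent_X :
    ∃ s : ℝ, s ≠ 0 ∧
      curveTangent (normalVal σ ε z) (.X i j h) (.A i) =
        -(s • imL (qD (ε j) (z j) * qD (ε i) (z i) : SU2)) ∧
      curveTangent (normalVal σ ε z) (.X i j h) (.D i) = 0 ∧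
      ∀ k, k ≠ i → k ≠ j → curveTangent (normalVal σ ε z) (.X i j h) (.A k) = 0 ∧
        curveTangent (normalVal σ ε z) (.X i j h) (.D k) = 0 := by
  obtain ⟨e, he⟩ := lift_wZ_normalVal σ ε z i j
  obtain ⟨e', he'⟩ := lift_wV_normalVal σ ε z i j
  obtain ⟨s, hs, hl⟩ := imL_sgn_mul (xor e' e) (qD (ε j) (z j) * qD (ε i) (z i))
  have hloop : FreeGroup.lift (normalVal σ ε z) (SpecialCurve.X i j h).loop =
      sgn (xor e' e) * (qD (ε j) (z j) * qD (ε i) (z i)) := by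
    simp only [SpecialCurve.loop, map_mul, map_inv, he, he', wD, FreeGroup.lift_apply_of,
      normalVal, sgn_inv, ← sgn_mul]
    rw [mul_assoc (sgn e'), mul_sgn]
    simp only [mul_assoc]
  refine ⟨s, hs, ?_⟩
  simp only [curveTangent, hloop, hl]
  refine ⟨?_, ?_, fun k hki hkj => ⟨?_, ?_⟩⟩ <;>
    simp [SpecialCurve.crossings, Ad_one, *] <;> module

theorem curveTangent_XI :
    ∃ s : ℝ, s ≠ 0 ∧
      curveTangent (normalVal σ ε z) (.XI i j h) (.A i) =
        -(s • Ad (qA (σ i)) (imL (qA (σ j) * qA (σ i) * qD (ε i) (z i) : SU2))) ∧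
      curveTangent (normalVal σ ε z) (.XI i j h) (.D i) =
        s • imL (qA (σ j) * qA (σ i) * qD (ε i) (z i) : SU2) ∧
      curveTangent (normalVal σ ε z) (.XI i j h) (.A j) = 0 ∧
      curveTangent (normalVal σ ε z) (.XI i j h) (.D j) =
        s • Ad (qA (σ j))⁻¹ (imL (qA (σ j) * qA (σ i) * qD (ε i) (z i) : SU2)) ∧
      ∀ k, k ≠ i → k ≠ j → curveTangent (normalVal σ ε z) (.XI i j h) (.A k) = 0 ∧
        curveTangent (normalVal σ ε z) (.XI i j h) (.D k) = 0 := by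
  obtain ⟨e, he⟩ := lift_wZ_normalVal σ ε z i j
  obtain ⟨e', he'⟩ := lift_wV_normalVal σ ε z i j
  obtain ⟨s, hs, hl⟩ := imL_sgn_mul (xor e e') (qA (σ j) * qA (σ i) * qD (ε i) (z i))
  have hloop : FreeGroup.lift (normalVal σ ε z) (SpecialCurve.XI i j h).loop =
      sgn (xor e e') * (qA (σ j) * qA (σ i) * qD (ε i) (z i)) := by
    simp only [SpecialCurve.loop, map_mul, map_inv, he, he', wA, wD, FreeGroup.lift_apply_of,
      normalVal, sgn_inv, ← sgn_mul]
    rw [mul_assoc (sgn e), mul_sgn]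
    simp only [mul_assoc]
  refine ⟨s, hs, ?_⟩
  simp only [curveTangent, hloop, hl]
  refine ⟨?_, ?_, ?_, ?_, fun k hki hkj => ⟨?_, ?_⟩⟩ <;>
    simp [SpecialCurve.crossings, sgn_inv, Ad_sgn, Ad_one, Ad_mul, wA, normalVal, *, h.symm] <;> module

end tangents

end TracelessTangle

namespace TracelessTangle

/-! ### The special curves span the cocycles at a normal form -/

/-- The imaginary quaternion `a i + b j + c k`. -/
def mkSu (a b c : ℝ) : su2 := ⟨quat 0 a b c, rfl⟩

theorem coe_mkSu (a b c : ℝ) : (mkSu a b c : ℍ[ℝ]) = quat 0 a b c := rfl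

theorem su2_eq_mkSu (u : su2) :
    u = mkSu (u : ℍ[ℝ]).imI (u : ℍ[ℝ]).imJ (u : ℍ[ℝ]).imK := by
  have h : (u : ℍ[ℝ]).re = 0 := u.2
  ext1
  ext <;> simp [coe_mkSu, h]

theorem mkSu_add (a b c a' b' c' : ℝ) :
    mkSu a b c + mkSu a' b' c' = mkSu (a + a') (b + b') (c + c') := by
  ext1
  ext <;> simp [coe_mkSu]

theorem smul_mkSu (s a b c : ℝ) : s • mkSu a b c = mkSu (s * a) (s * b) (s * c) := by
  ext1
  ext <;> simp [coe_mkSu]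

theorem neg_mkSu (a b c : ℝ) : -mkSu a b c = mkSu (-a) (-b) (-c) := by
  ext1
  ext <;> simp [coe_mkSu]

/-- The numbers `a`, `b` will be the cosine and sine of one angle; either may vanish, but the
combination with coefficients `a`, `b` gives `a² + b² = 1`. -/
theorem mkSu_I_mem {N : Submodule ℝ su2} {a b : ℝ} (hab : a ^ 2 + b ^ 2 = 1)
    (ha : mkSu a 0 0 ∈ N) (hb : mkSu b 0 0 ∈ N) (x : ℝ) : mkSu x 0 0 ∈ N := by
  have h := N.add_mem (N.smul_mem (x * a) ha) (N.smul_mem (x * b) hb)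
  rw [smul_mkSu, smul_mkSu, mkSu_add] at h
  convert h using 2
  · linear_combination -x * hab
  · ring
  · ring

/-- The two given vectors form a rotated orthonormal basis of the `jk`-plane. -/
theorem mkSu_JK_mem {N : Submodule ℝ su2} {a b : ℝ} (hab : a ^ 2 + b ^ 2 = 1)
    (h1 : mkSu 0 a b ∈ N) (h2 : mkSu 0 (-b) a ∈ N) (x y : ℝ) : mkSu 0 x y ∈ N := by
  have h := N.add_mem (N.smul_mem (x * a + y * b) h1) (N.smul_mem (y * a - x * b) h2)
  rw [smul_mkSu, smul_mkSu, mkSu_add] at h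
  convert h using 2
  · ring
  · linear_combination -x * hab
  · linear_combination -y * hab

theorem su2_eq_top {N : Submodule ℝ su2} (h1 : ∀ x, mkSu x 0 0 ∈ N)
    (h2 : ∀ x y, mkSu 0 x y ∈ N) (u : su2) : u ∈ N := by
  rw [su2_eq_mkSu u]
  have h := N.add_mem (h1 (u : ℍ[ℝ]).imI) (h2 (u : ℍ[ℝ]).imJ (u : ℍ[ℝ]).imK)
  rw [mkSu_add] at h
  simpa using h

theorem circle_mul_inv (w z : Circle) : ((w : ℂ).re * (z : ℂ).re + (w : ℂ).im * (z : ℂ).im) ^ 2 +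
    ((w : ℂ).im * (z : ℂ).re - (w : ℂ).re * (z : ℂ).im) ^ 2 = 1 := by
  have h1 := circle_sq w
  have h2 := circle_sq z
  linear_combination ((z : ℂ).re ^ 2 + (z : ℂ).im ^ 2) * h1 + h2

section computations

variable (b b' : Bool) (w z : Circle)

theorem coe_inv_qD_true : (((qD true w)⁻¹ : SU2) : ℍ[ℝ]) =
    quat 0 0 (-(w : ℂ).re) (-(w : ℂ).im) := by
  rw [SU2.coe_inv, coe_qD_true]
  ext <;> simp

theorem coe_inv_qD_false : (((qD false w)⁻¹ : SU2) : ℍ[ℝ]) =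
    quat (w : ℂ).re (-(w : ℂ).im) 0 0 := by
  rw [SU2.coe_inv, coe_qD_false]
  ext <;> simp

theorem imL_quat (x y u v : ℝ) : imL (quat x y u v) = mkSu y u v := by
  ext1
  rw [coe_imL]
  ext <;> simp [coe_mkSu]

theorem quat_mul (a b c d a' b' c' d' : ℝ) : quat a b c d * quat a' b' c' d' =
    quat (a * a' - b * b' - c * c' - d * d') (a * b' + b * a' + c * d' - d * c')
      (a * c' - b * d' + c * a' + d * b') (a * d' + b * c' - c * b' + d * a') := by
  ext <;> simp [Quaternion.re_mul, Quaternion.imI_mul, Quaternion.imJ_mul, Quaternion.imK_mul]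

theorem star_quat (a b c d : ℝ) : star (quat a b c d) = quat a (-b) (-c) (-d) := by
  ext <;> simp

theorem coe_qA : (qA b : ℍ[ℝ]) = quat 0 (if b then -1 else 1) 0 0 := rfl

theorem Ad_qA (x y v : ℝ) : Ad (qA b) (mkSu x y v) = mkSu x (-y) (-v) := by
  ext1
  rw [coe_Ad, coe_qA, coe_mkSu, star_quat, quat_mul, quat_mul, coe_mkSu]
  cases b <;> simp

theorem Ad_inv_qA (x y v : ℝ) : Ad (qA b)⁻¹ (mkSu x y v) = mkSu x (-y) (-v) := by
  have h := Ad_inv_Ad (qA b) (mkSu x (-y) (-v))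
  rwa [Ad_qA, neg_neg, neg_neg] at h

theorem Ad_qD_I (e : Bool) (x : ℝ) :
    Ad (qD e z) (mkSu x 0 0) = mkSu (if e then -x else x) 0 0 := by
  have h := circle_sq z
  ext1
  rw [coe_Ad, coe_mkSu, coe_mkSu]
  cases e
  · rw [coe_qD_false, star_quat, quat_mul, quat_mul]
    simp only [Bool.false_eq_true, if_false]
    congr 1
    · ring
    · linear_combination x * h
    · ring
    · ring
  · rw [coe_qD_true, star_quat, quat_mul, quat_mul]
    simp only [if_true]
    congr 1
    · ring
    · linear_combination -x * h
    · ring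
    · ring

theorem imL_VIII : ∃ s : ℝ, s ≠ 0 ∧ imL ((qD true w)⁻¹ * qA b : SU2) =
    s • mkSu 0 (-(w : ℂ).im) (w : ℂ).re := by
  refine ⟨if b then -1 else 1, by cases b <;> simp, ?_⟩
  rw [SU2.coe_mul, coe_inv_qD_true, coe_qA, quat_mul, imL_quat, smul_mkSu]
  cases b <;> simp

theorem imL_XI : ∃ s : ℝ, s ≠ 0 ∧ imL (qA b' * qA b * qD true w : SU2) =
    s • mkSu 0 (w : ℂ).re (w : ℂ).im := by
  refine ⟨-(if b then -1 else 1) * (if b' then -1 else 1), by cases b <;> cases b' <;> simp, ?_⟩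
  rw [SU2.coe_mul, SU2.coe_mul, coe_qA, coe_qA, coe_qD_true, quat_mul, quat_mul, imL_quat,
    smul_mkSu]
  cases b <;> cases b' <;> simp

theorem imL_III_true : ∃ s : ℝ, s ≠ 0 ∧ imL (qD true w * qA b : SU2) =
    s • mkSu 0 (-(w : ℂ).im) (w : ℂ).re := by
  refine ⟨-(if b then -1 else 1), by cases b <;> simp, ?_⟩
  rw [SU2.coe_mul, coe_qD_true, coe_qA, quat_mul, imL_quat, smul_mkSu]
  cases b <;> simp

theorem imL_III_false : ∃ s : ℝ, s ≠ 0 ∧ imL (qD false w * qA b : SU2) =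
    s • mkSu (w : ℂ).re 0 0 := by
  refine ⟨if b then -1 else 1, by cases b <;> simp, ?_⟩
  rw [SU2.coe_mul, coe_qD_false, coe_qA, quat_mul, imL_quat, smul_mkSu]
  cases b <;> simp

theorem imL_qA : ∃ s : ℝ, s ≠ 0 ∧ imL (qA b) = s • mkSu 1 0 0 := by
  refine ⟨if b then -1 else 1, by cases b <;> simp, ?_⟩
  rw [coe_qA, imL_quat, smul_mkSu]
  cases b <;> simp

theorem imL_X_true : imL (qD true w * qD true z : SU2) =
    mkSu (-((w : ℂ).im * (z : ℂ).re - (w : ℂ).re * (z : ℂ).im)) 0 0 := by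
  rw [SU2.coe_mul, coe_qD_true, coe_qD_true, quat_mul, imL_quat]
  congr 1 <;> ring

theorem imL_X_false : imL (qD true w * qD false z : SU2) =
    mkSu 0 ((w : ℂ).re * (z : ℂ).re + (w : ℂ).im * (z : ℂ).im)
      ((w : ℂ).im * (z : ℂ).re - (w : ℂ).re * (z : ℂ).im) := by
  rw [SU2.coe_mul, coe_qD_true, coe_qD_false, quat_mul, imL_quat]
  congr 1 <;> ring

theorem imL_IX_true : ∃ s : ℝ, s ≠ 0 ∧ imL ((qD true w)⁻¹ * qA b * qD true z : SU2) =
    s • mkSu ((w : ℂ).re * (z : ℂ).re + (w : ℂ).im * (z : ℂ).im) 0 0 := by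
  refine ⟨-(if b then -1 else 1), by cases b <;> simp, ?_⟩
  rw [SU2.coe_mul, SU2.coe_mul, coe_inv_qD_true, coe_qA, coe_qD_true, quat_mul, quat_mul,
    imL_quat, smul_mkSu]
  cases b <;> simp <;> congr 1 <;> ring

theorem imL_IX_false : ∃ s : ℝ, s ≠ 0 ∧ imL ((qD false z)⁻¹ * qA b * qD true w : SU2) =
    s • mkSu 0 (-((w : ℂ).im * (z : ℂ).re - (w : ℂ).re * (z : ℂ).im))
      ((w : ℂ).re * (z : ℂ).re + (w : ℂ).im * (z : ℂ).im) := by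
  refine ⟨if b then -1 else 1, by cases b <;> simp, ?_⟩
  rw [SU2.coe_mul, SU2.coe_mul, coe_inv_qD_false, coe_qA, coe_qD_true, quat_mul, quat_mul,
    imL_quat, smul_mkSu]
  cases b <;> simp <;> congr 1 <;> ring

end computations

/-! ### Spanning sector by sector. -/

variable {n : ℕ}

theorem eq_single_of_sector {y : Gen n → su2} {l : Fin n}
    (hy : ∀ k, k ≠ l → y (.A k) = 0 ∧ y (.D k) = 0) :
    y = Pi.single (.A l) (y (.A l)) + Pi.single (.D l) (y (.D l)) := by
  funext E
  cases E with
  | A k =>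
    rcases eq_or_ne k l with rfl | hk
    · simp
    · simp [(hy k hk).1, hk]
  | D k =>
    rcases eq_or_ne k l with rfl | hk
    · simp
    · simp [(hy k hk).2, hk]

/-- Once `W` contains everything supported in sector `m`, a tangent supported in the sectors `l` and
`m` may be replaced by its part in sector `l`. -/
theorem sector_mem {W : Submodule ℝ (Gen n → su2)} {m l : Fin n} (hlm : l ≠ m)
    (hA : ∀ u, Pi.single (.A m) u ∈ W) (hD : ∀ u, Pi.single (.D m) u ∈ W) {y : Gen n → su2}
    (hyW : y ∈ W) (hy : ∀ k, k ≠ l → k ≠ m → y (.A k) = 0 ∧ y (.D k) = 0) :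
    Pi.single (.A l) (y (.A l)) + Pi.single (.D l) (y (.D l)) ∈ W := by
  have h1 := W.sub_mem hyW (W.add_mem (hA (y (.A m))) (hD (y (.D m))))
  have h2 := eq_single_of_sector (l := l)
    (y := y - (Pi.single (.A m) (y (.A m)) + Pi.single (.D m) (y (.D m)))) (by
      intro k hk
      rcases eq_or_ne k m with rfl | hkm
      · simp
      · simp [hy k hk hkm, hkm])
  rw [h2] at h1
  simpa [hlm] using h1

theorem curveTangent_I (σ ε : Fin n → Bool) (z : Fin n → Circle) (l : Fin n) :
    curveTangent (normalVal σ ε z) (.I l) =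
      Pi.single (.A l) (-Ad (qA (σ l)) (imL (qD (ε l) (z l)))) := by
  rw [eq_single_of_sector (y := curveTangent (normalVal σ ε z) (.I l)) (l := l) (by
    intro k hk
    simp [curveTangent, SpecialCurve.crossings, hk])]
  simp [curveTangent, SpecialCurve.crossings, SpecialCurve.loop, wA, wD, normalVal]
  module

theorem curveTangent_II (σ ε : Fin n → Bool) (z : Fin n → Circle) (l : Fin n) :
    curveTangent (normalVal σ ε z) (.II l) =
      Pi.single (.D l) (Ad (qD (ε l) (z l)) (imL (qA (σ l)))) := by
  rw [eq_single_of_sector (y := curveTangent (normalVal σ ε z) (.II l)) (l := l) (by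
    intro k hk
    simp [curveTangent, SpecialCurve.crossings, hk])]
  simp [curveTangent, SpecialCurve.crossings, SpecialCurve.loop, wA, wD, normalVal]

theorem curveTangent_III (σ ε : Fin n → Bool) (z : Fin n → Circle) (l : Fin n) :
    curveTangent (normalVal σ ε z) (.III l) =
      Pi.single (.A l) (-Ad (qA (σ l)) (imL (qD (ε l) (z l) * qA (σ l) : SU2))) +
        Pi.single (.D l) (imL (qD (ε l) (z l) * qA (σ l) : SU2)) := by
  rw [eq_single_of_sector (y := curveTangent (normalVal σ ε z) (.III l)) (l := l) (by
    intro k hk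
    simp [curveTangent, SpecialCurve.crossings, hk])]
  simp [curveTangent, SpecialCurve.crossings, SpecialCurve.loop, wA, wD, normalVal, Ad_one]
  module

/-- Sector `m` is filled first, with the help of `hS1` and `hS2`. Every other sector `l` is then
treated modulo sector `m`, pairing `l` with `m` through the two-sector curves in both orders. The
families `I`–`III` and `VIII`–`XI` suffice. In each case `su(2)` is obtained as the `i`-axis plus
the `jk`-plane, the latter from a vector and its product with `i`. -/
theorem span_curveTangent (σ ε : Fin n → Bool) (z : Fin n → Circle) {m : Fin n} (hm : ε m = true)
    {W : Submodule ℝ (Gen n → su2)} (hT : ∀ c, curveTangent (normalVal σ ε z) c ∈ W)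
    (hS1 : ∀ a, Pi.single (.A m) (mkSu a 0 0) ∈ W)
    (hS2 : ∀ b c, Pi.single (.D m) (mkSu 0 b c) ∈ W) : W = ⊤ := by
  let N : Gen n → Submodule ℝ su2 := fun E => W.comap (LinearMap.single ℝ (fun _ => su2) E)
  have hN : ∀ {E u}, Pi.single E u ∈ W ↔ u ∈ N E := Iff.rfl
  -- Curve `II`: the adjoint action of `D_l` maps `i` to `±i`.
  have hDI : ∀ l x, mkSu x 0 0 ∈ N (.D l) := by
    intro l x
    have h := hT (.II l)
    obtain ⟨s, hs, he⟩ := imL_qA (σ l)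
    rw [curveTangent_II, hN, he, map_smul, Ad_qD_I, Submodule.smul_mem_iff _ hs] at h
    have h' := (N (.D l)).smul_mem (if ε l then -x else x) h
    rw [smul_mkSu] at h'
    convert h' using 2 <;> cases ε l <;> simp
  have hDm : ∀ u, Pi.single (.D m) u ∈ W := fun u => su2_eq_top (N := N (.D m)) (hDI m) hS2 u
  -- Curve `I` gives the direction `z_l j` at `A_l`.
  have hI : ∀ l, ε l = true → mkSu 0 ((z l : ℂ)).re ((z l : ℂ)).im ∈ N (.A l) := by
    intro l hl
    have h := hT (.I l)
    rw [curveTangent_I, hN, hl, coe_qD_true, imL_quat, Ad_qA, neg_mkSu] at h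
    simpa using h
  -- The `i`-axis is `hS1`; curves `I` and `III` give `z_m j` and `i z_m j`, the latter modulo the
  -- `D_m` part, already filled.
  have hAm : ∀ u, Pi.single (.A m) u ∈ W := by
    refine fun u => su2_eq_top (N := N (.A m)) hS1 (mkSu_JK_mem (circle_sq (z m)) (hI m hm) ?_) u
    have h := hT (.III m)
    obtain ⟨s, hs, he⟩ := imL_III_true (σ m) (z m)
    rw [curveTangent_III, hm, Submodule.add_mem_iff_left _ (hDm _), hN, he, map_smul,
      Submodule.neg_mem_iff, Submodule.smul_mem_iff _ hs, Ad_qA, ← Submodule.neg_mem_iff,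
      neg_mkSu] at h
    simpa using h
  have key : ∀ l, (∀ u, Pi.single (.A l) u ∈ W) ∧ ∀ u, Pi.single (.D l) u ∈ W := by
    intro l
    rcases eq_or_ne l m with rfl | hlm
    · exact ⟨hAm, hDm⟩
    have hsec : ∀ c : SpecialCurve n, (∀ k, k ≠ l → k ≠ m →
        curveTangent (normalVal σ ε z) c (.A k) = 0 ∧
        curveTangent (normalVal σ ε z) c (.D k) = 0) →
        Pi.single (.A l) (curveTangent (normalVal σ ε z) c (.A l)) +
          Pi.single (.D l) (curveTangent (normalVal σ ε z) c (.D l)) ∈ W := fun c hc =>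
      sector_mem hlm hAm hDm (hT c) hc
    have hz := circle_sq (z l)
    have hw := circle_sq (z m)
    have hzw := circle_mul_inv (z m) (z l)
    cases hl : ε l with
    | false =>
      -- Here `D_l = z_l`. At `D_l`, the curves `XI(m l)` and `VIII(l m)` give `z_m j` and `i z_m
      -- j`. At `A_l`, the curves `III` and `I` give the multiples of `i` by the real and imaginary
      -- parts of `z_l`, while `X(l m)` and `IX(m l)` give `u j` and `i u j` with `u` the quotient
      -- of `z_m` by `z_l`.
      have hD : ∀ u, Pi.single (.D l) u ∈ W := by
        refine fun u => su2_eq_top (N := N (.D l)) (hDI l) (mkSu_JK_mem hw ?_ ?_) u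
        · obtain ⟨s, hs, hAm', hDm', hAl, hDl, h0⟩ := curveTangent_XI σ ε z m l hlm.symm
          have h := hsec _ fun k h1 h2 => h0 k h2 h1
          obtain ⟨s', hs', he⟩ := imL_XI (σ m) (σ l) (z m)
          rw [hAl, hDl, hm, he, Pi.single_zero, zero_add, hN, Submodule.smul_mem_iff _ hs, map_smul,
            Submodule.smul_mem_iff _ hs', Ad_inv_qA, ← Submodule.neg_mem_iff, neg_mkSu] at h
          simpa using h
        · obtain ⟨s, hs, hAl, hDl, -, -, h0⟩ := curveTangent_VIII σ ε z l m hlm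
          have h := hsec _ h0
          obtain ⟨s', hs', he⟩ := imL_VIII (σ l) (z m)
          rwa [hAl, hDl, hm, he, Pi.single_zero, zero_add, hN, Submodule.smul_mem_iff _ hs,
            Submodule.smul_mem_iff _ hs'] at h
      refine ⟨fun u => su2_eq_top (N := N (.A l)) (mkSu_I_mem hz ?_ ?_)
        (mkSu_JK_mem hzw ?_ ?_) u, hD⟩
      · have h := hT (.III l)
        obtain ⟨s, hs, he⟩ := imL_III_false (σ l) (z l)
        rwa [curveTangent_III, hl, Submodule.add_mem_iff_left _ (hD _), hN, he, map_smul,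
          Submodule.neg_mem_iff, Submodule.smul_mem_iff _ hs, Ad_qA, neg_zero] at h
      · have h := hT (.I l)
        rwa [curveTangent_I, hN, hl, coe_qD_false, imL_quat, Ad_qA, Submodule.neg_mem_iff,
          neg_zero] at h
      · obtain ⟨s, hs, hAl, hDl, h0⟩ := curveTangent_X σ ε z l m hlm
        have h := hsec _ h0
        rwa [hAl, hDl, hm, hl, imL_X_false, Pi.single_zero, add_zero, hN, Submodule.neg_mem_iff,
          Submodule.smul_mem_iff _ hs] at h
      · obtain ⟨s, hs, -, -, hAl, hDl, h0⟩ := curveTangent_IX σ ε z m l hlm.symm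
        have h := hsec _ fun k h1 h2 => h0 k h2 h1
        obtain ⟨s', hs', he⟩ := imL_IX_false (σ m) (z m) (z l)
        rwa [hAl, hDl, hm, hl, he, Pi.single_zero, add_zero, hN, Submodule.smul_mem_iff _ hs,
          Submodule.smul_mem_iff _ hs'] at h
    | true =>
      -- Here `D_l = z_l j`. At `A_l`, the curves `IX(l m)` and `X(l m)` give the multiples of `i`
      -- by the real and imaginary parts of the quotient of `z_m` by `z_l`, up to sign, and `I`,
      -- `VIII(m l)` give `z_l j`, `i z_l j`. With `A_l` filled, `XI(l m)` and `III` give the same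
      -- two directions at `D_l`.
      have hAI : ∀ x, mkSu x 0 0 ∈ N (.A l) := by
        refine mkSu_I_mem hzw ?_ ?_
        · obtain ⟨s, hs, hAl, hDl, -, -, h0⟩ := curveTangent_IX σ ε z l m hlm
          have h := hsec _ h0
          obtain ⟨s', hs', he⟩ := imL_IX_true (σ l) (z m) (z l)
          rw [hAl, hDl, hm, hl, he, Submodule.add_mem_iff_left, hN, Submodule.neg_mem_iff,
            Submodule.smul_mem_iff _ hs, map_smul, Submodule.smul_mem_iff _ hs', Ad_qA,
            neg_zero] at h
          · exact h
          · exact (N (.D l)).smul_mem _ ((N (.D l)).smul_mem _ (hDI l _))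
        · obtain ⟨s, hs, hAl, hDl, h0⟩ := curveTangent_X σ ε z l m hlm
          have h := hsec _ h0
          rw [hAl, hDl, hm, hl, imL_X_true, Pi.single_zero, add_zero, hN, Submodule.neg_mem_iff,
            Submodule.smul_mem_iff _ hs, ← Submodule.neg_mem_iff, neg_mkSu] at h
          simpa using h
      have hAJ : mkSu 0 (-((z l : ℂ)).im) ((z l : ℂ)).re ∈ N (.A l) := by
        obtain ⟨s, hs, -, -, hAl, hDl, h0⟩ := curveTangent_VIII σ ε z m l hlm.symm
        have h := hsec _ fun k h1 h2 => h0 k h2 h1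
        obtain ⟨s', hs', he⟩ := imL_VIII (σ m) (z l)
        rwa [hAl, hDl, hl, he, Pi.single_zero, add_zero, hN, Submodule.smul_mem_iff _ hs,
          Submodule.smul_mem_iff _ hs'] at h
      have hA : ∀ u, Pi.single (.A l) u ∈ W := fun u =>
        su2_eq_top (N := N (.A l)) hAI (mkSu_JK_mem hz (hI l hl) hAJ) u
      refine ⟨hA, fun u => su2_eq_top (N := N (.D l)) (hDI l) (mkSu_JK_mem hz ?_ ?_) u⟩
      · obtain ⟨s, hs, hAl, hDl, -, -, h0⟩ := curveTangent_XI σ ε z l m hlm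
        have h := hsec _ h0
        obtain ⟨s', hs', he⟩ := imL_XI (σ l) (σ m) (z l)
        rwa [hDl, hl, he, Submodule.add_mem_iff_right _ (hA _), hN, Submodule.smul_mem_iff _ hs,
          Submodule.smul_mem_iff _ hs'] at h
      · have h := hT (.III l)
        obtain ⟨s, hs, he⟩ := imL_III_true (σ l) (z l)
        rwa [curveTangent_III, hl, Submodule.add_mem_iff_right _ (hA _), hN, he,
          Submodule.smul_mem_iff _ hs] at h
  rw [eq_top_iff]
  intro y _
  rw [← Finset.univ_sum_single y]
  refine W.sum_mem fun E _ => ?_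
  cases E with
  | A l => exact (key l).1 _
  | D l => exact (key l).2 _

/-! ### The derivative of the relator on a complement of the cocycles. -/

/-- A complement of the cocycles, supported in a sector `m`. -/
def relSection (m : Fin n) : su2 →ₗ[ℝ] (Gen n → su2) where
  toFun u := Pi.single (.A m) (mkSu (u : ℍ[ℝ]).imI 0 0) +
    Pi.single (.D m) (mkSu 0 (u : ℍ[ℝ]).imJ (u : ℍ[ℝ]).imK)
  map_add' u v := by
    have h1 : mkSu ((u + v : su2) : ℍ[ℝ]).imI 0 0 =
        mkSu (u : ℍ[ℝ]).imI 0 0 + mkSu (v : ℍ[ℝ]).imI 0 0 := by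
      rw [mkSu_add]; simp
    have h2 : mkSu 0 ((u + v : su2) : ℍ[ℝ]).imJ ((u + v : su2) : ℍ[ℝ]).imK =
        mkSu 0 (u : ℍ[ℝ]).imJ (u : ℍ[ℝ]).imK + mkSu 0 (v : ℍ[ℝ]).imJ (v : ℍ[ℝ]).imK := by
      rw [mkSu_add]; simp
    rw [h1, h2, Pi.single_add, Pi.single_add]
    abel
  map_smul' s u := by
    have h1 : mkSu ((s • u : su2) : ℍ[ℝ]).imI 0 0 = s • mkSu (u : ℍ[ℝ]).imI 0 0 := by
      rw [smul_mkSu]; simp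
    have h2 : mkSu 0 ((s • u : su2) : ℍ[ℝ]).imJ ((s • u : su2) : ℍ[ℝ]).imK =
        s • mkSu 0 (u : ℍ[ℝ]).imJ (u : ℍ[ℝ]).imK := by
      rw [smul_mkSu]; simp
    rw [h1, h2, Pi.single_smul, Pi.single_smul, RingHom.id_apply, smul_add]

theorem relSection_apply (m : Fin n) (u : su2) : relSection m u =
    Pi.single (.A m) (mkSu (u : ℍ[ℝ]).imI 0 0) +
      Pi.single (.D m) (mkSu 0 (u : ℍ[ℝ]).imJ (u : ℍ[ℝ]).imK) := rfl

/-- The commutators are signs and act trivially on `su(2)`, so the derivative of the relator is the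
untwisted sum over the sectors. -/
theorem relDeriv_normalVal (σ ε : Fin n → Bool) (z : Fin n → Circle) (m : Fin n)
    (y : Gen n → su2) (hy : ∀ k, k ≠ m → y (.A k) = 0 ∧ y (.D k) = 0) (L : List (Fin n))
    (hL : L.Nodup) : relDeriv (normalVal σ ε z) L y =
      if m ∈ L then commDeriv (normalVal σ ε z) m y else 0 := by
  have h0 : ∀ k, k ≠ m → commDeriv (normalVal σ ε z) k y = 0 := by
    intro k hk
    rw [commDeriv_apply, (hy k hk).1, (hy k hk).2]
    simp
  induction L with
  | nil => simp [relDeriv]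
  | cons l L ih =>
    obtain ⟨hl, hL⟩ := List.nodup_cons.1 hL
    have hc : ⁅normalVal σ ε z (.A l), normalVal σ ε z (.D l)⁆ = sgn (ε l) :=
      commutator_qA_qD _ _ _
    rw [relDeriv_cons, ih hL, hc, Ad_sgn]
    rcases eq_or_ne l m with rfl | hlm
    · simp [hl]
    · simp [h0 l hlm, hlm.symm]

/-- With `A_m = ±i` and `D_m = z_m j`, the adjoint action of `A_m D_m A_m⁻¹` is `-1` on the `i`-axis
and that of `A_m` is `-1` on the `jk`-plane. Hence the composite is multiplication by `2` on the
`i`-axis and by `-2` on the `jk`-plane. -/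
theorem relDeriv_relSection_injective (σ ε : Fin n → Bool) (z : Fin n → Circle) {m : Fin n}
    (hm : ε m = true) :
    Function.Injective (relDeriv (normalVal σ ε z) (List.finRange n) ∘ₗ relSection m) := by
  rw [injective_iff_map_eq_zero]
  intro u hu
  rw [LinearMap.comp_apply, relDeriv_normalVal σ ε z m _ _ _ (List.nodup_finRange n),
    if_pos (List.mem_finRange m), commDeriv_apply] at hu
  · have hA : relSection m u (.A m) = mkSu (u : ℍ[ℝ]).imI 0 0 := by simp [relSection_apply]
    have hD : relSection m u (.D m) = mkSu 0 (u : ℍ[ℝ]).imJ (u : ℍ[ℝ]).imK := by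
      simp [relSection_apply]
    have hc : ⁅normalVal σ ε z (.A m), normalVal σ ε z (.D m)⁆ = sgn (ε m) :=
      commutator_qA_qD _ _ _
    have hc' : normalVal σ ε z (.A m) * normalVal σ ε z (.D m) * (normalVal σ ε z (.A m))⁻¹ =
        sgn (ε m) * qD true (z m) := by
      change qA (σ m) * qD (ε m) (z m) * (qA (σ m))⁻¹ = _
      rw [qA_mul_qD, hm]
      group
    rw [hc, hc', hA, hD, Ad_mul, Ad_sgn, Ad_sgn] at hu
    change mkSu (u : ℍ[ℝ]).imI 0 0 + Ad (qA (σ m)) _ - _ - _ = 0 at hu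
    rw [Ad_qA, Ad_qD_I, if_pos rfl, sub_eq_add_neg, sub_eq_add_neg, neg_mkSu, neg_mkSu, mkSu_add,
      mkSu_add, mkSu_add] at hu
    have hu' := congrArg (fun v : su2 => (v : ℍ[ℝ])) hu
    have e1 := congrArg (fun q : ℍ[ℝ] => q.imI) hu'
    have e2 := congrArg (fun q : ℍ[ℝ] => q.imJ) hu'
    have e3 := congrArg (fun q : ℍ[ℝ] => q.imK) hu'
    simp [coe_mkSu] at e1 e2 e3
    rw [su2_eq_mkSu u, show (u : ℍ[ℝ]).imI = 0 by linarith, show (u : ℍ[ℝ]).imJ = 0 by linarith,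
      show (u : ℍ[ℝ]).imK = 0 by linarith]
    rfl
  · intro k hk
    simp [relSection_apply, hk]

theorem span_sup_relSection (σ ε : Fin n → Bool) (z : Fin n → Circle) {m : Fin n}
    (hm : ε m = true) {K : ℕ} (C : Fin K → SpecialCurve n) (hC : Function.Surjective C) :
    Submodule.span ℝ (Set.range fun k => curveTangent (normalVal σ ε z) (C k)) ⊔
      LinearMap.range (relSection m) = ⊤ := by
  refine span_curveTangent σ ε z hm (fun c => ?_) (fun a => ?_) fun b c => ?_
  · obtain ⟨k, rfl⟩ := hC c
    exact Submodule.mem_sup_left (Submodule.subset_span ⟨k, rfl⟩)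
  · refine Submodule.mem_sup_right ⟨mkSu a 0 0, ?_⟩
    rw [relSection_apply]
    have : mkSu 0 0 0 = 0 := rfl
    simp [coe_mkSu, this]
  · refine Submodule.mem_sup_right ⟨mkSu 0 b c, ?_⟩
    rw [relSection_apply]
    have : mkSu 0 0 0 = 0 := rfl
    simp [coe_mkSu, this]

end TracelessTangle

namespace TracelessTangle

variable {n : ℕ}

/-! ### A uniform neighbourhood of submersivity -/

/-- Angles replace points of the torus, so that the parameters form a normed space and ordinary
derivatives apply. -/
theorem smooth_normalVal (σ ε : Fin n → Bool) (E : Gen n) :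
    SmoothSU2 fun θ : Fin n → ℝ => normalVal σ ε (fun l => Circle.exp (θ l)) E := by
  cases E with
  | A l => exact .const _
  | D l =>
    have hθ : ContDiff ℝ ∞ fun θ : Fin n → ℝ => θ l := contDiff_apply ℝ ℝ l
    have hc := Real.contDiff_cos.comp hθ
    have hs := Real.contDiff_sin.comp hθ
    cases hl : ε l with
    | false =>
      have : (fun θ : Fin n → ℝ => (normalVal σ ε (fun l => Circle.exp (θ l)) (.D l) : ℍ[ℝ])) =
          fun θ => Real.cos (θ l) • quat 1 0 0 0 + Real.sin (θ l) • quat 0 1 0 0 := by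
        funext θ
        change (qD (ε l) (Circle.exp (θ l)) : ℍ[ℝ]) = _
        rw [hl, coe_qD_false]
        ext <;> simp [Complex.exp_ofReal_mul_I_re, Complex.exp_ofReal_mul_I_im]
      rw [SmoothSU2, this]
      exact (hc.smul contDiff_const).add (hs.smul contDiff_const)
    | true =>
      have : (fun θ : Fin n → ℝ => (normalVal σ ε (fun l => Circle.exp (θ l)) (.D l) : ℍ[ℝ])) =
          fun θ => Real.cos (θ l) • quat 0 0 1 0 + Real.sin (θ l) • quat 0 0 0 1 := by
        funext θ
        change (qD (ε l) (Circle.exp (θ l)) : ℍ[ℝ]) = _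
        rw [hl, coe_qD_true]
        ext <;> simp [Complex.exp_ofReal_mul_I_re, Complex.exp_ofReal_mul_I_im]
      rw [SmoothSU2, this]
      exact (hc.smul contDiff_const).add (hs.smul contDiff_const)

theorem eventually_submersiveAt_normalRep {K : ℕ} (C : Fin K → SpecialCurve n)
    (hC : Function.Surjective C) (σ ε : Fin n → Bool) (hε : IsEven ε) {m : Fin n}
    (hm : ε m = true) : ∀ᶠ t in 𝓝 (0 : Fin K → ℝ), ∀ z : Fin n → Circle,
      SubmersiveAt (Phi C (CharVar.mk (normalRep σ ε hε z))) t := by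
  let F : (Fin n → ℝ) → RepSpace (SurfaceGroup n) := fun θ =>
    normalRep σ ε hε fun l => Circle.exp (θ l)
  have hval : ∀ θ, (fun E => F θ (SurfaceGroup.of E)) =
      normalVal σ ε fun l => Circle.exp (θ l) := fun θ => funext fun E => normalRep_of _ _ _ _ E
  have hF : ∀ E, SmoothSU2 fun θ => F θ (SurfaceGroup.of E) := by
    intro E
    have := smooth_normalVal σ ε E
    simpa only [F, normalRep_of] using this
  -- This cube of angles covers the torus, as every `z_l` is the exponential of its argument.
  -- Compactness turns the neighbourhoods of the points `(θ, 0)` into one neighbourhood of `0` valid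
  -- for all `θ`.
  have hK : IsCompact (Set.univ.pi fun _ : Fin n => Set.Icc (-Real.pi) Real.pi) :=
    isCompact_univ_pi fun _ => isCompact_Icc
  have key := hK.eventually_forall_of_forall_eventually
    (P := fun (t : Fin K → ℝ) θ => SubmersiveAt (Phi C (CharVar.mk (F θ))) t) (x₀ := 0) (by
      intro θ _
      have h := eventually_submersiveAt C F hF θ (relSection m)
        (by rw [hval]; exact span_sup_relSection σ ε _ hm C hC)
        (by rw [hval]; exact relDeriv_relSection_injective σ ε _ hm)
      exact (continuous_swap.tendsto ((0 : Fin K → ℝ), θ)).eventually h)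
  filter_upwards [key] with t ht z
  have h := ht (fun l => (z l : ℂ).arg) (fun l _ =>
    ⟨(Complex.neg_pi_lt_arg _).le, Complex.arg_le_pi _⟩)
  simpa only [F, Circle.exp_arg] using h

/-! ### Conjugation -/

theorem SU2.re_conj (h q : SU2) : (h * q * h⁻¹).re = q.re := by
  have hcyc : ∀ a b : ℍ[ℝ], (a * b).re = (b * a).re := by
    intro a b
    simp only [Quaternion.re_mul]
    ring
  change ((h : ℍ[ℝ]) * q * ((h⁻¹ : SU2) : ℍ[ℝ])).re = (q : ℍ[ℝ]).re
  rw [hcyc, ← mul_assoc, SU2.coe_inv, SU2.coe_star_mul, one_mul]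

theorem SU2.re_inv (q : SU2) : (q⁻¹).re = q.re := by
  change (star (q : ℍ[ℝ])).re = (q : ℍ[ℝ]).re
  simp

section conj

variable {G : Type} [Group G]

theorem mk_conj (h : SU2) (ρ : RepSpace G) : CharVar.mk (RepSpace.conj h ρ) = CharVar.mk ρ :=
  Quotient.sound ⟨h⁻¹, fun g => by rw [RepSpace.conj_apply]; group⟩

theorem mk_eq_iff {ρ σ : RepSpace G} :
    CharVar.mk ρ = CharVar.mk σ ↔ ∃ h, σ = RepSpace.conj h ρ := by
  constructor
  · intro h
    obtain ⟨k, hk⟩ := Quotient.exact h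
    exact ⟨k, DFunLike.ext _ _ hk⟩
  · rintro ⟨h, rfl⟩
    exact (mk_conj h ρ).symm

theorem mem_stab_conj (h k : SU2) (ρ : RepSpace G) :
    k ∈ stab (RepSpace.conj h ρ) ↔ h⁻¹ * k * h ∈ stab ρ := by
  change (∀ g, k * (h * ρ g * h⁻¹) * k⁻¹ = h * ρ g * h⁻¹) ↔
    ∀ g, h⁻¹ * k * h * ρ g * (h⁻¹ * k * h)⁻¹ = ρ g
  refine forall_congr' fun g => ?_
  constructor
  · intro e
    calc h⁻¹ * k * h * ρ g * (h⁻¹ * k * h)⁻¹ = h⁻¹ * (k * (h * ρ g * h⁻¹) * k⁻¹) * h := by group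
      _ = ρ g := by rw [e]; group
  · intro e
    calc k * (h * ρ g * h⁻¹) * k⁻¹ = h * (h⁻¹ * k * h * ρ g * (h⁻¹ * k * h)⁻¹) * h⁻¹ := by group
      _ = h * ρ g * h⁻¹ := by rw [e]

theorem coe_conj_eq_iff (h k : SU2) (q : ℍ[ℝ]) :
    ((h⁻¹ * k * h : SU2) : ℍ[ℝ]) = q ↔ (k : ℍ[ℝ]) = h * q * star (h : ℍ[ℝ]) := by
  constructor
  · rintro rfl
    rw [SU2.coe_mul, SU2.coe_mul, SU2.coe_inv]
    simp only [mul_assoc, SU2.coe_mul_star, mul_one]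
    rw [← mul_assoc, SU2.coe_mul_star, one_mul]
  · intro e
    rw [SU2.coe_mul, SU2.coe_mul, SU2.coe_inv, e]
    simp only [mul_assoc, SU2.coe_star_mul, mul_one]
    rw [← mul_assoc, SU2.coe_star_mul, one_mul]

theorem isIrredRep_conj {h : SU2} {ρ : RepSpace G} (hρ : IsIrredRep ρ) :
    IsIrredRep (RepSpace.conj h ρ) := by
  intro k
  rw [mem_stab_conj, hρ, coe_conj_eq_iff, coe_conj_eq_iff]
  simp

theorem isAbelianRep_conj {h : SU2} {ρ : RepSpace G} (hρ : IsAbelianRep ρ) :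
    IsAbelianRep (RepSpace.conj h ρ) := by
  obtain ⟨P, hP0, hP1, hP⟩ := hρ
  refine ⟨Ad h ⟨P, hP0⟩, (Ad h ⟨P, hP0⟩).2, ?_, fun k => ?_⟩
  · rw [coe_Ad, norm_mul, norm_mul, hP1, mul_one, ← norm_mul, SU2.coe_mul_star, norm_one]
  · rw [mem_stab_conj, hP]
    refine exists_congr fun α => ?_
    rw [coe_conj_eq_iff, coe_Ad, mul_add, add_mul, ← Quaternion.coe_commutes, mul_assoc _ (h : ℍ[ℝ]),
      SU2.coe_mul_star, mul_one, mul_smul_comm, smul_mul_assoc]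

end conj

theorem comap_mk {G G' : Type} [Group G] [Group G'] (f : G' →* G) (ρ : RepSpace G) :
    CharVar.comap f (CharVar.mk ρ) = CharVar.mk (ρ.comap f) := rfl

theorem comap_incl_A (ρ : RepSpace (SurfaceGroup n)) (i : Fin n) :
    ρ.comap (incl n) (PresentedGroup.of (.A i)) = ρ (SurfaceGroup.of (.A i)) := by
  change ρ (incl n (PresentedGroup.of (.A i))) = _
  rw [incl, PresentedGroup.toGroup.of, inclGen]

theorem comap_incl_B (ρ : RepSpace (SurfaceGroup n)) (i : Fin n) :
    ρ.comap (incl n) (PresentedGroup.of (.B i)) =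
      ρ (SurfaceGroup.of (.D i)) * ρ (SurfaceGroup.of (.A i)) * (ρ (SurfaceGroup.of (.D i)))⁻¹ := by
  change ρ (incl n (PresentedGroup.of (.B i))) = _
  rw [incl, PresentedGroup.toGroup.of, inclGen, map_mul, map_mul, map_inv]

/-- Real parts are invariant under conjugation and inversion, and `B_i` becomes conjugate to `A_i`
in `π₁(F)`; so the condition on all meridians reduces to the `A_i`. -/
theorem exceptionalSet_eq (n : ℕ) : exceptionalSet n = CharVar.mk '' {ρ | IsIrredRep ρ ∧
    IsAbelianRep (ρ.comap (incl n)) ∧ ∀ i : Fin n, (ρ (SurfaceGroup.of (Gen.A i))).re = 0} := by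
  ext x
  constructor
  · rintro ⟨⟨τ, ⟨hτ, hm⟩, hx⟩, ρ, hρ, rfl⟩
    rw [comap_mk, mk_eq_iff] at hx
    obtain ⟨h, hh⟩ := hx
    refine ⟨ρ, ⟨hρ, ?_, fun i => ?_⟩, rfl⟩
    · rw [hh]
      exact isAbelianRep_conj hτ
    · rw [← comap_incl_A, hh, RepSpace.conj_apply, SU2.re_conj]
      exact hm _ ⟨.A i, 1, Or.inl (by simp)⟩
  · rintro ⟨ρ, ⟨hρ, hab, hre⟩, rfl⟩
    refine ⟨⟨ρ.comap (incl n), ⟨hab, ?_⟩, rfl⟩, ρ, hρ, rfl⟩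
    rintro _ ⟨E, g, rfl | rfl⟩
    · rw [map_mul, map_mul, map_inv, SU2.re_conj]
      cases E with
      | A i => rw [comap_incl_A, hre]
      | B i => rw [comap_incl_B, SU2.re_conj, hre]
    · rw [map_mul, map_mul, map_inv, map_inv, SU2.re_conj, SU2.re_inv]
      cases E with
      | A i => rw [comap_incl_A, hre]
      | B i => rw [comap_incl_B, SU2.re_conj, hre]

end TracelessTangle

namespace TracelessTangle

variable {n : ℕ}

/-! ### The binary dihedral group -/

theorem qD_injective (e : Bool) : Function.Injective (qD e) := by
  intro z w h
  have h' := congrArg (fun q : SU2 => (q : ℍ[ℝ])) h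
  apply Circle.ext
  cases e
  · have h1 := congrArg (fun q : ℍ[ℝ] => q.re) h'
    have h2 := congrArg (fun q : ℍ[ℝ] => q.imI) h'
    simp only [coe_qD_false, re_quat, imI_quat] at h1 h2
    exact Complex.ext h1 h2
  · have h1 := congrArg (fun q : ℍ[ℝ] => q.imJ) h'
    have h2 := congrArg (fun q : ℍ[ℝ] => q.imK) h'
    simp only [coe_qD_true, imJ_quat, imK_quat] at h1 h2
    exact Complex.ext h1 h2

theorem qD_false_mul (e : Bool) (w z : Circle) : qD false w * qD e z = qD e (w * z) := by
  ext1
  rw [SU2.coe_mul]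
  cases e
  · rw [coe_qD_false, coe_qD_false, coe_qD_false, quat_mul]
    congr 1 <;> simp
  · rw [coe_qD_false, coe_qD_true, coe_qD_true, quat_mul]
    congr 1 <;> simp

theorem qD_true_mul (w z : Circle) : qD true z * qD false w = qD true (z * w⁻¹) := by
  ext1
  rw [SU2.coe_mul, coe_qD_false, coe_qD_true, coe_qD_true, quat_mul]
  congr 1 <;> simp

theorem qD_one : qD false 1 = 1 := by
  ext1
  rw [coe_qD_false]
  ext <;> simp

theorem qD_neg_one : qD false (-1) = -1 := by
  ext1
  rw [coe_qD_false, SU2.coe_neg, SU2.coe_one]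
  ext <;> simp

theorem qD_inv (w : Circle) : (qD false w)⁻¹ = qD false w⁻¹ := by
  rw [inv_eq_iff_mul_eq_one, qD_false_mul, mul_inv_cancel, qD_one]

theorem qD_conj_true (w z : Circle) :
    qD false w * qD true z * (qD false w)⁻¹ = qD true (w * w * z) := by
  rw [qD_false_mul, qD_inv, qD_true_mul, inv_inv]
  congr 1
  rw [mul_comm, mul_assoc]

theorem qD_conj_false (w z : Circle) :
    qD false w * qD false z * (qD false w)⁻¹ = qD false z := by
  rw [qD_false_mul, qD_inv, qD_false_mul, mul_comm w z, mul_inv_cancel_right]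

theorem qD_conj_qA (e b : Bool) (z : Circle) :
    qD e z * qA b * (qD e z)⁻¹ = qA (xor e b) := by
  have h : qD e z * qA b = sgn e * (qA b * qD e z) := by
    rw [qA_mul_qD, mul_assoc, ← mul_assoc, ← mul_assoc, sgn_mul]
    simp [sgn]
  rw [h, ← mul_assoc, mul_inv_cancel_right]
  ext1
  cases e <;> cases b <;> ext <;> simp [sgn, SU2.coe_neg, coe_qA]

/-- An element which conjugates `±i` to `±i` is a complex unit, or `j` times one. -/
theorem exists_qD_of_conj {h : SU2} {b b' : Bool} (hh : h * qA b = qA b' * h) :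
    ∃ w, h = qD (xor b b') w := by
  have h1 := SU2.normSq_eq_one h
  have h2 := congrArg (fun q : SU2 => (q : ℍ[ℝ])) hh
  obtain ⟨a, c, d, f, hq⟩ : ∃ a c d f, (h : ℍ[ℝ]) = quat a c d f :=
    ⟨(h : ℍ[ℝ]).re, (h : ℍ[ℝ]).imI, (h : ℍ[ℝ]).imJ, (h : ℍ[ℝ]).imK, rfl⟩
  simp only [SU2.coe_mul, coe_qA, hq, quat_mul] at h2
  rw [hq, normSq_quat] at h1
  have e1 := congrArg (fun q : ℍ[ℝ] => q.re) h2
  have e2 := congrArg (fun q : ℍ[ℝ] => q.imI) h2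
  have e3 := congrArg (fun q : ℍ[ℝ] => q.imJ) h2
  have e4 := congrArg (fun q : ℍ[ℝ] => q.imK) h2
  simp only [re_quat, imI_quat, imJ_quat, imK_quat] at e1 e2 e3 e4
  have hw : ∀ x y : ℝ, x ^ 2 + y ^ 2 = 1 → ∃ w : Circle, (w : ℂ).re = x ∧ (w : ℂ).im = y := by
    intro x y hxy
    refine ⟨⟨⟨x, y⟩, mem_sphere_zero_iff_norm.2 ?_⟩, rfl, rfl⟩
    rw [← sq_eq_sq₀ (norm_nonneg _) zero_le_one, Complex.sq_norm,
      Complex.normSq_apply]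
    simp only
    linarith
  -- Comparing components: commuting with `i` kills the `j` and `k` parts, anticommuting kills the
  -- real and `i` parts.
  by_cases hb : b = b'
  · subst hb
    have hd : d = 0 := by cases b <;> simp at e4 <;> linarith
    have hf : f = 0 := by cases b <;> simp at e3 <;> linarith
    obtain ⟨w, hw1, hw2⟩ := hw a c (by rw [← h1, hd, hf]; ring)
    refine ⟨w, ?_⟩
    ext1
    rw [Bool.xor_self, coe_qD_false, hq, hw1, hw2, hd, hf]
  · have hx : xor b b' = true := by cases b <;> cases b' <;> simp at hb ⊢
    have ha : a = 0 := by cases b <;> cases b' <;> simp at hb e2 <;> linarith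
    have hc : c = 0 := by cases b <;> cases b' <;> simp at hb e1 <;> linarith
    obtain ⟨w, hw1, hw2⟩ := hw d f (by rw [← h1, ha, hc]; ring)
    refine ⟨w, ?_⟩
    ext1
    rw [hx, coe_qD_true, hq, hw1, hw2, ha, hc]

theorem commute_qA_iff {h : SU2} {b : Bool} : h * qA b = qA b * h ↔ ∃ w, h = qD false w := by
  constructor
  · intro hh
    obtain ⟨w, hw⟩ := exists_qD_of_conj hh
    exact ⟨w, by rw [hw, Bool.xor_self]⟩
  · rintro ⟨w, rfl⟩
    have h1 := qD_conj_qA false b w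
    rw [mul_inv_eq_iff_eq_mul, Bool.false_xor] at h1
    exact h1

theorem exists_qA_of_commute {h : SU2} (hh : h * qA false = qA false * h) (hr : h.re = 0) :
    ∃ b, h = qA b := by
  obtain ⟨w, rfl⟩ := commute_qA_iff.1 hh
  have hr' : (w : ℂ).re = 0 := hr
  have h1 := circle_sq w
  rw [hr'] at h1
  have h2 : (w : ℂ).im = 1 ∨ (w : ℂ).im = -1 := 
    mul_self_eq_one_iff.1 (by linarith)
  rcases h2 with h2 | h2
  · exact ⟨false, by ext1; rw [coe_qD_false, hr', h2]; rfl⟩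
  · exact ⟨true, by ext1; rw [coe_qD_false, hr', h2]; rfl⟩

/-- All imaginary unit quaternions are conjugate. -/
theorem exists_conj_eq_qA {p : SU2} (hp : p.re = 0) : ∃ h : SU2, h * p * h⁻¹ = qA false := by
  have h1 := SU2.normSq_eq_one p
  obtain ⟨a, c, d, f, hq⟩ : ∃ a c d f, (p : ℍ[ℝ]) = quat a c d f :=
    ⟨(p : ℍ[ℝ]).re, (p : ℍ[ℝ]).imI, (p : ℍ[ℝ]).imJ, (p : ℍ[ℝ]).imK, rfl⟩
  have ha : a = 0 := by
    have : (p : ℍ[ℝ]).re = 0 := hp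
    rwa [hq] at this
  subst ha
  rw [hq, normSq_quat] at h1
  by_cases hc : 1 + c = 0
  · refine ⟨qD true 1, ?_⟩
    have hc' : c = -1 := by linarith
    have hd : d = 0 := by nlinarith
    have hf : f = 0 := by nlinarith
    have : p = qA true := by
      ext1
      rw [hq, hc', hd, hf]
      rfl
    rw [this, qD_conj_qA]
    rfl
  · set N : ℝ := Real.sqrt ((1 + c) ^ 2 + d ^ 2 + f ^ 2) with hN
    have hpos : 0 < (1 + c) ^ 2 + d ^ 2 + f ^ 2 := by positivity
    have hN2 : N ^ 2 = (1 + c) ^ 2 + d ^ 2 + f ^ 2 := Real.sq_sqrt hpos.le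
    have hN0 : N ≠ 0 := (Real.sqrt_pos.2 hpos).ne'
    refine ⟨⟨quat 0 ((1 + c) / N) (d / N) (f / N), mem_unitary_of_normSq ?_⟩, ?_⟩
    · rw [normSq_quat]
      field_simp
      linarith
    · rw [mul_inv_eq_iff_eq_mul]
      ext1
      rw [SU2.coe_mul, SU2.coe_mul, hq, coe_qA, quat_mul, quat_mul]
      congr 1
      · simp only [Bool.false_eq_true, if_false]
        field_simp
        linarith
      · ring
      · simp only [Bool.false_eq_true, if_false]
        field_simp
        ring
      · simp only [Bool.false_eq_true, if_false]
        field_simp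
        ring

/-! ### Normal forms of the exceptional representations -/

section normal

variable (σ ε : Fin n → Bool) (hε : IsEven ε) (z : Fin n → Circle)

/-- Commuting with `A_m = ±i` forces a complex unit `w`; commuting with `z_m j` forces `w² = 1`. -/
theorem isIrredRep_normalRep {m : Fin n} (hm : ε m = true) :
    IsIrredRep (normalRep σ ε hε z) := by
  intro h
  constructor
  · intro hh
    have hh' : ∀ E, h * normalVal σ ε z E = normalVal σ ε z E * h := fun E => by
      have := (mem_stab_iff _ _).1 hh E
      rwa [show PresentedGroup.of E = SurfaceGroup.of E from rfl, normalRep_of] at this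
    obtain ⟨w, rfl⟩ := commute_qA_iff.1 (hh' (.A m))
    have h1 : qD false w * qD (ε m) (z m) = qD (ε m) (z m) * qD false w := hh' (.D m)
    rw [hm, qD_false_mul, qD_true_mul] at h1
    have h2 := qD_injective true h1
    rw [mul_comm w, mul_left_cancel_iff, eq_inv_iff_mul_eq_one] at h2
    have h3 : (w : ℂ) * w = 1 := by rw [← Circle.coe_mul, h2, Circle.coe_one]
    rcases mul_self_eq_one_iff.1 h3 with h4 | h4
    · left
      rw [show w = 1 from Circle.ext h4, qD_one]
      rfl
    · right
      rw [show w = -1 from Circle.ext (by rw [h4]; simp), qD_neg_one]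
      rfl
  · intro hh
    rw [mem_stab_iff]
    intro E
    ext1
    rw [SU2.coe_mul, SU2.coe_mul]
    rcases hh with hh | hh <;> rw [hh] <;> simp

theorem coe_qD_eq_iff (h : SU2) : (∃ w, h = qD false w) ↔
    ∃ α : ℝ, (h : ℍ[ℝ]) = (Real.cos α : ℍ[ℝ]) + Real.sin α • quat 0 1 0 0 := by
  have key : ∀ α : ℝ, (qD false (Circle.exp α) : ℍ[ℝ]) =
      (Real.cos α : ℍ[ℝ]) + Real.sin α • quat 0 1 0 0 := by
    intro α
    rw [coe_qD_false]
    ext <;> simp [Complex.exp_ofReal_mul_I_re, Complex.exp_ofReal_mul_I_im]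
  constructor
  · rintro ⟨w, rfl⟩
    exact ⟨(w : ℂ).arg, by rw [← key, Circle.exp_arg]⟩
  · rintro ⟨α, hα⟩
    exact ⟨Circle.exp α, by ext1; rw [hα, key]⟩

/-- The values lie in `{±i}` up to products, so the complex circle stabilizes; the value at `A_m`
shows that nothing else does. -/
theorem isAbelianRep_normalRep (m : Fin n) :
    IsAbelianRep ((normalRep σ ε hε z).comap (incl n)) := by
  have hn : ‖quat 0 1 0 0‖ = 1 := by
    have h1 : Quaternion.normSq (quat 0 1 0 0) = 1 := by rw [normSq_quat]; norm_num
    rw [Quaternion.normSq_eq_norm_mul_self] at h1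
    nlinarith [norm_nonneg (quat 0 1 0 0)]
  refine ⟨quat 0 1 0 0, rfl, hn, fun h => ?_⟩
  rw [← coe_qD_eq_iff, mem_stab_iff]
  constructor
  · intro hh
    have h1 := hh (.A m)
    rw [comap_incl_A, normalRep_of] at h1
    exact commute_qA_iff.1 h1
  · intro hh E
    cases E with
    | A i =>
      rw [comap_incl_A, normalRep_of]
      exact commute_qA_iff.2 hh
    | B i =>
      rw [comap_incl_B, normalRep_of, normalRep_of]
      change h * (qD (ε i) (z i) * qA (σ i) * (qD (ε i) (z i))⁻¹) =
        qD (ε i) (z i) * qA (σ i) * (qD (ε i) (z i))⁻¹ * h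
      rw [qD_conj_qA]
      exact commute_qA_iff.2 hh

end normal

theorem exists_normalRep {ρ : RepSpace (SurfaceGroup n)} (hρ : IsIrredRep ρ)
    (hab : IsAbelianRep (ρ.comap (incl n)))
    (hre : ∀ i, (ρ (SurfaceGroup.of (.A i))).re = 0) :
    ∃ (σ ε : Fin n → Bool) (hε : IsEven ε) (z : Fin n → Circle) (m : Fin n), ε m = true ∧
      CharVar.mk ρ = CharVar.mk (normalRep σ ε hε z) := by
  obtain ⟨P, hP0, hP1, hP⟩ := hab
  let p : SU2 := ⟨P, mem_unitary_of_normSq (by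
    rw [Quaternion.normSq_eq_norm_mul_self, hP1, mul_one])⟩
  -- The angle `π/2` gives the imaginary unit `P` itself, which is then conjugated to `i`.
  have hp : p ∈ stab (ρ.comap (incl n)) := (hP p).2 ⟨Real.pi / 2, by simp [p]⟩
  obtain ⟨h, hh⟩ := exists_conj_eq_qA (p := p) hP0
  let τ := RepSpace.conj h ρ
  have hτ : qA false ∈ stab (τ.comap (incl n)) := by
    have h1 : τ.comap (incl n) = RepSpace.conj h (ρ.comap (incl n)) := rfl
    rw [h1, mem_stab_conj, ← hh]
    convert hp using 1
    group
  rw [mem_stab_iff] at hτ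
  have hτre : ∀ i, (τ (SurfaceGroup.of (.A i))).re = 0 := fun i => by
    rw [RepSpace.conj_apply, SU2.re_conj, hre]
  have hA : ∀ i, ∃ b, τ (SurfaceGroup.of (.A i)) = qA b := fun i => by
    have h1 := hτ (.A i)
    rw [comap_incl_A] at h1
    exact exists_qA_of_commute h1.symm (hτre i)
  have hB : ∀ i, ∃ b, τ (SurfaceGroup.of (.D i)) * τ (SurfaceGroup.of (.A i)) *
      (τ (SurfaceGroup.of (.D i)))⁻¹ = qA b := fun i => by
    have h1 := hτ (.B i)
    rw [comap_incl_B] at h1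
    exact exists_qA_of_commute h1.symm (by rw [SU2.re_conj, hτre])
  choose σ hσ using hA
  choose β hβ using hB
  have hD : ∀ i, ∃ w, τ (SurfaceGroup.of (.D i)) = qD (xor (σ i) (β i)) w := fun i => by
    have h1 := hβ i
    rw [hσ, mul_inv_eq_iff_eq_mul] at h1
    exact exists_qD_of_conj h1
  choose z hz using hD
  let ε : Fin n → Bool := fun i => xor (σ i) (β i)
  have hval : ∀ E, τ (SurfaceGroup.of E) = normalVal σ ε z E := by
    intro E
    cases E with
    | A i => exact hσ i
    | D i => exact hz i
  have hε : IsEven ε := by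
    rw [IsEven, ← normalVal_relation σ ε z]
    have h1 := congrArg τ (surface_relation n)
    rw [map_list_prod, List.map_map, map_one] at h1
    rw [← h1]
    refine congrArg _ (List.map_congr_left fun l _ => ?_)
    rw [← hval, ← hval]
    simp [commutatorElement_def]
  have hτε : τ = normalRep σ ε hε z := RepSpace.ext_of fun E => by rw [hval, normalRep_of]
  -- If every `D_l` were a complex unit, `i` would lie in the stabilizer, against irreducibility.
  have hm : ∃ m, ε m = true := by
    by_contra hcon
    push Not at hcon
    have h1 : qA false ∈ stab τ := by
      rw [mem_stab_iff]
      intro E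
      change qA false * τ (SurfaceGroup.of E) = τ (SurfaceGroup.of E) * qA false
      rw [hval]
      cases E with
      | A i => exact (commute_qA_iff.2 ((commute_qA_iff (b := σ i)).1 rfl)).symm
      | D i =>
        have h2 : ε i = false := by simpa using hcon i
        change qA false * qD (ε i) (z i) = qD (ε i) (z i) * qA false
        rw [h2]
        exact (commute_qA_iff.2 ⟨z i, rfl⟩).symm
    rcases (isIrredRep_conj hρ (qA false)).1 h1 with h2 | h2
    · have := congrArg (fun q : ℍ[ℝ] => q.re) h2
      simp [coe_qA] at this
    · have := congrArg (fun q : ℍ[ℝ] => q.re) h2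
      simp [coe_qA] at this
  obtain ⟨m, hm⟩ := hm
  exact ⟨σ, ε, hε, z, m, hm, by rw [← hτε]; exact (mk_conj h ρ).symm⟩

end TracelessTangle

namespace TracelessTangle

/-! ### Topology of the character variety -/

instance : CompactSpace SU2 := by
  refine isCompact_iff_compactSpace.1 (?_ : IsCompact (unitary ℍ[ℝ] : Set ℍ[ℝ]))
  have : ProperSpace ℍ[ℝ] := FiniteDimensional.proper_real ℍ[ℝ]
  refine Metric.isCompact_of_isClosed_isBounded ?_ ?_
  · exact isClosed_unitary
  · refine (Metric.isBounded_closedBall (x := (0 : ℍ[ℝ])) (r := 1)).subset fun q hq => ?_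
    rw [mem_closedBall_zero_iff]
    exact (CStarRing.norm_of_mem_unitary hq).le

section

variable {G : Type} [Group G]

theorem continuous_repSpace_iff {X : Type} [TopologicalSpace X] {f : X → RepSpace G} :
    Continuous f ↔ ∀ g, Continuous fun x => f x g :=
  continuous_induced_rng.trans continuous_pi_iff

theorem continuous_eval (g : G) : Continuous fun ρ : RepSpace G => ρ g :=
  continuous_repSpace_iff.1 continuous_id g

instance : T2Space (RepSpace G) :=
  T2Space.of_injective_continuous (f := fun (ρ : RepSpace G) (g : G) => ρ g)
    DFunLike.coe_injective continuous_induced_dom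

theorem continuous_conj : Continuous fun p : SU2 × RepSpace G => RepSpace.conj p.1 p.2 := by
  rw [continuous_repSpace_iff]
  intro g
  simp only [RepSpace.conj_apply]
  have := (continuous_eval (G := G) g).comp (continuous_snd (X := SU2))
  exact (continuous_fst.mul this).mul continuous_fst.inv

theorem continuous_mk : Continuous (CharVar.mk : RepSpace G → CharVar G) := continuous_quot_mk

/-- The saturation of an open set is the union of its conjugates. -/
theorem isOpenQuotientMap_mk : IsOpenQuotientMap (CharVar.mk : RepSpace G → CharVar G) where
  surjective := Quotient.mk_surjective
  continuous := continuous_mk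
  isOpenMap := by
    intro U hU
    have hq : Topology.IsQuotientMap (CharVar.mk : RepSpace G → CharVar G) := isQuotientMap_quot_mk
    rw [← hq.isOpen_preimage]
    have : CharVar.mk ⁻¹' (CharVar.mk '' U) = ⋃ h : SU2, RepSpace.conj h ⁻¹' U := by
      ext ρ
      simp only [Set.mem_preimage, Set.mem_image, Set.mem_iUnion]
      constructor
      · rintro ⟨σ, hσ, hρ⟩
        obtain ⟨h, rfl⟩ := mk_eq_iff.1 hρ.symm
        exact ⟨h, hσ⟩
      · rintro ⟨h, hh⟩
        exact ⟨_, hh, mk_conj h ρ⟩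
    rw [this]
    exact isOpen_iUnion fun h =>
      hU.preimage (continuous_conj.comp (continuous_const.prodMk continuous_id))

theorem isClosed_graph_conj :
    IsClosed {p : SU2 × (RepSpace G × RepSpace G) | p.2.2 = RepSpace.conj p.1 p.2.1} := by
  have hsnd : Continuous fun p : SU2 × (RepSpace G × RepSpace G) => p.2.2 :=
    Continuous.snd continuous_snd
  have hpr : Continuous fun p : SU2 × (RepSpace G × RepSpace G) => (p.1, p.2.1) :=
    Continuous.prodMk continuous_fst (Continuous.fst continuous_snd)
  have hconj : Continuous fun p : SU2 × (RepSpace G × RepSpace G) => RepSpace.conj p.1 p.2.1 := by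
    have := (continuous_conj (G := G)).comp hpr
    exact this
  exact isClosed_eq hsnd hconj

/-- The conjugacy relation is the projection of a closed set along the compact factor `SU(2)`.
Together with openness of the quotient map this makes `CharVar` Hausdorff. -/
theorem isClosed_setOf_mk_eq :
    IsClosed {p : RepSpace G × RepSpace G | CharVar.mk p.1 = CharVar.mk p.2} := by
  have h2 := isClosedMap_snd_of_compactSpace (X := SU2) _ (isClosed_graph_conj (G := G))
  have h3 : {p : RepSpace G × RepSpace G | CharVar.mk p.1 = CharVar.mk p.2} =
      Prod.snd '' {p : SU2 × (RepSpace G × RepSpace G) | p.2.2 = RepSpace.conj p.1 p.2.1} := by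
    ext p
    constructor
    · intro h
      obtain ⟨k, hk⟩ := mk_eq_iff.1 h
      exact ⟨(k, p), hk, rfl⟩
    · rintro ⟨⟨k, q⟩, hk, rfl⟩
      exact mk_eq_iff.2 ⟨k, hk⟩
  rw [h3]
  exact h2

instance : T2Space (CharVar G) :=
  (t2Space_iff_of_isOpenQuotientMap isOpenQuotientMap_mk).2 isClosed_setOf_mk_eq

end

/-! ### The tori of exceptional classes -/

variable {n : ℕ}

theorem continuous_quat {X : Type} [TopologicalSpace X] {a b c d : X → ℝ} (ha : Continuous a)
    (hb : Continuous b) (hc : Continuous c) (hd : Continuous d) :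
    Continuous fun x => quat (a x) (b x) (c x) (d x) := by
  have : (fun x => quat (a x) (b x) (c x) (d x)) = fun x => a x • quat 1 0 0 0 +
      b x • quat 0 1 0 0 + c x • quat 0 0 1 0 + d x • quat 0 0 0 1 := by
    funext x
    ext <;> simp
  rw [this]
  fun_prop

theorem continuous_qD (e : Bool) : Continuous (qD e) := by
  have h1 : Continuous fun z : Circle => (z : ℂ).re := Complex.continuous_re.comp continuous_induced_dom
  have h2 : Continuous fun z : Circle => (z : ℂ).im := Complex.continuous_im.comp continuous_induced_dom
  rw [continuous_induced_rng]
  cases e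
  · exact continuous_quat h1 h2 continuous_const continuous_const
  · exact continuous_quat continuous_const continuous_const h1 h2

theorem continuous_normalRep (σ ε : Fin n → Bool) (hε : IsEven ε) :
    Continuous (normalRep σ ε hε) := by
  rw [continuous_repSpace_iff]
  refine presentedGroup_induction ?_ ?_ ?_ ?_
  · intro E
    have : (fun z => normalRep σ ε hε z (PresentedGroup.of E)) = fun z => normalVal σ ε z E :=
      funext fun z => normalRep_of σ ε hε z E
    rw [this]
    cases E with
    | A l => exact continuous_const
    | D l => exact (continuous_qD (ε l)).comp (continuous_apply l)
  · simpa only [map_one] using continuous_const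
  · intro a b ha hb
    simp only [map_mul]
    exact ha.mul hb
  · intro a ha
    simp only [map_inv]
    exact ha.inv

/-- The classes of the normal forms with given signs, where `z_m` is normalized to `1`. -/
def torusSet (σ ε : Fin n → Bool) (hε : IsEven ε) (m : Fin n) : Set (CharVar (SurfaceGroup n)) :=
  (fun z => CharVar.mk (normalRep σ ε hε z)) '' {z | z m = 1}

theorem isCompact_torusSet (σ ε : Fin n → Bool) (hε : IsEven ε) (m : Fin n) :
    IsCompact (torusSet σ ε hε m) :=
  (isClosed_eq (continuous_apply m) continuous_const).isCompact.image
    (continuous_mk.comp (continuous_normalRep σ ε hε))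

theorem mem_torusSet (σ ε : Fin n → Bool) (hε : IsEven ε) (z : Fin n → Circle) {m : Fin n}
    (hm : ε m = true) : CharVar.mk (normalRep σ ε hε z) ∈ torusSet σ ε hε m := by
  -- Conjugation by `w` rotates by `w²`, so a square root of the inverse of `z_m` is needed: half
  -- the argument, negated.
  obtain ⟨w, hw⟩ : ∃ w : Circle, w * w * z m = 1 := by
    refine ⟨Circle.exp (-((z m : ℂ).arg / 2)), ?_⟩
    rw [← Circle.exp_add, ← neg_add, add_halves, Circle.exp_neg, Circle.exp_arg, inv_mul_cancel]
  refine ⟨fun l => if ε l then w * w * z l else z l, by simp [hm, hw], ?_⟩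
  rw [eq_comm]
  refine mk_eq_iff.2 ⟨qD false w, RepSpace.ext_of fun E => ?_⟩
  rw [RepSpace.conj_apply, normalRep_of, normalRep_of]
  cases E with
  | A l => simp only [normalVal]; rw [qD_conj_qA, Bool.false_xor]
  | D l =>
    simp only [normalVal]
    cases ε l
    · rw [qD_conj_false]; simp
    · rw [qD_conj_true]; simp

/-- A conjugating element commutes with `A_m`, so it is a complex unit `w`. The normalization of
`z_m` forces `w² = 1`, and then conjugation changes nothing. -/
theorem normalRep_injective (σ ε : Fin n → Bool) (hε : IsEven ε) {m : Fin n} (hm : ε m = true)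
    {z z' : Fin n → Circle} (hz : z m = 1) (hz' : z' m = 1)
    (h : CharVar.mk (normalRep σ ε hε z) = CharVar.mk (normalRep σ ε hε z')) : z = z' := by
  obtain ⟨k, hk⟩ := mk_eq_iff.1 h
  have hk' : ∀ E, normalVal σ ε z' E = k * normalVal σ ε z E * k⁻¹ := fun E => by
    rw [← normalRep_of σ ε hε, hk, RepSpace.conj_apply, normalRep_of]
  obtain ⟨w, rfl⟩ := commute_qA_iff.1 (mul_inv_eq_iff_eq_mul.1 (hk' (.A m)).symm)
  have hD : ∀ l, qD (ε l) (z' l) = qD false w * qD (ε l) (z l) * (qD false w)⁻¹ := fun l =>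
    hk' (.D l)
  have hw : w * w = 1 := by
    have h1 := hD m
    rw [hm, qD_conj_true, hz, hz', mul_one] at h1
    exact (qD_injective true h1).symm
  funext l
  have h1 := hD l
  cases hl : ε l with
  | false =>
    rw [hl, qD_conj_false] at h1
    exact (qD_injective false h1).symm
  | true =>
    rw [hl, qD_conj_true, hw, one_mul] at h1
    exact (qD_injective true h1).symm

/-- The remaining coordinates parametrize the set by a continuous injection of a compact space into
a Hausdorff one, hence an embedding. The index `m` excludes `n = 0`, so `n - 1` is the true
difference. -/
theorem nonempty_homeomorph_torusSet (σ ε : Fin n → Bool) (hε : IsEven ε) {m : Fin n}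
    (hm : ε m = true) : Nonempty (torusSet σ ε hε m ≃ₜ (Fin (n - 1) → Circle)) := by
  obtain _ | k := n
  · exact m.elim0
  let f : (Fin k → Circle) → CharVar (SurfaceGroup (k + 1)) := fun z =>
    CharVar.mk (normalRep σ ε hε (m.insertNth (α := fun _ => Circle) 1 z))
  have hf : Continuous f := continuous_mk.comp ((continuous_normalRep σ ε hε).comp
    (Continuous.finInsertNth m continuous_const continuous_id))
  have hinj : Function.Injective f := by
    intro z z' h
    have h1 := normalRep_injective σ ε hε hm (by simp) (by simp) h
    exact (Fin.insertNth_injective2 h1).2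
  have hr : Set.range f = torusSet σ ε hε m := by
    ext x
    constructor
    · rintro ⟨z, rfl⟩
      exact ⟨_, by simp, rfl⟩
    · rintro ⟨z, hz, rfl⟩
      refine ⟨m.removeNth z, ?_⟩
      have : m.insertNth (α := fun _ => Circle) 1 (m.removeNth z) = z := by
        rw [← show z m = 1 from hz, Fin.insertNth_self_removeNth]
      simp only [f, this]
  rw [← hr]
  exact ⟨(hf.isClosedEmbedding hinj).isEmbedding.toHomeomorph.symm⟩

/-- The signs of the normal forms, with a sector where `D_m` anticommutes with `A_m`. -/
def SignData (n : ℕ) : Type :=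
  {p : (Fin n → Bool) × (Fin n → Bool) × Fin n // IsEven p.2.1 ∧ p.2.1 p.2.2 = true}

instance (n : ℕ) : Finite (SignData n) := Subtype.finite

/-- The torus of exceptional classes with the given signs. -/
def SignData.torus (d : SignData n) : Set (CharVar (SurfaceGroup n)) :=
  torusSet d.1.1 d.1.2.1 d.2.1 d.1.2.2

/-- The same torus may occur for several data, for instance for different choices of `m`; a finite
union is all that is claimed. -/
theorem exceptionalSet_eq_sUnion (n : ℕ) :
    exceptionalSet n = ⋃₀ Set.range (SignData.torus (n := n)) := by
  rw [exceptionalSet_eq]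
  ext x
  constructor
  · rintro ⟨ρ, ⟨hρ, hab, hre⟩, rfl⟩
    obtain ⟨σ, ε, hε, z, m, hm, h⟩ := exists_normalRep hρ hab hre
    exact ⟨_, ⟨⟨(σ, ε, m), hε, hm⟩, rfl⟩, h ▸ mem_torusSet σ ε hε z hm⟩
  · rintro ⟨_, ⟨⟨⟨σ, ε, m⟩, hε, hm⟩, rfl⟩, z, -, rfl⟩
    refine ⟨_, ⟨isIrredRep_normalRep σ ε hε z hm, isAbelianRep_normalRep σ ε hε z m,
      fun i => ?_⟩, rfl⟩
    rw [normalRep_of]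
    rfl

/-- Each choice of signs has its own neighbourhood of `0`; finitely many choices leave a common one.
-/
theorem eventually_submersiveAt_exceptionalSet {K : ℕ} (C : Fin K → SpecialCurve n)
    (hC : Function.Surjective C) : ∀ᶠ t in 𝓝 (0 : Fin K → ℝ), ∀ x ∈ exceptionalSet n,
      SubmersiveAt (Phi C x) t := by
  have h : ∀ᶠ t in 𝓝 (0 : Fin K → ℝ), ∀ d : SignData n, ∀ z : Fin n → Circle,
      SubmersiveAt (Phi C (CharVar.mk (normalRep d.1.1 d.1.2.1 d.2.1 z))) t :=
    Filter.eventually_all.2 fun d =>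
      eventually_submersiveAt_normalRep C hC d.1.1 d.1.2.1 d.2.1 d.2.2
  filter_upwards [h] with t ht x hx
  rw [exceptionalSet_eq_sUnion] at hx
  obtain ⟨_, ⟨d, rfl⟩, z, -, rfl⟩ := hx
  exact ht d z

end TracelessTangle

end

/-! ### The proposition. -/

open TracelessTangle
theorem proposition8p1 (n : ℕ) (C : Fin (8 * n ^ 2 - 5 * n) ≃ SpecialCurve n) :
    (∀ ρ : RepSpace (SurfaceGroup n),
      IsIrredRep ρ →
      IsAbelianRep (ρ.comap (incl n)) →
      (∀ i : Fin n, (ρ (SurfaceGroup.of (Gen.A i))).re = 0) →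
      (∀ t, Phi C (CharVar.mk ρ) t ∈ irredStratum (SurfaceGroup n)) ∧
        SubmersiveAt (Phi C (CharVar.mk ρ)) 0) ∧
    exceptionalSet n = CharVar.mk '' {ρ | IsIrredRep ρ ∧ IsAbelianRep (ρ.comap (incl n)) ∧
      ∀ i : Fin n, (ρ (SurfaceGroup.of (Gen.A i))).re = 0} ∧
    IsCompact (exceptionalSet n) ∧
    (∃ T : Set (Set (CharVar (SurfaceGroup n))), T.Finite ∧
      (∀ S ∈ T, Nonempty (S ≃ₜ (Fin (n - 1) → Circle))) ∧ exceptionalSet n = ⋃₀ T) ∧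
    ∃ U : Set (Fin (8 * n ^ 2 - 5 * n) → ℝ), IsOpen U ∧ 0 ∈ U ∧
      ∀ x ∈ exceptionalSet n, ∀ t ∈ U,
        Phi C x t ∈ irredStratum (SurfaceGroup n) ∧ SubmersiveAt (Phi C x) t := by
  have hsub := eventually_submersiveAt_exceptionalSet C C.surjective
  refine ⟨fun ρ hρ hab hre => ⟨fun t => phi_mem_irredStratum C hρ t, ?_⟩, exceptionalSet_eq n, ?_,
    ⟨Set.range SignData.torus, Set.finite_range _, ?_, exceptionalSet_eq_sUnion n⟩, ?_⟩
  · refine hsub.self_of_nhds _ ?_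
    rw [exceptionalSet_eq]
    exact ⟨ρ, ⟨hρ, hab, hre⟩, rfl⟩
  · rw [exceptionalSet_eq_sUnion]
    refine (Set.finite_range _).isCompact_sUnion ?_
    rintro _ ⟨d, rfl⟩
    exact isCompact_torusSet _ _ _ _
  · rintro _ ⟨d, rfl⟩
    exact nonempty_homeomorph_torusSet _ _ _ d.2.2
  · obtain ⟨U, hU, hUo, h0⟩ := eventually_nhds_iff.1 hsub
    refine ⟨U, hUo, h0, fun x hx t ht => ⟨?_, hU t ht x hx⟩⟩
    obtain ⟨ρ, hρ, rfl⟩ := hx.2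
    exact phi_mem_irredStratum C hρ t
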